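/- **Setting.** Let $\Phi\in\mathcal H^{11/6}(\mathbb R^2)$ be a real wavefront, identified with its continuous representative. Let $r\ge 1$ be an integer, let $\lambda,D,T,I_0>0$, and put $\alpha=r\lambda/D$, $\alpha_\lambda=2\pi\alpha/\lambda$. For a real pupil mask $M$ on $\mathbb R^2$ the complex amplitude in the pupil is $\psi_{M,\Phi}=M e^{-i\Phi}$. In the transmission-mask model of the pyramid sensor the amplitudes of the four beams on the detector and their intensities are, for $m,n\in\{0,1\}$, $$\psi^{mn}_{det}=\mathcal F^{-1}\big(T^{mn}\cdot\mathcal F\psi_{M,\Phi}\big),\qquad I^{mn}=|\psi^{mn}_{det}|^2,$$ where $T^{mn}$ is the indicator function of $\{(\xi,\eta):(-1)^m\xi\ge0,\ (-1)^n\eta\ge0\}$. The data of the non-modulated sensor are $$s^n_x=\frac{(I^{01}+I^{00})-(I^{11}+I^{10})}{I_0},\qquad s^n_y=\frac{(I^{01}+I^{11})-(I^{00}+I^{10})}{I_0}.$$ The data $s^c_x,s^c_y$ of the circularly modulated sensor are the averages $\frac1T\int_{-T/2}^{T/2}\cdot\,dt$ of the non-modulated data that belong to the phases $\Phi(x,y)+\alpha_\lambda\,(x\sin(2\pi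 t/T)+y\cos(2\pi t/T))$. **Operators.** Let $\Omega=\Omega_y\times\Omega_x=[a_y,b_y]\times[a_x,b_x]$ with $a_y<b_y$, $a_x<b_x$ (here $x\in\Omega_y$ and $y\in\Omega_x$), let $\mathcal X$ denote indicator functions, and put, for $\bullet\in\{n,c\}$, $$(P^{\bullet}_x\Phi)(x,y)=\frac{\mathcal X_\Omega(x,y)}{\pi}\,p.v.\!\int_{\Omega_y}\frac{\sin[\Phi(x',y)-\Phi(x,y)]\,k^{\bullet}(x'-x)}{x'-x}\,dx'+\frac{\mathcal X_{\Omega_y}(x)}{\pi^3}\,p.v.\!\int_{\Omega_y}p.v.\!\int_{\Omega_x}p.v.\!\int_{\Omega_x}\frac{\sin[\Phi(x',y')-\Phi(x,y'')]\,l^{\bullet}(x'-x,y''-y')}{(x'-x)(y'-y)(y''-y)}\,dy''\,dy'\,dx',$$ $$(P^{\bullet}_y\Phi)(x,y)=\frac{\mathcal X_\Omega(x,y)}{\pi}\,p.v.\!\int_{\Omega_x}\frac{\sin[\Phi(x,y')-\Phi(x,y)]\,k^{\bullet}(y'-y)}{y'-y}\,dy'+\frac{\mathcal X_{\Omega_x}(y)}{\pi^3}\,p.v.\!\int_{\Omega_y}p.v.\!\int_{\Omega_x}p.v.\!\int_{\Omega_y}\frac{\sin[\Phi(x',y')-\Phi(x'',y)]\,l^{\bullet}(x''-x',y'-y)}{(x'-x)(y'-y)(x''-x)}\,dx''\,dy'\,dx',$$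 where $k^n=1$, $l^n=1$, $k^c(x)=J_0(\alpha_\lambda x)$ with $J_0(x)=\frac1\pi\int_0^\pi\cos(x\sin t)\,dt$, and $$l^c(x,y)=\frac1T\int_{-T/2}^{T/2}\cos[\alpha_\lambda x\sin(2\pi t/T)]\cos[\alpha_\lambda y\cos(2\pi t/T)]\,dt.$$ Principal values are limits, as $\delta\to0^+$, of the integrals outside $[x-\delta,x+\delta]$ (respectively $[y-\delta,y+\delta]$). For a mask $M\in C_c^\infty(\mathbb R^2)$ (for instance a smoothed indicator function of any bounded pupil), $P^{\bullet}_{M,x}$ and $P^{\bullet}_{M,y}$ denote the operators obtained by replacing the indicator function of the pupil by $M$: all integrals are over $\mathbb R$, the factor $\mathcal X_\Omega(x,y)$ becomes $M(x,y)$, the one-dimensional integrands get the factor $M(x',y)$, respectively $M(x,y')$, and the triple integrands get the factor $M(x',y')M(x,y'')$, respectively $M(x',y')M(x'',y)$, in place of $\mathcal X_{\Omega_y}(x)$, respectively $\mathcal X_{\Omega_x}(y)$. **Theorem.** For the non-modulated ($\bullet=n$) and for the circularly modulated ($\bullet=c$) sensor: 1. (Smooth pupil.) For every real $M\in C_c^\infty(\mathbb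 R^2)$, the functions $T^{mn}\cdot\mathcal F\psi_{M,\Phi}$ (for $\bullet=c$: those of all tilted phases) are integrable, so that the amplitudes are defined at every point by absolutely convergent integrals, the time averages exist, all principal values in $P^{\bullet}_{M,x}\Phi$ and $P^{\bullet}_{M,y}\Phi$ exist at every point, and for all $(x,y)\in\mathbb R^2$ $$I_0\,s^{\bullet}_x(x,y)=-\tfrac12(P^{\bullet}_{M,x}\Phi)(x,y),\qquad I_0\,s^{\bullet}_y(x,y)=\tfrac12(P^{\bullet}_{M,y}\Phi)(x,y).$$ 2. (Sharp pupil.) For $M=\mathcal X_\Omega$, with $\mathcal F$ the Fourier transform on $L^2(\mathbb R^2)$, the data are elements of $L^1(\mathbb R^2)$ (for $\bullet=c$ the time average is a Bochner integral in $L^1$, which exists), all principal values in $P^{\bullet}_x\Phi$ and $P^{\bullet}_y\Phi$ exist at every $(x,y)$ with $x\notin\{a_y,b_y\}$, $y\notin\{a_x,b_x\}$, and for almost every $(x,y)\in\mathbb R^2$ $$I_0\,s^{\bullet}_x(x,y)=-\tfrac12(P^{\bullet}_x\Phi)(x,y),\qquad I_0\,s^{\bullet}_y(x,y)=\tfrac12(P^{\bullet}_y\Phi)(x,y).$$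 In particular, with the intensities normalized so that $I_0=1$, $s_x^{\bullet}=-\tfrac12P_x^{\bullet}\Phi$ and $s_y^{\bullet}=\tfrac12P_y^{\bullet}\Phi$. -/

import Mathlib

open MeasureTheory Filter Topology
open scoped FourierTransform SchwartzMap ContDiff

namespace PyramidSensor

noncomputable section

/-- The plane `ℝ²` (pupil plane, focal plane and detector plane). -/
abbrev Plane : Type := EuclideanSpace ℝ (Fin 2)

/-! ### Wavefronts -/

/-- The real function `Φ` on the plane belongs to the `L²`-based Sobolev space `H^s(ℝ²)`. -/
def MemH (s : ℝ) (Φ : Plane → ℝ) : Prop :=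
  ∃ h : MemLp (fun z => (Φ z : ℂ)) 2 (volume : Measure Plane),
    TemperedDistribution.MemSobolev s 2
      ((h.toLp (fun z => (Φ z : ℂ)) : Lp ℂ 2 (volume : Measure Plane)) : 𝓢'(Plane, ℂ))

/-! ### Modulation -/

/-- The operating regime of the sensor: no modulation (superscript `n`), or circular
modulation (superscript `c`). -/
inductive Regime
  | nonmodulated
  | circular

/-- The modulation parameter `α_λ = 2πα/λ` with `α = rλ/D`. -/
def modParam (r : ℕ) (lam D : ℝ) : ℝ := 2 * Real.pi * (r * lam / D) / lam

/-- The periodic tilt `Φ^mod(x, y, t) = α_λ (x sin(2πt/T) + y cos(2πt/T))`. -/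
def tilt (α T t : ℝ) (z : Plane) : ℝ :=
  α * (z 0 * Real.sin (2 * Real.pi * t / T) + z 1 * Real.cos (2 * Real.pi * t / T))

/-- The phase at time `t` under circular modulation. -/
def tilted (α T : ℝ) (Φ : Plane → ℝ) (t : ℝ) (z : Plane) : ℝ := Φ z + tilt α T t z

/-- The zero-order Bessel function of the first kind. -/
def besselJ0 (x : ℝ) : ℝ := (1 / Real.pi) * ∫ t in (0 : ℝ)..Real.pi, Real.cos (x * Real.sin t)

/-- The kernels `k^n = 1` and `k^c(x) = J₀(α_λ x)`. -/
def kKer (α : ℝ) : Regime → ℝ → ℝ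
  | .nonmodulated, _ => 1
  | .circular, x => besselJ0 (α * x)

/-- The kernels `l^n = 1` and `l^c`, a time average of products of cosines. -/
def lKer (α T : ℝ) : Regime → ℝ → ℝ → ℝ
  | .nonmodulated, _, _ => 1
  | .circular, x, y => (1 / T) * ∫ t in (-T / 2)..(T / 2),
      Real.cos (α * x * Real.sin (2 * Real.pi * t / T)) *
        Real.cos (α * y * Real.cos (2 * Real.pi * t / T))

/-! ### Principal values -/

/-- `p.v. ∫_S f`, where `f` is singular at `a`. -/
def pv (S : Set ℝ) (a : ℝ) (f : ℝ → ℝ) : ℝ :=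
  limUnder (𝓝[>] (0 : ℝ)) (fun δ => ∫ t in S \ Set.Icc (a - δ) (a + δ), f t)

/-- The principal value `p.v. ∫_S f` with singularity at `a` exists: the truncated integrals are
Lebesgue integrals, and they have a finite limit. -/
def PVExists (S : Set ℝ) (a : ℝ) (f : ℝ → ℝ) : Prop :=
  (∀ δ : ℝ, 0 < δ → IntegrableOn f (S \ Set.Icc (a - δ) (a + δ))) ∧
    ∃ L : ℝ, Tendsto (fun δ => ∫ t in S \ Set.Icc (a - δ) (a + δ), f t) (𝓝[>] (0 : ℝ)) (𝓝 L)

/-- The iterated principal value `p.v. ∫_{S₁} p.v. ∫_{S₂} p.v. ∫_{S₃} F(u, v, w) dw dv du`, with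
singularities at `u = a₁`, `v = a₂`, `w = a₃`. -/
def pv3 (S₁ S₂ S₃ : Set ℝ) (a₁ a₂ a₃ : ℝ) (F : ℝ → ℝ → ℝ → ℝ) : ℝ :=
  pv S₁ a₁ fun u => pv S₂ a₂ fun v => pv S₃ a₃ fun w => F u v w

/-- All principal values in `pv3` exist. -/
def PV3Exists (S₁ S₂ S₃ : Set ℝ) (a₁ a₂ a₃ : ℝ) (F : ℝ → ℝ → ℝ → ℝ) : Prop :=
  (∀ u v : ℝ, PVExists S₃ a₃ fun w => F u v w) ∧
    (∀ u : ℝ, PVExists S₂ a₂ fun v => pv S₃ a₃ fun w => F u v w) ∧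
      PVExists S₁ a₁ fun u => pv S₂ a₂ fun v => pv S₃ a₃ fun w => F u v w

/-! ### Integrands of the pyramid operators -/

/-- Integrand (in `x'`) of the one-dimensional term of the `x`-operator. -/
def singleX (k : ℝ → ℝ) (Φ : Plane → ℝ) (x y x' : ℝ) : ℝ :=
  Real.sin (Φ !₂[x', y] - Φ !₂[x, y]) * k (x' - x) / (x' - x)

/-- Integrand (in `x', y', y''`) of the three-dimensional term of the `x`-operator. -/
def tripleX (l : ℝ → ℝ → ℝ) (Φ : Plane → ℝ) (x y x' y' y'' : ℝ) : ℝ :=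
  Real.sin (Φ !₂[x', y'] - Φ !₂[x, y'']) * l (x' - x) (y'' - y') /
    ((x' - x) * (y' - y) * (y'' - y))

/-- Integrand (in `y'`) of the one-dimensional term of the `y`-operator. -/
def singleY (k : ℝ → ℝ) (Φ : Plane → ℝ) (x y y' : ℝ) : ℝ :=
  Real.sin (Φ !₂[x, y'] - Φ !₂[x, y]) * k (y' - y) / (y' - y)

/-- Integrand (in `x', y', x''`) of the three-dimensional term of the `y`-operator. -/
def tripleY (l : ℝ → ℝ → ℝ) (Φ : Plane → ℝ) (x y x' y' x'' : ℝ) : ℝ :=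
  Real.sin (Φ !₂[x', y'] - Φ !₂[x'', y]) * l (x'' - x') (y' - y) /
    ((x' - x) * (y' - y) * (x'' - x))

/-! ### The pyramid operators for the sharp pupil `Ω = Ω_y × Ω_x`

Here `Ωy` is the set of the first coordinates `x` and `Ωx` that of the second coordinates `y`. -/

/-- The indicator function with values `0` and `1` in `ℝ`. -/
def chi {X : Type*} (S : Set X) : X → ℝ := S.indicator fun _ => 1

/-- The pupil `Ω = Ω_y × Ω_x` as a subset of the plane. -/
def pupil (Ωy Ωx : Set ℝ) : Set Plane := {z | z 0 ∈ Ωy ∧ z 1 ∈ Ωx}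

/-- The pyramid operator in `x`-direction. -/
def pyrX (Ωy Ωx : Set ℝ) (k : ℝ → ℝ) (l : ℝ → ℝ → ℝ) (Φ : Plane → ℝ) (x y : ℝ) : ℝ :=
  (1 / Real.pi) * chi (pupil Ωy Ωx) !₂[x, y] * pv Ωy x (singleX k Φ x y) +
    (1 / Real.pi ^ 3) * chi Ωy x * pv3 Ωy Ωx Ωx x y y (tripleX l Φ x y)

/-- The pyramid operator in `y`-direction. -/
def pyrY (Ωy Ωx : Set ℝ) (k : ℝ → ℝ) (l : ℝ → ℝ → ℝ) (Φ : Plane → ℝ) (x y : ℝ) : ℝ :=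
  (1 / Real.pi) * chi (pupil Ωy Ωx) !₂[x, y] * pv Ωx y (singleY k Φ x y) +
    (1 / Real.pi ^ 3) * chi Ωx y * pv3 Ωy Ωx Ωy x y x (tripleY l Φ x y)

/-- All principal values in `pyrX` and `pyrY` exist at `(x, y)`. -/
def PyrDefined (Ωy Ωx : Set ℝ) (k : ℝ → ℝ) (l : ℝ → ℝ → ℝ) (Φ : Plane → ℝ) (x y : ℝ) : Prop :=
  PVExists Ωy x (singleX k Φ x y) ∧ PV3Exists Ωy Ωx Ωx x y y (tripleX l Φ x y) ∧
    PVExists Ωx y (singleY k Φ x y) ∧ PV3Exists Ωy Ωx Ωy x y x (tripleY l Φ x y)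

/-! ### The pyramid operators for a smooth pupil mask `M`

The indicator function of the pupil is replaced by `M` throughout: the integrals over lines of the
pupil become integrals over `ℝ` with the weight `M`. -/

/-- The pyramid operator in `x`-direction for the mask `M`. -/
def maskPyrX (M : Plane → ℝ) (k : ℝ → ℝ) (l : ℝ → ℝ → ℝ) (Φ : Plane → ℝ) (x y : ℝ) : ℝ :=
  (1 / Real.pi) * M !₂[x, y] * pv Set.univ x (fun x' => M !₂[x', y] * singleX k Φ x y x') +
    (1 / Real.pi ^ 3) * pv3 Set.univ Set.univ Set.univ x y y
      (fun x' y' y'' => M !₂[x', y'] * M !₂[x, y''] * tripleX l Φ x y x' y' y'')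

/-- The pyramid operator in `y`-direction for the mask `M`. -/
def maskPyrY (M : Plane → ℝ) (k : ℝ → ℝ) (l : ℝ → ℝ → ℝ) (Φ : Plane → ℝ) (x y : ℝ) : ℝ :=
  (1 / Real.pi) * M !₂[x, y] * pv Set.univ y (fun y' => M !₂[x, y'] * singleY k Φ x y y') +
    (1 / Real.pi ^ 3) * pv3 Set.univ Set.univ Set.univ x y x
      (fun x' y' x'' => M !₂[x', y'] * M !₂[x'', y] * tripleY l Φ x y x' y' x'')

/-- All principal values in `maskPyrX` and `maskPyrY` exist at `(x, y)`. -/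
def MaskPyrDefined (M : Plane → ℝ) (k : ℝ → ℝ) (l : ℝ → ℝ → ℝ) (Φ : Plane → ℝ) (x y : ℝ) : Prop :=
  PVExists Set.univ x (fun x' => M !₂[x', y] * singleX k Φ x y x') ∧
    PV3Exists Set.univ Set.univ Set.univ x y y
      (fun x' y' y'' => M !₂[x', y'] * M !₂[x, y''] * tripleX l Φ x y x' y' y'') ∧
    PVExists Set.univ y (fun y' => M !₂[x, y'] * singleY k Φ x y y') ∧
    PV3Exists Set.univ Set.univ Set.univ x y x
      (fun x' y' x'' => M !₂[x', y'] * M !₂[x'', y] * tripleY l Φ x y x' y' x'')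

/-! ### Fourier optics of the transmission mask model -/

/-- The complex amplitude in the pupil plane, `M · exp(-iΦ)`, for the pupil mask `M`. -/
def aperture (M Φ : Plane → ℝ) (z : Plane) : ℂ := (M z : ℂ) * Complex.exp (-Complex.I * (Φ z : ℂ))

/-- The transmission function `T^{mn}` of a facet of the pyramid: the indicator function of the
quadrant `(-1)^m ξ ≥ 0`, `(-1)^n η ≥ 0`. -/
def facet (m n : Fin 2) : Plane → ℂ :=
  {ζ : Plane | 0 ≤ (-1 : ℝ) ^ (m : ℕ) * ζ 0 ∧ 0 ≤ (-1 : ℝ) ^ (n : ℕ) * ζ 1}.indicator fun _ => 1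

/-- The combination of the four intensities that is measured in `x`-direction. -/
def combX (I₀ : ℝ) (I : Fin 2 → Fin 2 → ℝ) : ℝ := ((I 0 1 + I 0 0) - (I 1 1 + I 1 0)) / I₀

/-- The combination of the four intensities that is measured in `y`-direction. -/
def combY (I₀ : ℝ) (I : Fin 2 → Fin 2 → ℝ) : ℝ := ((I 0 1 + I 1 1) - (I 0 0 + I 1 0)) / I₀

/-! #### Pointwise version, by absolutely convergent inverse Fourier integrals

The transmission functions are homogeneous of degree zero, so that the normalization of the
Fourier transform plays no role. -/

/-- The amplitude in the focal plane behind the facet `(m, n)`. -/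
def focal (m n : Fin 2) (ψ : Plane → ℂ) (ζ : Plane) : ℂ := facet m n ζ * 𝓕 ψ ζ

/-- The amplitude on the detector of the beam `(m, n)`. -/
def detAmp (m n : Fin 2) (ψ : Plane → ℂ) : Plane → ℂ := 𝓕⁻ (focal m n ψ)

/-- The intensities `ψ_det · conj ψ_det` of the four beams on the detector. -/
def intensity (ψ : Plane → ℂ) (z : Plane) (m n : Fin 2) : ℝ := Complex.normSq (detAmp m n ψ z)

/-- The sensor data in `x`-direction for the pupil mask `M`. -/
def dataX (I₀ α T : ℝ) (M : Plane → ℝ) : Regime → (Plane → ℝ) → ℝ → ℝ → ℝ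
  | .nonmodulated, Φ, x, y => combX I₀ (intensity (aperture M Φ) !₂[x, y])
  | .circular, Φ, x, y => (1 / T) * ∫ t in (-T / 2)..(T / 2),
      combX I₀ (intensity (aperture M (tilted α T Φ t)) !₂[x, y])

/-- The sensor data in `y`-direction for the pupil mask `M`. -/
def dataY (I₀ α T : ℝ) (M : Plane → ℝ) : Regime → (Plane → ℝ) → ℝ → ℝ → ℝ
  | .nonmodulated, Φ, x, y => combY I₀ (intensity (aperture M Φ) !₂[x, y])
  | .circular, Φ, x, y => (1 / T) * ∫ t in (-T / 2)..(T / 2),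
      combY I₀ (intensity (aperture M (tilted α T Φ t)) !₂[x, y])

/-- The integrals in `dataX` and `dataY` exist: the inverse Fourier integrals converge absolutely,
and, under modulation, the momentary data are integrable in time. -/
def DataDefined (I₀ α T : ℝ) (M : Plane → ℝ) : Regime → (Plane → ℝ) → Prop
  | .nonmodulated, Φ => ∀ m n : Fin 2, Integrable (focal m n (aperture M Φ))
  | .circular, Φ =>
      (∀ (t : ℝ) (m n : Fin 2), Integrable (focal m n (aperture M (tilted α T Φ t)))) ∧
      ∀ x y : ℝ,
        IntervalIntegrable
          (fun t => combX I₀ (intensity (aperture M (tilted α T Φ t)) !₂[x, y]))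
          volume (-T / 2) (T / 2) ∧
        IntervalIntegrable
          (fun t => combY I₀ (intensity (aperture M (tilted α T Φ t)) !₂[x, y]))
          volume (-T / 2) (T / 2)

/-! #### `L²` version, by the Fourier-Plancherel transform -/

open scoped Classical in
/-- The class in `L²` of a square-integrable function (zero for other functions). -/
def toL2 (f : Plane → ℂ) : Lp ℂ 2 (volume : Measure Plane) :=
  if h : MemLp f 2 (volume : Measure Plane) then h.toLp f else 0

open scoped Classical in
/-- The class in `L¹` of an integrable function (zero for other functions). -/
def toL1 (f : Plane → ℝ) : Lp ℝ 1 (volume : Measure Plane) :=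
  if h : MemLp f 1 (volume : Measure Plane) then h.toLp f else 0

/-- The amplitude on the detector of the beam `(m, n)`, as an element of `L²`. -/
def detAmpL2 (m n : Fin 2) (ψ : Plane → ℂ) : Lp ℂ 2 (volume : Measure Plane) :=
  𝓕⁻ (toL2 fun ζ => facet m n ζ * (𝓕 (toL2 ψ) : Lp ℂ 2 (volume : Measure Plane)) ζ)

/-- The intensities of the four beams on the detector, almost everywhere. -/
def intensityL2 (ψ : Plane → ℂ) (z : Plane) (m n : Fin 2) : ℝ := Complex.normSq (detAmpL2 m n ψ z)

/-- The sensor data in `x`-direction for the pupil mask `M`, as an element of `L¹`; under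
modulation the time average is a Bochner integral. -/
def dataXL1 (I₀ α T : ℝ) (M : Plane → ℝ) :
    Regime → (Plane → ℝ) → Lp ℝ 1 (volume : Measure Plane)
  | .nonmodulated, Φ => toL1 fun z => combX I₀ (intensityL2 (aperture M Φ) z)
  | .circular, Φ => (1 / T) • ∫ t in (-T / 2)..(T / 2),
      toL1 fun z => combX I₀ (intensityL2 (aperture M (tilted α T Φ t)) z)

/-- The sensor data in `y`-direction for the pupil mask `M`, as an element of `L¹`. -/
def dataYL1 (I₀ α T : ℝ) (M : Plane → ℝ) :
    Regime → (Plane → ℝ) → Lp ℝ 1 (volume : Measure Plane)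
  | .nonmodulated, Φ => toL1 fun z => combY I₀ (intensityL2 (aperture M Φ) z)
  | .circular, Φ => (1 / T) • ∫ t in (-T / 2)..(T / 2),
      toL1 fun z => combY I₀ (intensityL2 (aperture M (tilted α T Φ t)) z)

/-- Under modulation, the Bochner integrals in `dataXL1` and `dataYL1` exist. -/
def DataL1Defined (I₀ α T : ℝ) (M : Plane → ℝ) : Regime → (Plane → ℝ) → Prop
  | .nonmodulated, _ => True
  | .circular, Φ =>
      IntervalIntegrable
        (fun t => toL1 fun z => combX I₀ (intensityL2 (aperture M (tilted α T Φ t)) z))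
        volume (-T / 2) (T / 2) ∧
      IntervalIntegrable
        (fun t => toL1 fun z => combY I₀ (intensityL2 (aperture M (tilted α T Φ t)) z))
        volume (-T / 2) (T / 2)

/-! The following facts show that the default values in `toL2` and `toL1` are never used. -/

theorem measurable_facet (m n : Fin 2) : Measurable (facet m n) := by
  have h0 : Measurable fun ζ : Plane => ζ 0 := by fun_prop
  have h1 : Measurable fun ζ : Plane => ζ 1 := by fun_prop
  exact measurable_const.indicator
    ((measurableSet_le measurable_const (h0.const_mul _)).inter
      (measurableSet_le measurable_const (h1.const_mul _)))

theorem norm_facet_le (m n : Fin 2) (ζ : Plane) : ‖facet m n ζ‖ ≤ 1 := by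
  unfold facet
  by_cases h : ζ ∈ {ζ : Plane | 0 ≤ (-1 : ℝ) ^ (m : ℕ) * ζ 0 ∧ 0 ≤ (-1 : ℝ) ^ (n : ℕ) * ζ 1}
  · simp [Set.indicator_of_mem h]
  · simp [Set.indicator_of_notMem h]

theorem memLp_facet_mul (m n : Fin 2) (u : Lp ℂ 2 (volume : Measure Plane)) :
    MemLp (fun ζ => facet m n ζ * u ζ) 2 (volume : Measure Plane) := by
  refine (Lp.memLp u).mono
    ((measurable_facet m n).aestronglyMeasurable.mul (Lp.aestronglyMeasurable u))
    (Eventually.of_forall fun ζ => ?_)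
  rw [norm_mul]
  exact mul_le_of_le_one_left (norm_nonneg _) (norm_facet_le m n ζ)

theorem memLp_intensityL2 (ψ : Plane → ℂ) (m n : Fin 2) :
    MemLp (fun z => intensityL2 ψ z m n) 1 (volume : Measure Plane) := by
  have h := (Lp.memLp (detAmpL2 m n ψ)).integrable_norm_pow (by norm_num)
  rw [memLp_one_iff_integrable]
  refine h.congr (Eventually.of_forall fun z => ?_)
  simp [intensityL2, Complex.normSq_eq_norm_sq]

theorem memLp_combX (I₀ : ℝ) (ψ : Plane → ℂ) :
    MemLp (fun z => combX I₀ (intensityL2 ψ z)) 1 (volume : Measure Plane) := by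
  have h := memLp_intensityL2 ψ
  simpa [combX, div_eq_inv_mul] using
    ((((h 0 1).add (h 0 0)).sub ((h 1 1).add (h 1 0))).const_mul I₀⁻¹)

theorem memLp_combY (I₀ : ℝ) (ψ : Plane → ℂ) :
    MemLp (fun z => combY I₀ (intensityL2 ψ z)) 1 (volume : Measure Plane) := by
  have h := memLp_intensityL2 ψ
  simpa [combY, div_eq_inv_mul] using
    ((((h 0 1).add (h 1 1)).sub ((h 0 0).add (h 1 0))).const_mul I₀⁻¹)

theorem memLp_aperture (a b c d : ℝ) (Φ : Plane → ℝ) (hΦ : Continuous Φ) :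
    MemLp (aperture (chi (pupil (Set.Icc a b) (Set.Icc c d))) Φ) 2 (volume : Measure Plane) := by
  have hm : MeasurableSet (pupil (Set.Icc a b) (Set.Icc c d)) := by
    have h0 : Measurable fun z : Plane => z 0 := by fun_prop
    have h1 : Measurable fun z : Plane => z 1 := by fun_prop
    exact (h0 measurableSet_Icc).inter (h1 measurableSet_Icc)
  have hb : Bornology.IsBounded (pupil (Set.Icc a b) (Set.Icc c d)) := by
    refine (Metric.isBounded_iff_subset_closedBall (0 : Plane)).2
      ⟨|a| + |b| + (|c| + |d|), fun z hz => ?_⟩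
    have e0 : |z 0| ≤ |a| + |b| := by
      have := hz.1.1; have := hz.1.2
      rw [abs_le]; constructor <;>
      linarith [neg_abs_le a, neg_abs_le b, le_abs_self a, le_abs_self b, abs_nonneg a, abs_nonneg b]
    have e1 : |z 1| ≤ |c| + |d| := by
      have := hz.2.1; have := hz.2.2
      rw [abs_le]; constructor <;>
      linarith [neg_abs_le c, neg_abs_le d, le_abs_self c, le_abs_self d, abs_nonneg c, abs_nonneg d]
    rw [mem_closedBall_zero_iff, EuclideanSpace.norm_eq, Fin.sum_univ_two]
    refine Real.sqrt_le_iff.2 ⟨by positivity, ?_⟩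
    simp only [Real.norm_eq_abs]
    nlinarith [abs_nonneg (z 0), abs_nonneg (z 1)]
  have hfin : volume (pupil (Set.Icc a b) (Set.Icc c d)) ≠ ⊤ := hb.measure_lt_top.ne
  have h1 : MemLp ((pupil (Set.Icc a b) (Set.Icc c d)).indicator fun _ => (1 : ℝ)) 2
      (volume : Measure Plane) := memLp_indicator_const 2 hm 1 (Or.inr hfin)
  have hmeas : Measurable (aperture (chi (pupil (Set.Icc a b) (Set.Icc c d))) Φ) := by
    unfold aperture chi
    exact (Complex.measurable_ofReal.comp (measurable_const.indicator hm)).mul (by fun_prop)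
  refine h1.mono hmeas.aestronglyMeasurable (Eventually.of_forall fun z => ?_)
  simp [aperture, chi, Complex.norm_exp]

end

end PyramidSensor

open PyramidSensor

/-!
Why the theorem holds. Since `11/6 > 1 + 1/2`, the Fourier transform `G` of the wavefront
satisfies `∫ (1 + ‖ξ‖²)^(1/4) |G ξ| dξ < ∞` (`exists_fourierInv_eq`). Hence `Φ` is Hölder
continuous with exponent `1/2` (`exists_holder`), and as a member of the Wiener algebra it
yields amplitudes `M exp(-iΦ)` with integrable Fourier transform for every smooth mask `M`
(`integrable_fourier_mul_exp`).

*Smooth masks.* The indicator function of a quadrant is `¼ (1 ± sign ξ) (1 ± sign η)` almost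
everywhere, and multiplication by `sign` in the frequency domain is the Hilbert transform: this
is the Dirichlet integral, integrated against an absolutely convergent superposition of
exponentials (`hilb_integral_exp`). So the amplitude of a beam is `¼ (ψ ± i H_x ψ ± i H_y ψ ±
H_x H_y ψ)` up to the normalization of the Hilbert transforms (`Amplitude.detAmp_eq`), and in
the combinations of the four intensities only the interference terms of `ψ` with `H_x ψ` and of
`H_y ψ` with `H_x H_y ψ` survive, with `x` and `y` exchanged for the second combination
(`Amplitude.mul_combX_intensity`, `Amplitude.mul_combY_intensity`). Products of Hilbert
transforms at one point are iterated principal values of products, whose numerators are the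
sines in the pyramid operators. All these singular integrals are written in the symmetrized form
`hilb`, which converges absolutely for Hölder functions; Hölder bounds propagate through
iterated integrals at the cost of half of the exponent (`BddHolder.hilb`), and make it possible
to exchange them with averages (`hilb3_integral`) and limits (`tendsto_hilb3`). The time average
of the sine of a tilted phase difference is the sine of the phase difference times `l^c`, by
symmetry of the circle (`integral_sin_add`), and `l^c` reduces to `k^c` if one argument
vanishes; this gives `smooth_circular`.

*Sharp pupils.* Indicator functions of intervals are constant near points off the endpoints, so
that they are admissible cutoffs for the same singular integrals; this gives the existence of
the principal values (`pyrDefined_circular`). Smooth masks that tend to the indicator function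
of the pupil have pyramid operators that converge off the lines through the edges
(`tendsto_maskPyrX`, `tendsto_maskPyrY`). By Plancherel's theorem, the intensities depend
continuously in `L¹` on the amplitude in `L²`; so the data of the smooth masks, which for these
masks agree with the pointwise data (`detAmpL2_ae`, `coeFn_intervalIntegral`), converge in `L¹`
to the data of the sharp pupil, and almost everywhere along a subsequence
(`ae_eq_of_tendsto_data`).

The sensor without modulation is the case of the modulation parameter zero.
-/

namespace PyramidSensor

noncomputable section

/-! ### Singular integrals of Hölder functions with bounded support -/

section Hilb

variable {E F : Type*} [NormedAddCommGroup E] [NormedSpace ℝ E] [NormedAddCommGroup F]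
  [NormedSpace ℝ F]

/-- The (unnormalized) Hilbert transform `p.v. ∫ g(s) / (s - a) ds`, in the symmetrized form
`∫_{h > 0} (g(a + h) - g(a - h)) / h dh`, which converges absolutely for the functions of interest
and makes sense for vector-valued functions. -/
def hilb (g : ℝ → E) (a : ℝ) : E := ∫ h in Set.Ioi (0 : ℝ), h⁻¹ • (g (a + h) - g (a - h))

/-- Quantitative hypotheses under which `hilb g a` converges absolutely: a Hölder condition at the
single point `a`, and support in a ball around `a`. -/
structure HolderAt (β C R a : ℝ) (g : ℝ → E) : Prop where
  meas : StronglyMeasurable g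
  holder : ∀ w, ‖g w - g a‖ ≤ C * |w - a| ^ β
  supp : ∀ w, R ≤ |w - a| → g w = 0

/-- The dominating function `h ^ (β - 1)` on `h < R`. -/
def domFn (β R : ℝ) : ℝ → ℝ := (Set.Iio R).indicator fun h => h ^ (β - 1)

theorem domFn_nonneg {β R h : ℝ} (hh : 0 < h) : 0 ≤ domFn β R h := by
  unfold domFn
  exact Set.indicator_apply_nonneg fun _ => (Real.rpow_pos_of_pos hh _).le

theorem integrableOn_domFn {β : ℝ} (hβ : 0 < β) (R : ℝ) :
    IntegrableOn (domFn β R) (Set.Ioi 0) := by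
  unfold domFn
  rw [IntegrableOn, integrable_indicator_iff measurableSet_Iio, IntegrableOn,
    Measure.restrict_restrict measurableSet_Iio, ← IntegrableOn]
  rcases le_or_gt R 0 with hR | hR
  · have : Set.Iio R ∩ Set.Ioi 0 = ∅ := by
      ext x; simp; intro h; linarith
    simp [this]
  · have h := (intervalIntegral.intervalIntegrable_rpow' (r := β - 1) (by linarith)
      (a := 0) (b := R)).1
    exact h.mono_set fun x hx => ⟨hx.2, hx.1.le⟩

theorem setIntegral_domFn_nonneg (β R : ℝ) : 0 ≤ ∫ h in Set.Ioi (0 : ℝ), domFn β R h :=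
  setIntegral_nonneg measurableSet_Ioi fun _ hx => domFn_nonneg hx

namespace HolderAt

variable {β C R a : ℝ} {g : ℝ → E}

omit [NormedSpace ℝ E] in
theorem const_nonneg (hg : HolderAt β C R a g) : 0 ≤ C := by
  have := (norm_nonneg _).trans (hg.holder (a + 1))
  simpa using this

theorem norm_quot_le (hg : HolderAt β C R a g) {h : ℝ} (hh : 0 < h) :
    ‖h⁻¹ • (g (a + h) - g (a - h))‖ ≤ 2 * C * domFn β R h := by
  have hC := hg.const_nonneg
  unfold domFn
  by_cases hR : h < R
  · rw [Set.indicator_of_mem (by exact hR), norm_smul, Real.norm_eq_abs, abs_inv, abs_of_pos hh]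
    have h1 := hg.holder (a + h)
    have h2 := hg.holder (a - h)
    rw [add_sub_cancel_left, abs_of_pos hh] at h1
    rw [sub_sub_cancel_left, abs_neg, abs_of_pos hh] at h2
    have h3 : ‖g (a + h) - g (a - h)‖ ≤ 2 * C * h ^ β := by
      calc _ = ‖(g (a + h) - g a) - (g (a - h) - g a)‖ := by congr 1; abel
        _ ≤ _ := (norm_sub_le _ _).trans (by linarith)
    rw [Real.rpow_sub_one hh.ne']
    calc _ ≤ h⁻¹ * (2 * C * h ^ β) := by gcongr
      _ = _ := by ring
  · rw [Set.indicator_of_notMem (by exact hR), hg.supp (a + h), hg.supp (a - h)]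
    · simp
    · rw [sub_sub_cancel_left, abs_neg, abs_of_pos hh]; linarith
    · rw [add_sub_cancel_left, abs_of_pos hh]; linarith

theorem stronglyMeasurable_quot (hg : HolderAt β C R a g) :
    StronglyMeasurable fun h : ℝ => h⁻¹ • (g (a + h) - g (a - h)) := by
  refine StronglyMeasurable.smul (by fun_prop) (StronglyMeasurable.sub ?_ ?_)
  · exact hg.meas.comp_measurable (by fun_prop)
  · exact hg.meas.comp_measurable (by fun_prop)

theorem integrableOn_quot (hβ : 0 < β) (hg : HolderAt β C R a g) :
    IntegrableOn (fun h : ℝ => h⁻¹ • (g (a + h) - g (a - h))) (Set.Ioi 0) := by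
  refine Integrable.mono' ((integrableOn_domFn hβ R).const_mul (2 * C))
    hg.stronglyMeasurable_quot.aestronglyMeasurable ?_
  filter_upwards [ae_restrict_mem measurableSet_Ioi] with h hh using hg.norm_quot_le hh

theorem norm_hilb_le (hβ : 0 < β) (hg : HolderAt β C R a g) :
    ‖hilb g a‖ ≤ 2 * C * ∫ h in Set.Ioi (0 : ℝ), domFn β R h := by
  rw [← integral_const_mul]
  refine norm_integral_le_of_norm_le ((integrableOn_domFn hβ R).const_mul (2 * C)) ?_
  filter_upwards [ae_restrict_mem measurableSet_Ioi] with h hh using hg.norm_quot_le hh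

omit [NormedSpace ℝ E] in
theorem norm_le (hβ : 0 < β) (hg : HolderAt β C R a g) (w : ℝ) :
    ‖g w‖ ≤ ‖g a‖ + C * |R| ^ β := by
  have hC := hg.const_nonneg
  by_cases h : R ≤ |w - a|
  · rw [hg.supp w h, norm_zero]; positivity
  · have h1 := hg.holder w
    have h2 : |w - a| ^ β ≤ |R| ^ β :=
      Real.rpow_le_rpow (abs_nonneg _) ((not_le.1 h).le.trans (le_abs_self R)) hβ.le
    have h3 : ‖g w‖ ≤ ‖g a‖ + ‖g w - g a‖ := by
      simpa using norm_add_le (g a) (g w - g a)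
    have := mul_le_mul_of_nonneg_left h2 hC
    linarith

omit [NormedSpace ℝ E] in
theorem integrable (hβ : 0 < β) (hg : HolderAt β C R a g) : Integrable g := by
  have h1 : IntegrableOn g (Set.Icc (a - R) (a + R)) := by
    refine Measure.integrableOn_of_bounded (M := ‖g a‖ + C * |R| ^ β) (by simp)
      hg.meas.aestronglyMeasurable (Eventually.of_forall fun w => hg.norm_le hβ w)
  refine (integrableOn_iff_integrable_of_support_subset fun w hw => ?_).1 h1
  by_contra hc
  refine hw (hg.supp w ?_)
  rw [Set.mem_Icc, not_and_or] at hc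
  rcases hc with h | h
  · exact le_trans (by linarith) (neg_le_abs _)
  · exact le_trans (by linarith) (le_abs_self _)

end HolderAt

theorem hilb_clm_comp [CompleteSpace E] [CompleteSpace F] {β C R a : ℝ} {g : ℝ → E} (hβ : 0 < β)
    (hg : HolderAt β C R a g) (L : E →L[ℝ] F) : hilb (fun s => L (g s)) a = L (hilb g a) := by
  unfold hilb
  rw [← L.integral_comp_comm (hg.integrableOn_quot hβ)]
  simp

theorem hilb_const_mul (c : ℝ) (g : ℝ → ℝ) (a : ℝ) :
    hilb (fun s => c * g s) a = c * hilb g a := by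
  unfold hilb
  rw [← integral_const_mul]
  congr 1; ext h; simp only [smul_eq_mul]; ring

/-! ### Principal values as symmetrized integrals -/

theorem univ_diff_Icc (a δ : ℝ) :
    Set.univ \ Set.Icc (a - δ) (a + δ) = Set.Iio (a - δ) ∪ Set.Ioi (a + δ) := by
  ext x
  simp only [Set.mem_sdiff, Set.mem_univ, true_and, Set.mem_Icc, not_and_or, not_le, Set.mem_union,
    Set.mem_Iio, Set.mem_Ioi]

theorem integrableOn_truncated {β C R a : ℝ} {g : ℝ → ℝ} (hβ : 0 < β) (hg : HolderAt β C R a g)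
    {δ : ℝ} (hδ : 0 < δ) :
    IntegrableOn (fun s => g s / (s - a)) (Set.univ \ Set.Icc (a - δ) (a + δ)) := by
  simp only [div_eq_inv_mul]
  refine Integrable.bdd_mul (c := δ⁻¹) (hg.integrable hβ).integrableOn
    (by fun_prop) ?_
  filter_upwards [ae_restrict_mem (by measurability)] with s hs
  rw [univ_diff_Icc a δ] at hs
  rw [norm_inv, Real.norm_eq_abs]
  refine inv_anti₀ hδ ?_
  rcases hs with h | h
  · simp only [Set.mem_Iio] at h
    exact le_trans (by linarith) (neg_le_abs _)
  · simp only [Set.mem_Ioi] at h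
    exact le_trans (by linarith) (le_abs_self _)

/-- Reflection at `a` of the part of the truncated integral to the left of `a`. -/
theorem setIntegral_truncated {β C R a : ℝ} {g : ℝ → ℝ} (hβ : 0 < β) (hg : HolderAt β C R a g)
    {δ : ℝ} (hδ : 0 < δ) :
    ∫ s in Set.univ \ Set.Icc (a - δ) (a + δ), g s / (s - a) =
      ∫ h in Set.Ioi δ, h⁻¹ • (g (a + h) - g (a - h)) := by
  have hi := integrableOn_truncated hβ hg hδ
  rw [univ_diff_Icc a δ] at hi ⊢
  have mp1 := measurePreserving_add_left (volume : Measure ℝ) a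
  have mp2 := Measure.measurePreserving_sub_left (volume : Measure ℝ) a
  have me1 : MeasurableEmbedding fun x : ℝ => a + x := (MeasurableEquiv.addLeft a).measurableEmbedding
  have me2 : MeasurableEmbedding fun x : ℝ => a - x := (MeasurableEquiv.subLeft a).measurableEmbedding
  have e1 : (fun x : ℝ => a + x) ⁻¹' Set.Ioi (a + δ) = Set.Ioi δ := by ext; simp
  have e2 : (fun x : ℝ => a - x) ⁻¹' Set.Iio (a - δ) = Set.Ioi δ := by ext; simp
  have i1 := hi.mono_set (Set.subset_union_right (s := Set.Iio (a - δ)))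
  have i2 := hi.mono_set (Set.subset_union_left (t := Set.Ioi (a + δ)))
  rw [setIntegral_union (by
    rw [Set.disjoint_left]; intro x h1 h2; simp only [Set.mem_Iio, Set.mem_Ioi] at h1 h2; linarith)
    measurableSet_Ioi i2 i1]
  have j1 := (mp1.integrableOn_comp_preimage me1).2 i1
  have j2 := (mp2.integrableOn_comp_preimage me2).2 i2
  rw [← mp1.setIntegral_preimage_emb me1 (fun s => g s / (s - a)) (Set.Ioi (a + δ)),
    ← mp2.setIntegral_preimage_emb me2 (fun s => g s / (s - a)) (Set.Iio (a - δ))]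
  rw [e1] at j1 ⊢
  rw [e2] at j2 ⊢
  simp only [Function.comp_def] at j1 j2
  rw [← integral_add j2 j1]
  refine setIntegral_congr_fun measurableSet_Ioi fun h hh => ?_
  have : h ≠ 0 := (hδ.trans hh).ne'
  simp only [smul_eq_mul, add_sub_cancel_left, sub_sub_cancel_left]
  field_simp
  ring

theorem tendsto_truncated {β C R a : ℝ} {g : ℝ → ℝ} (hβ : 0 < β) (hg : HolderAt β C R a g) :
    Tendsto (fun δ => ∫ s in Set.univ \ Set.Icc (a - δ) (a + δ), g s / (s - a)) (𝓝[>] (0 : ℝ))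
      (𝓝 (hilb g a)) := by
  have hi := hg.integrableOn_quot hβ
  have key : Tendsto (fun δ => ∫ h in Set.Ioi (0 : ℝ),
      (Set.Ioi δ).indicator (fun h : ℝ => h⁻¹ • (g (a + h) - g (a - h))) h) (𝓝[>] (0 : ℝ))
      (𝓝 (hilb g a)) := by
    refine tendsto_integral_filter_of_dominated_convergence
      (fun h => ‖h⁻¹ • (g (a + h) - g (a - h))‖)
      (Eventually.of_forall fun δ => (hi.1.indicator measurableSet_Ioi))
      (Eventually.of_forall fun δ => Eventually.of_forall fun h => norm_indicator_le_norm_self _ _)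
      hi.norm ?_
    filter_upwards [ae_restrict_mem measurableSet_Ioi] with h hh
    refine tendsto_const_nhds.congr' ?_
    filter_upwards [mem_nhdsWithin_of_mem_nhds (Iio_mem_nhds hh)] with δ hδ
    rw [Set.indicator_of_mem (by exact hδ)]
  refine key.congr' ?_
  filter_upwards [self_mem_nhdsWithin] with δ hδ
  rw [setIntegral_truncated hβ hg hδ, integral_indicator measurableSet_Ioi,
    Measure.restrict_restrict measurableSet_Ioi]
  congr 2
  ext x
  simp only [Set.mem_inter_iff, Set.mem_Ioi] at hδ ⊢
  exact ⟨fun h => h.1, fun h => ⟨h, hδ.trans h⟩⟩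

theorem pvExists_of_holderAt {β C R a : ℝ} {g : ℝ → ℝ} (hβ : 0 < β) (hg : HolderAt β C R a g) :
    PVExists Set.univ a fun s => g s / (s - a) :=
  ⟨fun _ hδ => integrableOn_truncated hβ hg hδ, _, tendsto_truncated hβ hg⟩

theorem pv_eq_hilb {β C R a : ℝ} {g : ℝ → ℝ} (hβ : 0 < β) (hg : HolderAt β C R a g) :
    pv Set.univ a (fun s => g s / (s - a)) = hilb g a :=
  (tendsto_truncated hβ hg).limUnder_eq

theorem setIntegral_diff_indicator {S : Set ℝ} (hS : MeasurableSet S) (f : ℝ → ℝ) (a δ : ℝ) :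
    ∫ t in S \ Set.Icc (a - δ) (a + δ), f t =
      ∫ t in Set.univ \ Set.Icc (a - δ) (a + δ), S.indicator f t := by
  rw [setIntegral_indicator hS]
  congr 2
  ext x; simp; tauto

theorem pv_eq_univ {S : Set ℝ} (hS : MeasurableSet S) (a : ℝ) (f : ℝ → ℝ) :
    pv S a f = pv Set.univ a (S.indicator f) := by
  unfold pv
  congr 1
  ext δ
  exact setIntegral_diff_indicator hS f a δ

theorem pvExists_iff_univ {S : Set ℝ} (hS : MeasurableSet S) (a : ℝ) (f : ℝ → ℝ) :
    PVExists S a f ↔ PVExists Set.univ a (S.indicator f) := by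
  unfold PVExists
  simp only [setIntegral_diff_indicator hS f a]
  refine and_congr (forall_congr' fun δ => imp_congr_right fun hδ => ?_) Iff.rfl
  rw [IntegrableOn, IntegrableOn, integrable_indicator_iff hS, IntegrableOn,
    Measure.restrict_restrict hS]
  have : S \ Set.Icc (a - δ) (a + δ) = S ∩ (Set.univ \ Set.Icc (a - δ) (a + δ)) := by
    ext x; simp
  rw [this]

theorem pv_const_mul (S : Set ℝ) (a c : ℝ) (f : ℝ → ℝ) (hf : PVExists S a f) :
    PVExists S a (fun s => c * f s) ∧ pv S a (fun s => c * f s) = c * pv S a f := by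
  obtain ⟨h1, L, hL⟩ := hf
  have h2 : Tendsto (fun δ => ∫ t in S \ Set.Icc (a - δ) (a + δ), c * f t) (𝓝[>] (0 : ℝ))
      (𝓝 (c * L)) := by
    simpa only [integral_const_mul] using hL.const_mul c
  refine ⟨⟨fun δ hδ => (h1 δ hδ).const_mul c, _, h2⟩, ?_⟩
  rw [pv, h2.limUnder_eq, pv, hL.limUnder_eq]

/-! ### Limits and averages of Hilbert transforms -/

theorem tendsto_hilb {ι : Type*} {l : Filter ι} [l.IsCountablyGenerated] {β C R a : ℝ}
    {g : ι → ℝ → E} {g₀ : ℝ → E} (hβ : 0 < β) (hg : ∀ᶠ i in l, HolderAt β C R a (g i))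
    (hlim : ∀ᵐ s, Tendsto (fun i => g i s) l (𝓝 (g₀ s))) :
    Tendsto (fun i => hilb (g i) a) l (𝓝 (hilb g₀ a)) := by
  have q1 := (measurePreserving_add_left (volume : Measure ℝ) a).quasiMeasurePreserving.ae hlim
  have q2 := (Measure.measurePreserving_sub_left (volume : Measure ℝ) a).quasiMeasurePreserving.ae
    hlim
  refine tendsto_integral_filter_of_dominated_convergence (fun h => 2 * C * domFn β R h)
    ?_ ?_ ((integrableOn_domFn hβ R).const_mul _) ?_
  · filter_upwards [hg] with i hi using hi.stronglyMeasurable_quot.aestronglyMeasurable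
  · filter_upwards [hg] with i hi
    filter_upwards [ae_restrict_mem measurableSet_Ioi] with h hh using hi.norm_quot_le hh
  · filter_upwards [ae_restrict_of_ae q1, ae_restrict_of_ae q2] with h h1 h2
    exact (h1.sub h2).const_smul _

theorem stronglyMeasurable_hilb {T : Type*} [MeasurableSpace T] {g : T → ℝ → E}
    (hm : StronglyMeasurable (Function.uncurry g)) (a : ℝ) :
    StronglyMeasurable fun t => hilb (g t) a := by
  have h : StronglyMeasurable fun q : T × ℝ => q.2⁻¹ • (g q.1 (a + q.2) - g q.1 (a - q.2)) := by
    refine StronglyMeasurable.smul (by fun_prop) (StronglyMeasurable.sub ?_ ?_)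
    · exact hm.comp_measurable (g := fun q : T × ℝ => (q.1, a + q.2)) (by fun_prop)
    · exact hm.comp_measurable (g := fun q : T × ℝ => (q.1, a - q.2)) (by fun_prop)
  exact h.integral_prod_right

theorem hilb_integral {T : Type*} [MeasurableSpace T] {ν : Measure T} [IsFiniteMeasure ν]
    {β C R a : ℝ} {g : T → ℝ → E} (hβ : 0 < β) (hm : StronglyMeasurable (Function.uncurry g))
    (hg : ∀ t, HolderAt β C R a (g t)) (hi : ∀ s, Integrable (fun t => g t s) ν) :
    hilb (fun s => ∫ t, g t s ∂ν) a = ∫ t, hilb (g t) a ∂ν := by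
  unfold hilb
  have h : StronglyMeasurable fun q : T × ℝ => q.2⁻¹ • (g q.1 (a + q.2) - g q.1 (a - q.2)) := by
    refine StronglyMeasurable.smul (by fun_prop) (StronglyMeasurable.sub ?_ ?_)
    · exact hm.comp_measurable (g := fun q : T × ℝ => (q.1, a + q.2)) (by fun_prop)
    · exact hm.comp_measurable (g := fun q : T × ℝ => (q.1, a - q.2)) (by fun_prop)
  rw [integral_integral_swap]
  · refine setIntegral_congr_fun measurableSet_Ioi fun s _ => ?_
    simp only
    rw [integral_smul, integral_sub (hi _) (hi _)]
  · refine Integrable.mono' (g := fun q : T × ℝ => 2 * C * domFn β R q.2) ?_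
      h.aestronglyMeasurable ?_
    · exact (Integrable.comp_snd (((integrableOn_domFn hβ R).const_mul (2 * C))) ν)
    · have : ∀ᵐ q ∂(ν.prod (volume.restrict (Set.Ioi (0 : ℝ)))), q.2 ∈ Set.Ioi (0 : ℝ) :=
        Measure.quasiMeasurePreserving_snd.ae (ae_restrict_mem measurableSet_Ioi)
      filter_upwards [this] with q hq
      exact (hg q.1).norm_quot_le hq

end Hilb

/-! ### Hölder dependence on parameters, and iterated singular integrals -/

section Param

variable {E X : Type*} [NormedAddCommGroup E] [NormedSpace ℝ E] [PseudoMetricSpace X]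

/-- `f` is bounded by `C` and Hölder continuous with exponent `β` and constant `C`. -/
structure BddHolder (β C : ℝ) (f : X → E) : Prop where
  norm_le : ∀ p, ‖f p‖ ≤ C
  holder : ∀ p q, ‖f p - f q‖ ≤ C * dist p q ^ β

/-- `c` is a cutoff function for singular integrals at `y`: bounded by one, constant near `y`, and
supported in a ball around `y`. Indicator functions of compact intervals are examples as long as `y`
is not an endpoint. -/
structure IsCutoff (r R y : ℝ) (c : ℝ → ℝ) : Prop where
  meas : Measurable c
  abs_le : ∀ w, |c w| ≤ 1
  eq_of : ∀ w, |w - y| ≤ r → c w = c y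
  supp : ∀ w, R ≤ |w - y| → c w = 0

omit [NormedSpace ℝ E] in
theorem BddHolder.const_nonneg [Nonempty X] {β C : ℝ} {f : X → E} (hf : BddHolder β C f) : 0 ≤ C :=
  (norm_nonneg _).trans (hf.norm_le (Classical.arbitrary X))

omit [NormedSpace ℝ E] in
theorem BddHolder.continuous {β C : ℝ} (hβ : 0 < β) {f : X → E} (hf : BddHolder β C f) :
    Continuous f := by
  rw [continuous_iff_continuousAt]
  intro p
  rw [ContinuousAt, tendsto_iff_norm_sub_tendsto_zero]
  have h : Tendsto (fun q => C * dist q p ^ β) (𝓝 p) (𝓝 0) := by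
    have : Continuous fun q => C * dist q p ^ β :=
      continuous_const.mul ((continuous_id.dist continuous_const).rpow_const
        fun _ => Or.inr hβ.le)
    simpa [Real.zero_rpow hβ.ne'] using this.tendsto p
  exact squeeze_zero (fun _ => norm_nonneg _) (fun q => hf.holder q p) h

omit [NormedSpace ℝ E] in
theorem BddHolder.comp {Y : Type*} [PseudoMetricSpace Y] {β C : ℝ} (hβ : 0 < β) {f : X → E}
    (hf : BddHolder β C f) {φ : Y → X} (hφ : ∀ p q, dist (φ p) (φ q) ≤ dist p q) :
    BddHolder β C (f ∘ φ) where
  norm_le p := hf.norm_le _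
  holder p q := (hf.holder _ _).trans (by
    have := (norm_nonneg _).trans (hf.norm_le (φ p))
    have := Real.rpow_le_rpow dist_nonneg (hφ p q) hβ.le
    exact mul_le_mul_of_nonneg_left this ‹0 ≤ C›)

theorem HolderAt.cutoff_smul {β C r R y : ℝ} (hβ : 0 < β) (hr : 0 < r) {c : ℝ → ℝ}
    (hc : IsCutoff r R y c) {f : ℝ → E} (hf : BddHolder β C f) :
    HolderAt β (C * (1 + 2 * r⁻¹ ^ β)) R y fun w => c w • f w where
  meas := hc.meas.stronglyMeasurable.smul (hf.continuous hβ).stronglyMeasurable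
  supp w hw := by simp [hc.supp w hw]
  holder w := by
    have hC := hf.const_nonneg
    rcases le_or_gt |w - y| r with h | h
    · rw [hc.eq_of w h, ← smul_sub, norm_smul, Real.norm_eq_abs]
      have h1 := hf.holder w y
      rw [Real.dist_eq] at h1
      calc |c y| * ‖f w - f y‖ ≤ 1 * (C * |w - y| ^ β) := by
            gcongr
            exact hc.abs_le y
        _ ≤ C * (1 + 2 * r⁻¹ ^ β) * |w - y| ^ β := by
            rw [one_mul]
            gcongr
            exact le_mul_of_one_le_right hC (by linarith [Real.rpow_pos_of_pos (inv_pos.2 hr) β])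
    · have h1 : ∀ s, ‖c s • f s‖ ≤ C := fun s => by
        rw [norm_smul, Real.norm_eq_abs]
        exact (mul_le_of_le_one_left (norm_nonneg _) (hc.abs_le s)).trans (hf.norm_le s)
      have h2 : 1 ≤ r⁻¹ ^ β * |w - y| ^ β := by
        rw [← Real.mul_rpow (by positivity) (abs_nonneg _)]
        refine Real.one_le_rpow ?_ hβ.le
        rw [inv_mul_eq_div, one_le_div hr]
        exact h.le
      have h3 : 0 ≤ |w - y| ^ β := by positivity
      calc _ ≤ C + C := (norm_sub_le _ _).trans (add_le_add (h1 _) (h1 _))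
        _ ≤ C * (|w - y| ^ β + 2 * (r⁻¹ ^ β * |w - y| ^ β)) := by
          nlinarith
        _ = _ := by ring

/-- The factor by which the Hölder constant grows in `BddHolder.hilb`. -/
def hilbConst (β r R : ℝ) : ℝ :=
  4 * (1 + 2 * r⁻¹ ^ β) *
    ((∫ h in Set.Ioi (0 : ℝ), domFn β R h) + ∫ h in Set.Ioi (0 : ℝ), domFn (β / 2) R h)

omit [NormedSpace ℝ E] in
theorem BddHolder.slice {β C : ℝ} {G : X × ℝ → E} (hG : BddHolder β C G) (p : X) :
    BddHolder β C fun w => G (p, w) where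
  norm_le w := hG.norm_le _
  holder w w' := by simpa [Prod.dist_eq] using hG.holder (p, w) (p, w')

/-- The Hilbert transform in one variable of a Hölder function is Hölder in the remaining
variables. Half of the exponent is spent on the convergence of the integral. -/
theorem BddHolder.hilb {β C r R y : ℝ} (hβ : 0 < β) (hr : 0 < r) {c : ℝ → ℝ}
    (hc : IsCutoff r R y c) {G : X × ℝ → E} (hG : BddHolder β C G) :
    BddHolder (β / 2) (C * hilbConst β r R) fun p => hilb (fun w => c w • G (p, w)) y := by
  have hA : ∀ p, HolderAt β (C * (1 + 2 * r⁻¹ ^ β)) R y fun w => c w • G (p, w) :=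
    fun p => HolderAt.cutoff_smul hβ hr hc (hG.slice p)
  have I1 := setIntegral_domFn_nonneg β R
  have I2 := setIntegral_domFn_nonneg (β / 2) R
  have hr' : 0 < r⁻¹ ^ β := Real.rpow_pos_of_pos (inv_pos.2 hr) β
  constructor
  · intro p
    have hC : 0 ≤ C := (norm_nonneg _).trans (hG.norm_le (p, 0))
    refine ((hA p).norm_hilb_le hβ).trans ?_
    unfold hilbConst
    have h1 : 0 ≤ C * (1 + 2 * r⁻¹ ^ β) := by positivity
    nlinarith [mul_nonneg h1 I1, mul_nonneg h1 I2]
  · intro p q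
    have hC : 0 ≤ C := (norm_nonneg _).trans (hG.norm_le (p, 0))
    set C₁ := C * (1 + 2 * r⁻¹ ^ β) with hC₁
    have hCC : C ≤ C₁ := by rw [hC₁]; nlinarith
    have hC₁0 : 0 ≤ C₁ := hC.trans hCC
    have hd : 0 ≤ dist p q ^ β := by positivity
    have hslice : ∀ w, ‖c w • G (p, w) - c w • G (q, w)‖ ≤ C * dist p q ^ β := fun w => by
      rw [← smul_sub, norm_smul, Real.norm_eq_abs]
      refine (mul_le_of_le_one_left (norm_nonneg _) (hc.abs_le w)).trans ?_
      simpa [Prod.dist_eq] using hG.holder (p, w) (q, w)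
    have key : ∀ h ∈ Set.Ioi (0 : ℝ),
        ‖h⁻¹ • (c (y + h) • G (p, y + h) - c (y - h) • G (p, y - h)) -
          h⁻¹ • (c (y + h) • G (q, y + h) - c (y - h) • G (q, y - h))‖ ≤
        4 * C₁ * dist p q ^ (β / 2) * domFn (β / 2) R h := by
      intro h hh
      have hh : 0 < h := hh
      have b1 := (hA p).norm_quot_le hh
      have b2 := (hA q).norm_quot_le hh
      unfold domFn at b1 b2 ⊢
      by_cases hR : h < R
      · rw [Set.indicator_of_mem (by exact hR)] at b1 b2 ⊢
        set D := h⁻¹ • (c (y + h) • G (p, y + h) - c (y - h) • G (p, y - h)) -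
          h⁻¹ • (c (y + h) • G (q, y + h) - c (y - h) • G (q, y - h)) with hD
        -- `d1` uses that each numerator vanishes at `h = 0`, `d2` that `p` and `q` are close; the
        -- geometric mean of the two bounds is integrable in `h` and Hölder in `(p, q)`
        have d1 : ‖D‖ ≤ h⁻¹ * (4 * C₁ * h ^ β) := by
          rw [Real.rpow_sub_one hh.ne'] at b1 b2
          refine (norm_sub_le _ _).trans ((add_le_add b1 b2).trans (le_of_eq ?_))
          rw [hC₁]
          field_simp
          ring
        have d2 : ‖D‖ ≤ h⁻¹ * (4 * C₁ * dist p q ^ β) := by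
          have e : D = h⁻¹ • ((c (y + h) • G (p, y + h) - c (y + h) • G (q, y + h)) -
              (c (y - h) • G (p, y - h) - c (y - h) • G (q, y - h))) := by
            rw [hD, ← smul_sub]; congr 1; abel
          rw [e, norm_smul, Real.norm_eq_abs, abs_of_pos (inv_pos.2 hh)]
          gcongr
          refine (norm_sub_le _ _).trans ((add_le_add (hslice _) (hslice _)).trans ?_)
          nlinarith
        have hhb : 0 ≤ h ^ β := by positivity
        have e1 : h ^ (β / 2) * h ^ (β / 2) = h ^ β := by
          rw [← Real.rpow_add hh]; ring_nf
        have e2 : dist p q ^ (β / 2) * dist p q ^ (β / 2) = dist p q ^ β := by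
          rw [← Real.rpow_add_of_nonneg dist_nonneg (by positivity) (by positivity)]; ring_nf
        have hx : 0 ≤ h ^ (β / 2) := by positivity
        have hy : 0 ≤ dist p q ^ (β / 2) := by positivity
        have d3 : ‖D‖ ≤ h⁻¹ * (4 * C₁ * (dist p q ^ (β / 2) * h ^ (β / 2))) := by
          rw [← e1] at d1
          rw [← e2] at d2
          rcases le_total (h ^ (β / 2)) (dist p q ^ (β / 2)) with hle | hle
          · exact d1.trans (by gcongr)
          · exact d2.trans (by gcongr)
        refine d3.trans (le_of_eq ?_)
        rw [Real.rpow_sub_one hh.ne']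
        ring
      · rw [Set.indicator_of_notMem (by exact hR)] at b1 b2 ⊢
        rw [mul_zero] at b1 b2 ⊢
        rw [norm_le_zero_iff.1 b1, norm_le_zero_iff.1 b2]
        simp
    have hint := ((integrableOn_domFn (half_pos hβ) R).const_mul (4 * C₁ * dist p q ^ (β / 2)))
    unfold PyramidSensor.hilb
    rw [← integral_sub ((hA p).integrableOn_quot hβ) ((hA q).integrableOn_quot hβ)]
    refine (norm_integral_le_of_norm_le hint ?_).trans ?_
    · filter_upwards [ae_restrict_mem measurableSet_Ioi] with h hh using key h hh
    · rw [integral_const_mul]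
      have : 0 ≤ 4 * C₁ * dist p q ^ (β / 2) := by positivity
      unfold hilbConst
      calc _ ≤ 4 * C₁ * dist p q ^ (β / 2) *
            ((∫ h in Set.Ioi (0 : ℝ), domFn β R h) + ∫ h in Set.Ioi (0 : ℝ), domFn (β / 2) R h) := by
            gcongr; linarith
        _ = _ := by rw [hC₁]; ring

/-- The threefold iterated Hilbert transform of a function of three variables, with cutoffs in each
variable. -/
def hilb3 (a b c : ℝ → ℝ) (x y z : ℝ) (G : (ℝ × ℝ) × ℝ → E) : E :=
  hilb (fun u => a u • hilb (fun v => b v • hilb (fun w => c w • G ((u, v), w)) z) y) x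

/-- Three cutoffs with common radii. -/
structure IsCutoff3 (r R x y z : ℝ) (a b c : ℝ → ℝ) : Prop where
  fst : IsCutoff r R x a
  snd : IsCutoff r R y b
  trd : IsCutoff r R z c

/-- Existence of the iterated principal value for a Hölder numerator with cutoffs. -/
theorem pv3_eq_hilb3 {β C r R x y z : ℝ} (hβ : 0 < β) (hr : 0 < r) {a b c : ℝ → ℝ}
    (hc : IsCutoff3 r R x y z a b c) {G : (ℝ × ℝ) × ℝ → ℝ} (hG : BddHolder β C G) :
    PV3Exists Set.univ Set.univ Set.univ x y z
        (fun u v w => a u * b v * c w * G ((u, v), w) / ((u - x) * (v - y) * (w - z))) ∧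
      pv3 Set.univ Set.univ Set.univ x y z
        (fun u v w => a u * b v * c w * G ((u, v), w) / ((u - x) * (v - y) * (w - z))) =
        hilb3 a b c x y z G := by
  have h1 := BddHolder.hilb hβ hr hc.trd hG
  have h2 := BddHolder.hilb (half_pos hβ) hr hc.snd h1
  have H3 : ∀ u v, HolderAt β _ R z fun w => c w • G ((u, v), w) :=
    fun u v => HolderAt.cutoff_smul hβ hr hc.trd (hG.slice (u, v))
  have H2 : ∀ u, HolderAt (β / 2) _ R y
      fun v => b v • hilb (fun w => c w • G ((u, v), w)) z :=
    fun u => HolderAt.cutoff_smul (half_pos hβ) hr hc.snd (h1.slice u)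
  have H1 := HolderAt.cutoff_smul (half_pos (half_pos hβ)) hr hc.fst h2
  have s3 : ∀ u v,
      PVExists Set.univ z
        (fun w => a u * b v * c w * G ((u, v), w) / ((u - x) * (v - y) * (w - z))) ∧
      pv Set.univ z
        (fun w => a u * b v * c w * G ((u, v), w) / ((u - x) * (v - y) * (w - z))) =
        a u / (u - x) * (b v • hilb (fun w => c w • G ((u, v), w)) z / (v - y)) := by
    intro u v
    have k := pv_const_mul Set.univ z (a u * b v / ((u - x) * (v - y)))
      (fun w => c w • G ((u, v), w) / (w - z)) (pvExists_of_holderAt hβ (H3 u v))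
    rw [pv_eq_hilb hβ (H3 u v)] at k
    have e : (fun w => a u * b v / ((u - x) * (v - y)) * (c w • G ((u, v), w) / (w - z))) =
        fun w => a u * b v * c w * G ((u, v), w) / ((u - x) * (v - y) * (w - z)) := by
      ext w; simp only [smul_eq_mul, div_eq_mul_inv, mul_inv]; ring
    rw [e] at k
    refine ⟨k.1, k.2.trans ?_⟩
    simp only [smul_eq_mul, div_eq_mul_inv, mul_inv]
    ring
  have s2 : ∀ u, PVExists Set.univ y (fun v => pv Set.univ z
        (fun w => a u * b v * c w * G ((u, v), w) / ((u - x) * (v - y) * (w - z)))) ∧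
      pv Set.univ y (fun v => pv Set.univ z
        (fun w => a u * b v * c w * G ((u, v), w) / ((u - x) * (v - y) * (w - z)))) =
        a u • hilb (fun v => b v • hilb (fun w => c w • G ((u, v), w)) z) y / (u - x) := by
    intro u
    simp only [fun v => (s3 u v).2]
    have k := pv_const_mul Set.univ y (a u / (u - x)) _
      (pvExists_of_holderAt (half_pos hβ) (H2 u))
    rw [pv_eq_hilb (half_pos hβ) (H2 u)] at k
    refine ⟨k.1, k.2.trans ?_⟩
    simp only [smul_eq_mul, div_eq_mul_inv]
    ring
  refine ⟨⟨fun u v => (s3 u v).1, fun u => (s2 u).1, ?_⟩, ?_⟩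
  · simp only [fun u => (s2 u).2]
    exact pvExists_of_holderAt (half_pos (half_pos hβ)) H1
  · unfold pv3
    simp only [fun u => (s2 u).2]
    exact pv_eq_hilb (half_pos (half_pos hβ)) H1

/-- The iterated Hilbert transform depends continuously on the cutoffs. -/
theorem tendsto_hilb3 {ι : Type*} {l : Filter ι} [l.IsCountablyGenerated] {β C r R x y z : ℝ}
    (hβ : 0 < β) (hr : 0 < r) {a b c : ι → ℝ → ℝ} {a₀ b₀ c₀ : ℝ → ℝ}
    (hc : ∀ᶠ i in l, IsCutoff3 r R x y z (a i) (b i) (c i))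
    (ha : ∀ᵐ s, Tendsto (fun i => a i s) l (𝓝 (a₀ s)))
    (hb : ∀ᵐ s, Tendsto (fun i => b i s) l (𝓝 (b₀ s)))
    (hcc : ∀ᵐ s, Tendsto (fun i => c i s) l (𝓝 (c₀ s)))
    {G : (ℝ × ℝ) × ℝ → E} (hG : BddHolder β C G) :
    Tendsto (fun i => hilb3 (a i) (b i) (c i) x y z G) l (𝓝 (hilb3 a₀ b₀ c₀ x y z G)) := by
  have t1 : ∀ p, Tendsto (fun i => hilb (fun w => c i w • G (p, w)) z) l
      (𝓝 (hilb (fun w => c₀ w • G (p, w)) z)) := by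
    intro p
    refine tendsto_hilb hβ (C := C * (1 + 2 * r⁻¹ ^ β)) (R := R) ?_ ?_
    · filter_upwards [hc] with i hi using HolderAt.cutoff_smul hβ hr hi.trd (hG.slice p)
    · filter_upwards [hcc] with s hs using hs.smul_const _
  have t2 : ∀ u, Tendsto
      (fun i => hilb (fun v => b i v • hilb (fun w => c i w • G ((u, v), w)) z) y) l
      (𝓝 (hilb (fun v => b₀ v • hilb (fun w => c₀ w • G ((u, v), w)) z) y)) := by
    intro u
    refine tendsto_hilb (half_pos hβ) (R := R) (C := C * hilbConst β r R *
      (1 + 2 * r⁻¹ ^ (β / 2))) ?_ ?_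
    · filter_upwards [hc] with i hi
      exact HolderAt.cutoff_smul (half_pos hβ) hr hi.snd
        ((BddHolder.hilb hβ hr hi.trd hG).slice u)
    · filter_upwards [hb] with s hs using hs.smul (t1 (u, s))
  refine tendsto_hilb (half_pos (half_pos hβ)) (R := R) (C := C * hilbConst β r R *
    hilbConst (β / 2) r R * (1 + 2 * r⁻¹ ^ (β / 2 / 2))) ?_ ?_
  · filter_upwards [hc] with i hi
    exact HolderAt.cutoff_smul (half_pos (half_pos hβ)) hr hi.fst
      (BddHolder.hilb (half_pos hβ) hr hi.snd (BddHolder.hilb hβ hr hi.trd hG))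
  · filter_upwards [ha] with s hs using hs.smul (t2 s)

theorem stronglyMeasurable_hilb_cutoff {S : Type*} [MeasurableSpace S] {c : ℝ → ℝ}
    (hc : Measurable c) {H : S × ℝ → E} (hH : StronglyMeasurable H) (z : ℝ) :
    StronglyMeasurable fun q : S => hilb (fun w => c w • H (q, w)) z :=
  stronglyMeasurable_hilb (g := fun (q : S) w => c w • H (q, w))
    ((hc.comp measurable_snd).stronglyMeasurable.smul hH) z

/-- Averages commute with iterated Hilbert transforms. -/
theorem hilb3_integral {T : Type*} [MeasurableSpace T] {ν : Measure T} [IsFiniteMeasure ν]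
    {β C r R x y z : ℝ} (hβ : 0 < β) (hr : 0 < r) {a b c : ℝ → ℝ}
    (hc : IsCutoff3 r R x y z a b c) {G : T → (ℝ × ℝ) × ℝ → E}
    (hm : StronglyMeasurable (Function.uncurry G)) (hG : ∀ t, BddHolder β C (G t)) :
    Integrable (fun t => hilb3 a b c x y z (G t)) ν ∧
      hilb3 a b c x y z (fun p => ∫ t, G t p ∂ν) = ∫ t, hilb3 a b c x y z (G t) ∂ν := by
  have h1 := fun t => BddHolder.hilb hβ hr hc.trd (hG t)
  have h2 := fun t => BddHolder.hilb (half_pos hβ) hr hc.snd (h1 t)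
  have m1 : StronglyMeasurable fun q : T × (ℝ × ℝ) =>
      hilb (fun w => c w • G q.1 (q.2, w)) z :=
    stronglyMeasurable_hilb_cutoff hc.trd.meas
      (H := fun q : (T × (ℝ × ℝ)) × ℝ => G q.1.1 (q.1.2, q.2))
      (hm.comp_measurable (g := fun q : (T × (ℝ × ℝ)) × ℝ => (q.1.1, (q.1.2, q.2)))
        (by fun_prop)) z
  have m2 : StronglyMeasurable fun q : T × ℝ =>
      hilb (fun v => b v • hilb (fun w => c w • G q.1 ((q.2, v), w)) z) y :=
    stronglyMeasurable_hilb_cutoff hc.snd.meas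
      (H := fun q : (T × ℝ) × ℝ => hilb (fun w => c w • G q.1.1 ((q.1.2, q.2), w)) z)
      (m1.comp_measurable (g := fun q : (T × ℝ) × ℝ => (q.1.1, (q.1.2, q.2))) (by fun_prop)) y
  have bint : ∀ {f : T → E} {K : ℝ}, StronglyMeasurable f → (∀ t, ‖f t‖ ≤ K) → Integrable f ν :=
    fun hf hK => Integrable.of_bound hf.aestronglyMeasurable _ (Eventually.of_forall hK)
  have e1 : ∀ p : ℝ × ℝ, hilb (fun w => c w • ∫ t, G t (p, w) ∂ν) z =
      ∫ t, hilb (fun w => c w • G t (p, w)) z ∂ν := by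
    intro p
    rw [← hilb_integral hβ (g := fun t w => c w • G t (p, w)) _
      (fun t => HolderAt.cutoff_smul hβ hr hc.trd ((hG t).slice p))]
    · simp only [integral_smul]
    · intro w
      exact (bint (hm.comp_measurable (g := fun t => (t, (p, w))) (by fun_prop))
        fun t => (hG t).norm_le _).smul _
    · exact (hc.trd.meas.comp measurable_snd).stronglyMeasurable.smul
        (hm.comp_measurable (g := fun q : T × ℝ => (q.1, (p, q.2))) (by fun_prop))
  have e2 : ∀ u : ℝ, hilb (fun v => b v • ∫ t, hilb (fun w => c w • G t ((u, v), w)) z ∂ν) y =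
      ∫ t, hilb (fun v => b v • hilb (fun w => c w • G t ((u, v), w)) z) y ∂ν := by
    intro u
    rw [← hilb_integral (half_pos hβ)
      (g := fun t v => b v • hilb (fun w => c w • G t ((u, v), w)) z) _
      (fun t => HolderAt.cutoff_smul (half_pos hβ) hr hc.snd ((h1 t).slice u))]
    · simp only [integral_smul]
    · intro v
      exact (bint (m1.comp_measurable (g := fun t => (t, (u, v))) (by fun_prop))
        fun t => (h1 t).norm_le _).smul _
    · exact (hc.snd.meas.comp measurable_snd).stronglyMeasurable.smul
        (m1.comp_measurable (g := fun q : T × ℝ => (q.1, (u, q.2))) (by fun_prop))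
  have h3 := fun t => HolderAt.cutoff_smul (half_pos (half_pos hβ)) hr hc.fst (h2 t)
  unfold hilb3
  refine ⟨bint (stronglyMeasurable_hilb_cutoff hc.fst.meas
    (H := fun q : T × ℝ => hilb (fun v => b v • hilb (fun w => c w • G q.1 ((q.2, v), w)) z) y)
      m2 x) (fun t => (h3 t).norm_hilb_le (half_pos (half_pos hβ))), ?_⟩
  simp only [e1, e2]
  rw [← hilb_integral (half_pos (half_pos hβ))
    (g := fun t u => a u • hilb (fun v => b v • hilb (fun w => c w • G t ((u, v), w)) z) y) _ h3]
  · simp only [integral_smul]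
  · intro u
    exact (bint (m2.comp_measurable (g := fun t => (t, u)) (by fun_prop))
      fun t => (h2 t).norm_le _).smul _
  · exact (hc.fst.meas.comp measurable_snd).stronglyMeasurable.smul m2

theorem hilb_cutoff_integral {T : Type*} [MeasurableSpace T] {ν : Measure T} [IsFiniteMeasure ν]
    {β C r R x : ℝ} (hβ : 0 < β) (hr : 0 < r) {c : ℝ → ℝ} (hc : IsCutoff r R x c)
    {G : T → ℝ → E} (hm : StronglyMeasurable (Function.uncurry G))
    (hG : ∀ t, BddHolder β C (G t)) :
    Integrable (fun t => hilb (fun u => c u • G t u) x) ν ∧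
      hilb (fun u => c u • ∫ t, G t u ∂ν) x = ∫ t, hilb (fun u => c u • G t u) x ∂ν := by
  have h := fun t => HolderAt.cutoff_smul hβ hr hc (hG t)
  refine ⟨Integrable.of_bound (stronglyMeasurable_hilb_cutoff hc.meas
    (H := Function.uncurry G) hm x).aestronglyMeasurable _
    (Eventually.of_forall fun t => (h t).norm_hilb_le hβ), ?_⟩
  rw [← hilb_integral hβ (g := fun t u => c u • G t u) _ h]
  · simp only [integral_smul]
  · intro u
    exact (Integrable.of_bound (hm.comp_measurable (g := fun t => (t, u))
      (by fun_prop)).aestronglyMeasurable _ (Eventually.of_forall fun t => (hG t).norm_le u)).smul _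
  · exact (hc.meas.comp measurable_snd).stronglyMeasurable.smul hm

end Param

/-! ### The Dirichlet integral and the Hilbert transform of a superposition of exponentials -/

/-- The sine integral. -/
def sineInt (x : ℝ) : ℝ := ∫ t in (0 : ℝ)..x, Real.sinc t

theorem sineInt_neg (x : ℝ) : sineInt (-x) = -sineInt x := by
  unfold sineInt
  have h := intervalIntegral.integral_comp_neg (f := Real.sinc) (a := 0) (b := x)
  simp only [Real.sinc_neg, neg_zero] at h
  rw [h, intervalIntegral.integral_symm]

theorem continuous_sineInt : Continuous sineInt :=
  intervalIntegral.continuous_primitive (fun _ _ => Real.continuous_sinc.intervalIntegrable _ _) 0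

theorem integral_exp_mul_sin (s R : ℝ) :
    ∫ x in (0 : ℝ)..R, Real.exp (-s * x) * Real.sin x =
      (1 + s ^ 2)⁻¹ - Real.exp (-s * R) * (Real.cos R + s * Real.sin R) / (1 + s ^ 2) := by
  have hs : (1 + s ^ 2) ≠ 0 := by positivity
  have hd : ∀ x ∈ Set.uIcc 0 R, HasDerivAt
      (fun x => -(Real.exp (-s * x) * (Real.cos x + s * Real.sin x)) / (1 + s ^ 2))
      (Real.exp (-s * x) * Real.sin x) x := by
    intro x _
    have h1 : HasDerivAt (fun x => Real.exp (-s * x)) (Real.exp (-s * x) * (-s)) x := by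
      simpa using ((hasDerivAt_id x).const_mul (-s)).exp
    have h2 := (Real.hasDerivAt_cos x).add ((Real.hasDerivAt_sin x).const_mul s)
    convert! ((h1.mul h2).neg).div_const (1 + s ^ 2) using 1
    field_simp
    simp only [Pi.add_apply]
    ring
  rw [intervalIntegral.integral_eq_sub_of_hasDerivAt hd
    (Continuous.intervalIntegrable (by fun_prop) _ _)]
  simp
  field_simp
  ring

/-- The Dirichlet integral, with a rate of convergence. -/
theorem abs_sineInt_sub_le {R : ℝ} (hR : 0 < R) : |sineInt R - Real.pi / 2| ≤ 2 / R := by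
  -- Laplace's trick: write `1 / x` as the integral of `exp (-s x)` and exchange the integrals.
  have e1 : ∀ x ∈ Set.Ioc (0 : ℝ) R, Real.sinc x =
      ∫ s in Set.Ioi (0 : ℝ), Real.exp (-s * x) * Real.sin x := by
    intro x hx
    have h := integral_exp_mul_Ioi (a := -x) (by linarith [hx.1]) 0
    rw [integral_mul_const]
    have : (fun s : ℝ => Real.exp (-s * x)) = fun s => Real.exp (-x * s) := by
      ext s; congr 1; ring
    rw [this, h, Real.sinc_of_ne_zero hx.1.ne']
    simp
    ring
  have i1 : ∀ x, 0 < x → IntegrableOn (fun s : ℝ => Real.exp (-s * x)) (Set.Ioi 0) := by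
    intro x hx
    have := integrableOn_exp_mul_Ioi (a := -x) (by linarith) 0
    refine this.congr_fun (fun s _ => ?_) measurableSet_Ioi
    simp only
    congr 1; ring
  have hswap : sineInt R = ∫ s in Set.Ioi (0 : ℝ), ∫ x in Set.Ioc (0 : ℝ) R,
      Real.exp (-s * x) * Real.sin x := by
    unfold sineInt
    rw [intervalIntegral.integral_of_le hR.le, setIntegral_congr_fun measurableSet_Ioc e1]
    refine integral_integral_swap ?_
    refine (integrable_prod_iff ?_).2 ⟨?_, ?_⟩
    · exact (by fun_prop : Continuous fun p : ℝ × ℝ =>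
        Real.exp (-p.2 * p.1) * Real.sin p.1).aestronglyMeasurable
    · filter_upwards [ae_restrict_mem measurableSet_Ioc] with x hx
      exact (i1 x hx.1).mul_const (Real.sin x)
    · refine Measure.integrableOn_of_bounded (M := 1) (by simp) ?_ ?_
      · exact (by fun_prop : Continuous fun p : ℝ × ℝ =>
          ‖Real.exp (-p.2 * p.1) * Real.sin p.1‖).stronglyMeasurable.integral_prod_right
            |>.aestronglyMeasurable
      · filter_upwards [ae_restrict_mem measurableSet_Ioc] with x hx
        have : ∀ s : ℝ, ‖Real.exp (-s * x) * Real.sin x‖ = Real.exp (-s * x) * |Real.sin x| := by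
          intro s; simp
        simp only [Function.uncurry, this]
        rw [integral_mul_const]
        have h := integral_exp_mul_Ioi (a := -x) (by linarith [hx.1]) 0
        have e : (fun s : ℝ => Real.exp (-s * x)) = fun s => Real.exp (-x * s) := by
          ext s; congr 1; ring
        rw [e, h]
        simp only [mul_zero, Real.exp_zero, neg_div_neg_eq, norm_mul, Real.norm_eq_abs, abs_abs,
          one_div, abs_inv, abs_of_pos hx.1]
        rw [inv_mul_le_one₀ hx.1]
        simpa [abs_of_pos hx.1] using Real.abs_sin_le_abs (x := x)
  have i2 : IntegrableOn (fun s : ℝ => (1 + s ^ 2)⁻¹) (Set.Ioi 0) :=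
    integrable_inv_one_add_sq.integrableOn
  have hb : ∀ s ∈ Set.Ioi (0 : ℝ),
      ‖Real.exp (-s * R) * (Real.cos R + s * Real.sin R) / (1 + s ^ 2)‖ ≤
        2 * Real.exp (-s * R) := by
    intro s hs
    have hs : 0 < s := hs
    rw [norm_div, norm_mul, Real.norm_eq_abs, Real.norm_eq_abs, Real.norm_eq_abs, Real.abs_exp,
      abs_of_pos (by positivity : 0 < 1 + s ^ 2), div_le_iff₀ (by positivity)]
    have h1 : |Real.cos R + s * Real.sin R| ≤ 1 + s := by
      refine (abs_add_le _ _).trans (add_le_add (Real.abs_cos_le_one R) ?_)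
      rw [abs_mul, abs_of_pos hs]
      exact mul_le_of_le_one_right hs.le (Real.abs_sin_le_one R)
    have h2 : 1 + s ≤ 2 * (1 + s ^ 2) := by nlinarith [sq_nonneg (s - 1)]
    calc _ ≤ Real.exp (-s * R) * (2 * (1 + s ^ 2)) := by
          gcongr; exact h1.trans h2
      _ = _ := by ring
  have i3 : IntegrableOn
      (fun s : ℝ => Real.exp (-s * R) * (Real.cos R + s * Real.sin R) / (1 + s ^ 2))
      (Set.Ioi 0) := by
    refine Integrable.mono' ((i1 R hR).const_mul 2) ?_ ?_
    · exact Measurable.aestronglyMeasurable (by fun_prop)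
    · filter_upwards [ae_restrict_mem measurableSet_Ioi] with s hs using hb s hs
  have e2 : sineInt R = Real.pi / 2 - ∫ s in Set.Ioi (0 : ℝ),
      Real.exp (-s * R) * (Real.cos R + s * Real.sin R) / (1 + s ^ 2) := by
    rw [hswap]
    simp only [← intervalIntegral.integral_of_le hR.le, integral_exp_mul_sin]
    rw [integral_sub i2 i3, integral_Ioi_inv_one_add_sq]
    simp
  rw [e2, sub_sub_cancel_left, abs_neg, ← Real.norm_eq_abs]
  refine (norm_integral_le_of_norm_le ((i1 R hR).const_mul 2) ?_).trans (le_of_eq ?_)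
  · filter_upwards [ae_restrict_mem measurableSet_Ioi] with s hs using hb s hs
  · rw [integral_const_mul]
    have h := integral_exp_mul_Ioi (a := -R) (by linarith) 0
    have e : (fun s : ℝ => Real.exp (-s * R)) = fun s => Real.exp (-R * s) := by
      ext s; congr 1; ring
    rw [e, h]
    simp
    ring

theorem abs_sineInt_le (x : ℝ) : |sineInt x| ≤ 4 := by
  have key : ∀ x : ℝ, 0 ≤ x → |sineInt x| ≤ 4 := by
    intro x hx
    rcases le_or_gt x 1 with h | h
    · have := intervalIntegral.norm_integral_le_of_norm_le_const (a := 0) (b := x) (C := 1)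
        (f := Real.sinc) fun t _ => Real.abs_sinc_le_one t
      rw [Real.norm_eq_abs, sub_zero, abs_of_nonneg hx] at this
      unfold sineInt
      linarith
    · have h1 := abs_sineInt_sub_le (by linarith : 0 < x)
      have h2 : 2 / x ≤ 2 := by
        rw [div_le_iff₀ (by linarith)]; linarith
      rw [abs_le] at h1 ⊢
      constructor <;> linarith [Real.pi_le_four, Real.pi_pos]
  rcases le_total 0 x with h | h
  · exact key x h
  · have := key (-x) (by linarith)
    rwa [sineInt_neg, abs_neg] at this

theorem tendsto_sineInt_atTop : Tendsto sineInt atTop (𝓝 (Real.pi / 2)) := by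
  rw [tendsto_iff_norm_sub_tendsto_zero]
  refine squeeze_zero' (Eventually.of_forall fun _ => norm_nonneg _) ?_
    (tendsto_const_nhds.div_atTop tendsto_id : Tendsto (fun x : ℝ => 2 / x) atTop (𝓝 0))
  filter_upwards [eventually_gt_atTop 0] with x hx using abs_sineInt_sub_le hx

theorem tendsto_sineInt_nat_mul (ξ : ℝ) :
    Tendsto (fun n : ℕ => sineInt ((n + 1) * ξ)) atTop (𝓝 (Real.pi / 2 * SignType.sign ξ)) := by
  have hn : Tendsto (fun n : ℕ => (n : ℝ) + 1) atTop atTop :=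
    tendsto_atTop_add_const_right _ _ tendsto_natCast_atTop_atTop
  rcases lt_trichotomy ξ 0 with h | h | h
  · have h1 : Tendsto (fun n : ℕ => sineInt ((n + 1) * (-ξ))) atTop (𝓝 (Real.pi / 2)) :=
      tendsto_sineInt_atTop.comp (hn.atTop_mul_const (by linarith))
    simpa [sineInt_neg, h] using h1.neg
  · simp [h, sineInt]
  · have h1 : Tendsto (fun n : ℕ => sineInt ((n + 1) * ξ)) atTop (𝓝 (Real.pi / 2)) :=
      tendsto_sineInt_atTop.comp (hn.atTop_mul_const h)
    simpa [h] using h1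

theorem tendsto_sineInt_nat_div (ξ : ℝ) :
    Tendsto (fun n : ℕ => sineInt (((n : ℝ) + 1)⁻¹ * ξ)) atTop (𝓝 0) := by
  have hn : Tendsto (fun n : ℕ => ((n : ℝ) + 1)⁻¹ * ξ) atTop (𝓝 (0 * ξ)) :=
    (tendsto_inv_atTop_zero.comp
      (tendsto_atTop_add_const_right _ _ tendsto_natCast_atTop_atTop)).mul_const ξ
  have h0 : sineInt (0 * ξ) = 0 := by simp [sineInt]
  have := (continuous_sineInt.tendsto (0 * ξ)).comp hn
  rwa [h0] at this

theorem integral_sin_mul_div {a b : ℝ} (ha : 0 < a) (hab : a ≤ b) (ξ : ℝ) :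
    ∫ h in Set.Ioc a b, h⁻¹ * Real.sin (h * ξ) = sineInt (b * ξ) - sineInt (a * ξ) := by
  have e : ∀ h ∈ Set.Ioc a b, h⁻¹ * Real.sin (h * ξ) = ξ * Real.sinc (h * ξ) := by
    intro h hh
    have h0 : h ≠ 0 := (ha.trans hh.1).ne'
    rcases eq_or_ne ξ 0 with hξ | hξ
    · simp [hξ]
    · rw [Real.sinc_of_ne_zero (mul_ne_zero h0 hξ)]
      field_simp
  rw [setIntegral_congr_fun measurableSet_Ioc e, ← intervalIntegral.integral_of_le hab,
    intervalIntegral.integral_const_mul, intervalIntegral.mul_integral_comp_mul_right]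
  unfold sineInt
  rw [intervalIntegral.integral_interval_sub_left]
  · exact Real.continuous_sinc.intervalIntegrable _ _
  · exact Real.continuous_sinc.intervalIntegrable _ _

theorem exp_add_sub_exp_sub (x h ξ : ℝ) :
    Complex.exp (Complex.I * ((x + h : ℝ) * ξ)) - Complex.exp (Complex.I * ((x - h : ℝ) * ξ)) =
      2 * Complex.I * Real.sin (h * ξ) * Complex.exp (Complex.I * (x * ξ)) := by
  have e1 : Complex.I * ((x + h : ℝ) * ξ) = Complex.I * (x * ξ) + ((h * ξ : ℝ) : ℂ) * Complex.I := by
    push_cast; ring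
  have e2 : Complex.I * ((x - h : ℝ) * ξ) =
      Complex.I * (x * ξ) + -((h * ξ : ℝ) : ℂ) * Complex.I := by
    push_cast; ring
  rw [e1, e2, Complex.exp_add, Complex.exp_add, Complex.exp_mul_I, Complex.exp_mul_I,
    Complex.cos_neg, Complex.sin_neg, Complex.ofReal_sin]
  ring

/-- The Hilbert transform acts on a superposition of exponentials with integrable amplitude by the
multiplier `iπ sign`. -/
theorem hilb_integral_exp {Ω : Type*} [MeasurableSpace Ω] {μ : Measure Ω} [SFinite μ] {ξ : Ω → ℝ}
    (hξ : Measurable ξ) {G : Ω → ℂ} (hG : Integrable G μ) {β C R x : ℝ} (hβ : 0 < β) {q : ℝ → ℂ}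
    (hq : ∀ u, q u = ∫ η, Complex.exp (Complex.I * (u * ξ η)) * G η ∂μ)
    (hA : HolderAt β C R x q) :
    hilb q x = ∫ η, Complex.I * Real.pi * ((SignType.sign (ξ η) : ℝ) : ℂ) *
      (Complex.exp (Complex.I * (x * ξ η)) * G η) ∂μ := by
  have hnorm : ∀ (u : ℝ) (η : Ω), ‖Complex.exp (Complex.I * (u * ξ η))‖ = 1 := by
    intro u η
    rw [mul_comm, ← Complex.ofReal_mul, Complex.norm_exp_ofReal_mul_I]
  have hme : ∀ u : ℝ, Measurable fun η => Complex.exp (Complex.I * (u * ξ η)) := by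
    intro u; fun_prop
  have hi : ∀ u : ℝ, Integrable (fun η => Complex.exp (Complex.I * (u * ξ η)) * G η) μ := fun u =>
    hG.bdd_mul (c := 1) (hme u).aestronglyMeasurable (Eventually.of_forall fun η => (hnorm u η).le)
  set s : ℕ → Set ℝ := fun n => Set.Ioc (((n : ℝ) + 1)⁻¹) ((n : ℝ) + 1) with hs
  have hpos : ∀ n : ℕ, 0 < ((n : ℝ) + 1)⁻¹ := fun n => by positivity
  have hle : ∀ n : ℕ, ((n : ℝ) + 1)⁻¹ ≤ (n : ℝ) + 1 := fun n =>
    (inv_le_one_of_one_le₀ (by linarith [n.cast_nonneg (α := ℝ)])).trans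
      (by linarith [n.cast_nonneg (α := ℝ)])
  -- the truncated integrals, by Fubini
  have trunc : ∀ n : ℕ, ∫ h in s n, h⁻¹ • (q (x + h) - q (x - h)) =
      ∫ η, 2 * Complex.I * ((sineInt ((n + 1) * ξ η) - sineInt (((n : ℝ) + 1)⁻¹ * ξ η) : ℝ) : ℂ) *
        (Complex.exp (Complex.I * (x * ξ η)) * G η) ∂μ := by
    intro n
    have e1 : ∀ h : ℝ, h⁻¹ • (q (x + h) - q (x - h)) = ∫ η,
        2 * Complex.I * ((h⁻¹ * Real.sin (h * ξ η) : ℝ) : ℂ) *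
          (Complex.exp (Complex.I * (x * ξ η)) * G η) ∂μ := by
      intro h
      rw [hq, hq, ← integral_sub (hi _) (hi _), ← integral_smul]
      congr 1; ext η
      rw [← sub_mul, exp_add_sub_exp_sub, Complex.real_smul]
      push_cast
      ring
    simp only [e1]
    rw [integral_integral_swap]
    · congr 1; ext η
      rw [← integral_sin_mul_div (hpos n) (hle n), integral_mul_const, integral_const_mul,
        integral_complex_ofReal]
    · have hb : Integrable (fun p : ℝ × Ω => 2 * (n + 1 : ℝ) * ‖G p.2‖)
          ((volume.restrict (s n)).prod μ) :=
        Integrable.comp_snd (hG.norm.const_mul _) _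
      refine hb.mono' ?_ ?_
      · refine AEStronglyMeasurable.mul ?_ (AEStronglyMeasurable.mul ?_ ?_)
        · exact Measurable.aestronglyMeasurable (by fun_prop)
        · exact Measurable.aestronglyMeasurable (by fun_prop)
        · exact hG.1.comp_snd
      · have : ∀ᵐ q ∂((volume.restrict (s n)).prod μ), q.1 ∈ s n :=
          Measure.quasiMeasurePreserving_fst.ae (ae_restrict_mem measurableSet_Ioc)
        filter_upwards [this] with p hp
        have hp0 : 0 < p.1 := (hpos n).trans hp.1
        simp only [Function.uncurry]
        rw [norm_mul, norm_mul, norm_mul, norm_mul, hnorm, Complex.norm_I, Complex.norm_real,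
          norm_mul, one_mul, norm_inv, Real.norm_eq_abs, Real.norm_eq_abs, abs_of_pos hp0]
        have h1 : p.1⁻¹ ≤ (n : ℝ) + 1 := by
          rw [inv_le_comm₀ hp0 (by positivity)]
          exact hp.1.le
        have h2 := Real.abs_sin_le_one (p.1 * ξ p.2)
        have h3 : p.1⁻¹ * |Real.sin (p.1 * ξ p.2)| ≤ ((n : ℝ) + 1) * 1 := by gcongr
        simp only [Complex.norm_ofNat, mul_one]
        rw [mul_one] at h3
        gcongr
  have lim1 : Tendsto (fun n => ∫ h in s n, h⁻¹ • (q (x + h) - q (x - h))) atTop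
      (𝓝 (hilb q x)) := by
    have hint := hA.integrableOn_quot hβ
    have key : Tendsto (fun n => ∫ h in Set.Ioi (0 : ℝ),
        (s n).indicator (fun h : ℝ => h⁻¹ • (q (x + h) - q (x - h))) h) atTop (𝓝 (hilb q x)) := by
      refine tendsto_integral_of_dominated_convergence
        (fun h => ‖h⁻¹ • (q (x + h) - q (x - h))‖)
        (fun δ => (hint.1.indicator measurableSet_Ioc)) hint.norm
        (fun δ => Eventually.of_forall fun h => norm_indicator_le_norm_self _ _) ?_
      filter_upwards [ae_restrict_mem measurableSet_Ioi] with h hh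
      refine tendsto_const_nhds.congr' ?_
      have t1 : Tendsto (fun n : ℕ => (n : ℝ) + 1) atTop atTop :=
        tendsto_atTop_add_const_right _ _ tendsto_natCast_atTop_atTop
      have t2 := tendsto_inv_atTop_zero.comp t1
      filter_upwards [t1.eventually_ge_atTop h, t2.eventually_lt_const hh] with n h1 h2
      rw [Set.indicator_of_mem (by exact ⟨h2, h1⟩)]
    refine key.congr fun n => ?_
    have hsub : s n ∩ Set.Ioi 0 = s n := Set.inter_eq_left.2 fun y hy => (hpos n).trans hy.1
    rw [integral_indicator measurableSet_Ioc, Measure.restrict_restrict measurableSet_Ioc]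
    exact congrArg (fun A => ∫ h in A, h⁻¹ • (q (x + h) - q (x - h))) hsub
  -- the limit under the integral sign over the frequencies, where `sineInt` is bounded
  refine tendsto_nhds_unique lim1 ?_
  simp only [trunc]
  refine tendsto_integral_of_dominated_convergence (fun η => 16 * ‖G η‖) ?_ (hG.norm.const_mul _)
    ?_ ?_
  · intro n
    refine AEStronglyMeasurable.mul ?_ (hi x).1
    have := continuous_sineInt.measurable
    exact Measurable.aestronglyMeasurable (by fun_prop)
  · intro n
    refine Eventually.of_forall fun η => ?_
    rw [norm_mul, norm_mul, norm_mul, norm_mul, hnorm, Complex.norm_I, Complex.norm_real]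
    have h1 := abs_sineInt_le ((n + 1) * ξ η)
    have h2 := abs_sineInt_le (((n : ℝ) + 1)⁻¹ * ξ η)
    have h3 : ‖sineInt ((n + 1) * ξ η) - sineInt (((n : ℝ) + 1)⁻¹ * ξ η)‖ ≤ 8 :=
      (norm_sub_le _ _).trans (by simp only [Real.norm_eq_abs]; linarith)
    simp only [Complex.norm_ofNat, mul_one, one_mul]
    have := norm_nonneg (G η)
    nlinarith
  · refine Eventually.of_forall fun η => ?_
    have h := (tendsto_sineInt_nat_mul (ξ η)).sub (tendsto_sineInt_nat_div (ξ η))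
    have h' := ((Complex.continuous_ofReal.tendsto _).comp h).const_mul (2 * Complex.I)
    have e : 2 * Complex.I * ((Real.pi / 2 * (SignType.sign (ξ η) : ℝ) - 0 : ℝ) : ℂ) =
        Complex.I * Real.pi * ((SignType.sign (ξ η) : ℝ) : ℂ) := by
      push_cast; ring
    rw [e] at h'
    exact h'.mul_const _

/-! ### Fourier inversion, and the Wiener algebra -/

theorem integral_fourier_mul {f g : Plane → ℂ} (hf : Integrable f) (hg : Integrable g) :
    ∫ ξ, 𝓕 f ξ * g ξ = ∫ x, f x * 𝓕 g x := by
  simpa using! VectorFourier.integral_bilin_fourierIntegral_eq_flip (ContinuousLinearMap.mul ℂ ℂ)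
    (L := innerₗ Plane) Real.continuous_fourierChar continuous_inner hf hg

theorem integral_fourierInv_mul {f g : Plane → ℂ} (hf : Integrable f) (hg : Integrable g) :
    ∫ ξ, 𝓕⁻ f ξ * g ξ = ∫ x, f x * 𝓕⁻ g x := by
  have h := integral_fourier_mul hf hg.comp_neg
  rw [Real.fourierInv_eq_fourier_comp_neg g, ← h,
    ← integral_neg_eq_self fun ξ => 𝓕 f ξ * g (-ξ)]
  simp [Real.fourierInv_eq_fourier_neg]

theorem continuous_fourier {f : Plane → ℂ} (hf : Integrable f) : Continuous (𝓕 f) :=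
  VectorFourier.fourierIntegral_continuous Real.continuous_fourierChar
    (L := innerₗ Plane) continuous_inner hf

theorem continuous_fourierInv {f : Plane → ℂ} (hf : Integrable f) : Continuous (𝓕⁻ f) := by
  rw [Real.fourierInv_eq_fourier_comp_neg]
  exact continuous_fourier hf.comp_neg

theorem ae_eq_of_forall_schwartz {f g : Plane → ℂ} (hf : LocallyIntegrable f)
    (hg : LocallyIntegrable g) (h : ∀ φ : 𝓢(Plane, ℂ), ∫ x, φ x * f x = ∫ x, φ x * g x) :
    f =ᵐ[volume] g := by
  refine ae_eq_of_integral_contDiff_smul_eq hf hg fun φ hφ hφc => ?_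
  have hc : HasCompactSupport fun x => (φ x : ℂ) := hφc.comp_left Complex.ofReal_zero
  have := h (hc.toSchwartzMap (Complex.ofRealCLM.contDiff.comp hφ))
  simp only [Complex.real_smul]
  exact this

/-- Fourier inversion for integrable functions that need not be continuous. -/
theorem fourier_fourierInv_ae {a : Plane → ℂ} (ha : Integrable a) (ha' : Integrable (𝓕⁻ a)) :
    𝓕 (𝓕⁻ a) =ᵐ[volume] a := by
  refine ae_eq_of_forall_schwartz (continuous_fourier ha').locallyIntegrable
    ha.locallyIntegrable fun φ => ?_
  have h1 := integral_fourier_mul φ.integrable ha'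
  have h2 := integral_fourierInv_mul (𝓕 φ).integrable ha
  rw [← h1, ← SchwartzMap.fourier_coe]
  simp_rw [mul_comm _ (𝓕⁻ a _), ← mul_comm _ (𝓕⁻ a _)]
  rw [← h2, ← SchwartzMap.fourierInv_coe]
  simp

theorem fourierInv_convolution {f g : Plane → ℂ} (hf : Integrable f) (hg : Integrable g)
    (z : Plane) :
    𝓕⁻ (convolution f g (ContinuousLinearMap.mul ℂ ℂ) volume) z = 𝓕⁻ f z * 𝓕⁻ g z := by
  simp only [Real.fourierInv_eq_fourier_neg]
  exact Real.fourier_mul_convolution_eq hf hg (-z)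

theorem integral_norm_convolution_le {f g : Plane → ℂ} (hf : Integrable f) (hg : Integrable g) :
    ∫ x, ‖convolution f g (ContinuousLinearMap.mul ℂ ℂ) volume x‖ ≤
      (∫ x, ‖f x‖) * ∫ x, ‖g x‖ := by
  rw [show (∫ x, ‖f x‖) * ∫ x, ‖g x‖ = ContinuousLinearMap.mul ℝ ℝ (∫ x, ‖f x‖) (∫ x, ‖g x‖)
    from rfl, ← integral_convolution (μ := (volume : Measure Plane)) (ν := (volume : Measure Plane))
      (ContinuousLinearMap.mul ℝ ℝ) hf.norm hg.norm]
  refine integral_mono_of_nonneg (Eventually.of_forall fun _ => norm_nonneg _)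
    (hf.norm.integrable_convolution _ hg.norm) (Eventually.of_forall fun x => ?_)
  refine (norm_integral_le_integral_norm _).trans (le_of_eq ?_)
  simp [convolution]

theorem integrable_tsum_of_summable {α : Type*} [MeasurableSpace α] {μ : Measure α}
    {F : ℕ → α → ℂ} (hF : ∀ i, Integrable (F i) μ) (hs : Summable fun i => ∫ a, ‖F i a‖ ∂μ) :
    Integrable (fun a => ∑' i, F i a) μ := by
  have hfin : ∑' i, ∫⁻ a, ‖F i a‖ₑ ∂μ ≠ ⊤ := by
    have e : ∀ i, ∫⁻ a, ‖F i a‖ₑ ∂μ = ENNReal.ofReal (∫ a, ‖F i a‖ ∂μ) := fun i => by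
      rw [ofReal_integral_norm_eq_lintegral_enorm (hF i)]
    simp only [e]
    exact hs.tsum_ofReal_ne_top
  have hle : ∫⁻ a, ∑' i, ‖F i a‖ₑ ∂μ ≠ ⊤ := by
    rwa [lintegral_tsum fun i => (hF i).1.enorm]
  have hae : ∀ᵐ a ∂μ, Summable fun i => F i a := by
    filter_upwards [ae_lt_top' (AEMeasurable.tsum fun i => (hF i).1.enorm) hle] with a ha
    refine Summable.of_norm ?_
    have : Summable fun i => ‖F i a‖₊ := ENNReal.tsum_coe_ne_top_iff_summable.1 ha.ne
    exact NNReal.summable_coe.2 this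
  refine ⟨?_, ?_⟩
  · refine aestronglyMeasurable_of_tendsto_ae atTop
      (f := fun n a => ∑ i ∈ Finset.range n, F i a) (fun n => ?_) ?_
    · exact (integrable_finsetSum _ fun i _ => hF i).1
    · filter_upwards [hae] with a ha using ha.hasSum.tendsto_sum_nat
  · refine lt_of_le_of_lt (lintegral_mono fun a => ?_) hle.lt_top
    exact enorm_tsum_le_tsum_enorm

/-- If `M` and `Φ` are Fourier transforms of integrable functions, then the Fourier transform of
`M exp(-iΦ)` is integrable: the exponential series converges in the convolution algebra `L¹`. -/
theorem integrable_fourier_mul_exp {M Φ a g : Plane → ℂ} (ha : Integrable a) (hg : Integrable g)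
    (haM : ∀ z, 𝓕⁻ a z = M z) (hgΦ : ∀ z, 𝓕⁻ g z = Φ z)
    (hi : Integrable fun z => M z * Complex.exp (-Complex.I * Φ z)) :
    Integrable (𝓕 fun z => M z * Complex.exp (-Complex.I * Φ z)) := by
  -- `b k` is the convolution of `a` with `k` copies of `g`: a Fourier preimage of `M Φ ^ k`
  set b : ℕ → Plane → ℂ := fun k =>
    (fun f => convolution f g (ContinuousLinearMap.mul ℂ ℂ) volume)^[k] a with hb
  have hb1 : ∀ k, b (k + 1) = convolution (b k) g (ContinuousLinearMap.mul ℂ ℂ) volume := fun k => by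
    simp only [hb, Function.iterate_succ_apply']
  have hbi : ∀ k, Integrable (b k) := by
    intro k
    induction k with
    | zero => exact ha
    | succ k ih => rw [hb1]; exact ih.integrable_convolution _ hg
  have hbF : ∀ k z, 𝓕⁻ (b k) z = M z * Φ z ^ k := by
    intro k z
    induction k with
    | zero => simp [hb, haM]
    | succ k ih => rw [hb1, fourierInv_convolution (hbi k) hg, ih, hgΦ, pow_succ, mul_assoc]
  have hbn : ∀ k, ∫ x, ‖b k x‖ ≤ (∫ x, ‖a x‖) * (∫ x, ‖g x‖) ^ k := by
    intro k
    induction k with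
    | zero => simp [hb]
    | succ k ih =>
      rw [hb1, pow_succ, ← mul_assoc]
      exact (integral_norm_convolution_le (hbi k) hg).trans
        (mul_le_mul_of_nonneg_right ih (integral_nonneg fun _ => norm_nonneg _))
  set F : ℕ → Plane → ℂ := fun k ξ => ((-Complex.I) ^ k / (k.factorial : ℂ)) * b k ξ with hF
  have hFi : ∀ k, Integrable (F k) := fun k => (hbi k).const_mul _
  have hFs : Summable fun k => ∫ x, ‖F k x‖ := by
    refine Summable.of_nonneg_of_le (fun k => integral_nonneg fun _ => norm_nonneg _) (fun k => ?_)
      ((Real.summable_pow_div_factorial (∫ x, ‖g x‖)).mul_left (∫ x, ‖a x‖))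
    simp only [hF, norm_mul, norm_div, norm_pow, norm_neg, Complex.norm_I, one_pow,
      RCLike.norm_natCast]
    rw [integral_const_mul]
    calc _ ≤ 1 / (k.factorial : ℝ) * ((∫ x, ‖a x‖) * (∫ x, ‖g x‖) ^ k) := by
          gcongr; exact hbn k
      _ = _ := by ring
  have hA := integrable_tsum_of_summable hFi hFs
  have hAF : 𝓕⁻ (fun ξ => ∑' k, F k ξ) = fun z => M z * Complex.exp (-Complex.I * Φ z) := by
    ext z
    have hnorm : ∀ ξ : Plane, ‖(Real.fourierChar (inner ℝ ξ z) : ℂ)‖ = 1 := fun ξ => Circle.norm_coe _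
    have hmeas : Continuous fun ξ : Plane => (Real.fourierChar (inner ℝ ξ z) : ℂ) := by
      simp only [Real.fourierChar_apply]
      fun_prop
    have h1 := hasSum_integral_of_summable_integral_norm
      (F := fun k ξ => (Real.fourierChar (inner ℝ ξ z) : ℂ) * F k ξ) (μ := (volume : Measure Plane))
      (fun k => (hFi k).bdd_mul (c := 1) hmeas.aestronglyMeasurable
        (Eventually.of_forall fun ξ => (hnorm ξ).le)) (by simpa only [norm_mul, hnorm, one_mul] using hFs)
    have h2 : ∀ k, ∫ ξ, (Real.fourierChar (inner ℝ ξ z) : ℂ) * F k ξ =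
        M z * ((-Complex.I * Φ z) ^ k / (k.factorial : ℂ)) := by
      intro k
      have h3 := hbF k z
      rw [Real.fourierInv_eq] at h3
      simp only [Circle.smul_def, smul_eq_mul] at h3
      simp only [hF, mul_left_comm _ ((-Complex.I) ^ k / (k.factorial : ℂ))]
      rw [integral_const_mul, h3, mul_pow]
      ring
    simp only [h2, tsum_mul_left] at h1
    have h4 : HasSum (fun k : ℕ => M z * ((-Complex.I * Φ z) ^ k / (k.factorial : ℂ)))
        (M z * Complex.exp (-Complex.I * Φ z)) := by
      rw [Complex.exp_eq_exp_ℂ]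
      exact (NormedSpace.expSeries_div_hasSum_exp (-Complex.I * Φ z)).mul_left _
    rw [Real.fourierInv_eq]
    simp only [Circle.smul_def, smul_eq_mul]
    exact h1.unique h4
  rw [← hAF] at hi ⊢
  exact hA.congr (fourier_fourierInv_ae hA hi).symm

/-! ### Regularity of wavefronts -/

/-- The Fourier representation of a wavefront: an integrable amplitude with half a moment. -/
theorem exists_fourierInv_eq {Φ : Plane → ℝ} (hc : Continuous Φ) (h : MemH (11 / 6) Φ) :
    ∃ G : Plane → ℂ, Integrable G ∧
      Integrable (fun ξ => (1 + ‖ξ‖ ^ 2) ^ (1 / 4 : ℝ) * ‖G ξ‖) ∧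
      ∀ z, 𝓕⁻ G z = (Φ z : ℂ) := by
  obtain ⟨hL, hS⟩ := h
  set f : 𝓢'(Plane, ℂ) := ((hL.toLp (fun z => (Φ z : ℂ)) : Lp ℂ 2 (volume : Measure Plane)) :
    𝓢'(Plane, ℂ)) with hf
  -- `11/6 - 1/2 = 4/3 > 1` derivatives in `L²` make the Fourier transform integrable in the plane
  have hS' : TemperedDistribution.MemSobolev (4 / 3) 2
      (TemperedDistribution.besselPotential Plane ℂ (1 / 2) f) := by
    rw [TemperedDistribution.memSobolev_besselPotential_iff]
    convert! hS using 1
    norm_num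
  obtain ⟨v, hv⟩ := hS'.fourier_memL1 (by simp; norm_num)
  rw [TemperedDistribution.fourier_besselPotential_eq_smulLeftCLM_fourier_apply] at hv
  have hvi : Integrable v := L1.integrable_coeFn v
  set w : Plane → ℝ := fun ξ => (1 + ‖ξ‖ ^ 2) ^ (-1 / 4 : ℝ) with hw
  have hwg : (fun ξ => (w ξ : ℂ)).HasTemperateGrowth := by fun_prop
  have hwpos : ∀ ξ, 0 < w ξ := fun ξ => by positivity
  have hwle : ∀ ξ, w ξ ≤ 1 := fun ξ =>
    Real.rpow_le_one_of_one_le_of_nonpos (by nlinarith [norm_nonneg ξ]) (by norm_num)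
  have hwc : Continuous w := by
    exact (by fun_prop : Continuous fun ξ : Plane => 1 + ‖ξ‖ ^ 2).rpow_const
      fun ξ => Or.inl (by positivity)
  have hGi : Integrable fun ξ => (w ξ : ℂ) * v ξ :=
    hvi.bdd_mul (c := 1) (Complex.continuous_ofReal.comp hwc).aestronglyMeasurable
      (Eventually.of_forall fun ξ => by
        rw [Complex.norm_real, Real.norm_eq_abs, abs_of_pos (hwpos ξ)]; exact hwle ξ)
  refine ⟨fun ξ => (w ξ : ℂ) * v ξ, hGi, ?_, ?_⟩
  · refine hvi.norm.congr (Eventually.of_forall fun ξ => ?_)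
    simp only [norm_mul, Complex.norm_real, Real.norm_eq_abs, abs_of_pos (hwpos ξ)]
    rw [← mul_assoc, hw, ← Real.rpow_add (by positivity)]
    norm_num
  · -- undo the Bessel potential on the side of the tempered distributions
    have hdist : 𝓕 f = TemperedDistribution.smulLeftCLM ℂ (fun ξ => (w ξ : ℂ))
        (v : 𝓢'(Plane, ℂ)) := by
      rw [← hv, TemperedDistribution.smulLeftCLM_smulLeftCLM_apply (by fun_prop) hwg]
      convert! (TemperedDistribution.smulLeftCLM_const 1 (𝓕 f)).symm using 1
      · simp
      · congr
        ext ξ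
        rw [Pi.mul_apply, hw]
        rw [← Complex.ofReal_mul, ← Real.rpow_add (by positivity),
          show (1 / 2 / 2 : ℝ) + -1 / 4 = 0 by norm_num, Real.rpow_zero, Complex.ofReal_one]
    have hae : (fun z => (Φ z : ℂ)) =ᵐ[volume] 𝓕⁻ (fun ξ => (w ξ : ℂ) * v ξ) := by
      refine ae_eq_of_forall_schwartz (Complex.continuous_ofReal.comp hc).locallyIntegrable
        (continuous_fourierInv hGi).locallyIntegrable fun φ => ?_
      have h1 := congrArg (fun T : 𝓢'(Plane, ℂ) => T (𝓕⁻ φ)) hdist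
      simp only [TemperedDistribution.fourier_apply, hf, Lp.toTemperedDistribution_apply,
        TemperedDistribution.smulLeftCLM_apply_apply] at h1
      rw [← integral_fourierInv_mul φ.integrable hGi]
      have h2 : ∫ x, φ x * (Φ x : ℂ) = ∫ x, (𝓕 (𝓕⁻ φ)) x • (hL.toLp (fun z => (Φ z : ℂ))) x := by
        refine integral_congr_ae ?_
        filter_upwards [hL.coeFn_toLp] with x hx
        rw [hx]
        simp
      rw [h2, h1]
      refine integral_congr_ae (Eventually.of_forall fun ξ => ?_)
      simp only [SchwartzMap.smulLeftCLM_apply_apply hwg, smul_eq_mul, ← SchwartzMap.fourierInv_coe]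
      ring
    have := Continuous.ae_eq_iff_eq volume (Complex.continuous_ofReal.comp hc)
      (continuous_fourierInv hGi)
    intro z
    exact (congrFun (this.1 hae) z).symm

theorem norm_exp_sub_one_le_sqrt (t : ℝ) : ‖Complex.exp (Complex.I * t) - 1‖ ≤ 2 * √|t| := by
  rcases le_total |t| 1 with h | h
  · have h1 : ‖Complex.exp (Complex.I * t) - 1‖ ≤ |t| := by
      simpa using Real.norm_exp_I_mul_ofReal_sub_one_le (x := t)
    have h2 : |t| ≤ √|t| := by
      refine Real.le_sqrt_of_sq_le ?_
      nlinarith [abs_nonneg t]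
    linarith [Real.sqrt_nonneg |t|]
  · have h1 : ‖Complex.exp (Complex.I * t) - 1‖ ≤ 2 := by
      refine (norm_sub_le _ _).trans ?_
      rw [mul_comm, Complex.norm_exp_ofReal_mul_I, norm_one]; norm_num
    have h2 : 1 ≤ √|t| := by rwa [Real.one_le_sqrt]
    linarith

/-- Wavefronts in `H^{11/6}` are Hölder continuous with exponent `1/2`. -/
theorem exists_holder {Φ : Plane → ℝ} {G : Plane → ℂ} (hG : Integrable G)
    (hG' : Integrable (fun ξ => (1 + ‖ξ‖ ^ 2) ^ (1 / 4 : ℝ) * ‖G ξ‖))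
    (hΦ : ∀ z, 𝓕⁻ G z = (Φ z : ℂ)) :
    ∃ C, 0 ≤ C ∧ ∀ z z', |Φ z - Φ z'| ≤ C * dist z z' ^ (1 / 2 : ℝ) := by
  refine ⟨2 * √(2 * Real.pi) * ∫ ξ, (1 + ‖ξ‖ ^ 2) ^ (1 / 4 : ℝ) * ‖G ξ‖, ?_, fun z z' => ?_⟩
  · have : 0 ≤ ∫ ξ : Plane, (1 + ‖ξ‖ ^ 2) ^ (1 / 4 : ℝ) * ‖G ξ‖ :=
      integral_nonneg fun ξ => by positivity
    positivity
  · have e : ∀ z : Plane, (Φ z : ℂ) = ∫ ξ, Complex.exp (Complex.I *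
        ((2 * Real.pi * inner ℝ ξ z : ℝ) : ℂ)) * G ξ := fun z => by
      rw [← hΦ z, Real.fourierInv_eq']
      refine integral_congr_ae (Eventually.of_forall fun ξ => ?_)
      simp only [smul_eq_mul]
      rw [mul_comm Complex.I]
    have hn : ∀ t : ℝ, ‖Complex.exp (Complex.I * t)‖ = 1 := fun t => by
      rw [mul_comm, Complex.norm_exp_ofReal_mul_I]
    have hi : ∀ z : Plane, Integrable fun ξ => Complex.exp (Complex.I *
        ((2 * Real.pi * inner ℝ ξ z : ℝ) : ℂ)) * G ξ := fun z =>
      hG.bdd_mul (c := 1) (Continuous.aestronglyMeasurable (by fun_prop))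
        (Eventually.of_forall fun ξ => (hn _).le)
    have e2 : |Φ z - Φ z'| = ‖(Φ z : ℂ) - (Φ z' : ℂ)‖ := by
      rw [← Complex.ofReal_sub, Complex.norm_real, Real.norm_eq_abs]
    rw [e2, e, e, ← integral_sub (hi z) (hi z')]
    have hb : ∀ ξ : Plane, ‖Complex.exp (Complex.I * ((2 * Real.pi * inner ℝ ξ z : ℝ) : ℂ)) * G ξ -
        Complex.exp (Complex.I * ((2 * Real.pi * inner ℝ ξ z' : ℝ) : ℂ)) * G ξ‖ ≤
        2 * √(2 * Real.pi) * dist z z' ^ (1 / 2 : ℝ) *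
          ((1 + ‖ξ‖ ^ 2) ^ (1 / 4 : ℝ) * ‖G ξ‖) := by
      intro ξ
      set t : ℝ := 2 * Real.pi * inner ℝ ξ (z - z') with ht
      have e3 : Complex.exp (Complex.I * ((2 * Real.pi * inner ℝ ξ z : ℝ) : ℂ)) =
          Complex.exp (Complex.I * ((2 * Real.pi * inner ℝ ξ z' : ℝ) : ℂ)) *
            Complex.exp (Complex.I * t) := by
        rw [← Complex.exp_add, ht, inner_sub_right]
        congr 1
        push_cast
        ring
      have e4 : Complex.exp (Complex.I * ((2 * Real.pi * inner ℝ ξ z : ℝ) : ℂ)) * G ξ -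
          Complex.exp (Complex.I * ((2 * Real.pi * inner ℝ ξ z' : ℝ) : ℂ)) * G ξ =
          Complex.exp (Complex.I * ((2 * Real.pi * inner ℝ ξ z' : ℝ) : ℂ)) *
            ((Complex.exp (Complex.I * t) - 1) * G ξ) := by
        rw [e3]; ring
      rw [e4, norm_mul, hn, one_mul, norm_mul]
      -- the square root costs half a moment of `G`, since `t` is linear in `ξ`
      have h1 := norm_exp_sub_one_le_sqrt t
      have h2 : |t| ≤ 2 * Real.pi * ‖ξ‖ * dist z z' := by
        rw [ht, abs_mul, abs_of_pos (by positivity), dist_eq_norm, mul_assoc (2 * Real.pi)]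
        gcongr
        exact abs_real_inner_le_norm _ _
      have h3 : √|t| ≤ √(2 * Real.pi) * (1 + ‖ξ‖ ^ 2) ^ (1 / 4 : ℝ) * dist z z' ^ (1 / 2 : ℝ) := by
        refine (Real.sqrt_le_sqrt h2).trans ?_
        rw [Real.sqrt_mul (by positivity), Real.sqrt_mul (by positivity),
          Real.sqrt_eq_rpow (dist z z')]
        gcongr
        have : (1 + ‖ξ‖ ^ 2 : ℝ) ^ (1 / 4 : ℝ) = √√(1 + ‖ξ‖ ^ 2) := by
          rw [Real.sqrt_eq_rpow, Real.sqrt_eq_rpow, ← Real.rpow_mul (by positivity)]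
          norm_num
        rw [this]
        refine Real.sqrt_le_sqrt (Real.le_sqrt_of_sq_le ?_)
        linarith
      calc _ ≤ (2 * (√(2 * Real.pi) * (1 + ‖ξ‖ ^ 2) ^ (1 / 4 : ℝ) * dist z z' ^ (1 / 2 : ℝ))) *
            ‖G ξ‖ := by
            gcongr
            exact h1.trans (by gcongr)
        _ = _ := by ring
    refine (norm_integral_le_of_norm_le (hG'.const_mul _) (Eventually.of_forall hb)).trans
      (le_of_eq ?_)
    rw [integral_const_mul]
    ring

/-! ### The detector amplitudes in terms of Hilbert transforms -/

theorem ae_coord_ne (i : Fin 2) (c : ℝ) : ∀ᵐ z : Plane, z i ≠ c := by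
  have h : ∀ᵐ f : Fin 2 → ℝ, f i ≠ c := by
    rw [ae_iff]
    simpa [← volume_pi] using Measure.pi_hyperplane (fun _ : Fin 2 => (volume : Measure ℝ)) i c
  exact (EuclideanSpace.volume_preserving_symm_measurableEquiv_toLp
    (Fin 2)).quasiMeasurePreserving.ae h

/-- The indicator function of a quadrant in terms of signs. On the axes, a null set, the formula is
wrong. -/
theorem facet_eq_sign {m n : Fin 2} {ζ : Plane} (h0 : ζ 0 ≠ 0) (h1 : ζ 1 ≠ 0) :
    facet m n ζ = 1 / 4 * (1 + (-1) ^ (m : ℕ) * ((SignType.sign (ζ 0) : ℝ) : ℂ)) *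
      (1 + (-1) ^ (n : ℕ) * ((SignType.sign (ζ 1) : ℝ) : ℂ)) := by
  unfold facet
  rw [Set.indicator_apply]
  rcases lt_or_gt_of_ne h0 with h0 | h0 <;> rcases lt_or_gt_of_ne h1 with h1 | h1 <;>
  fin_cases m <;> fin_cases n <;>
  simp [h0, h1, h0.le, h1.le, h0.not_ge, h1.not_ge] <;> norm_num

/-- A complex amplitude in the pupil with compact support that is Hölder continuous and has an
integrable Fourier transform. -/
structure Amplitude (β C L : ℝ) (ψ : Plane → ℂ) : Prop where
  exponent_pos : 0 < β
  bddHolder : BddHolder β C fun p : ℝ × ℝ => ψ !₂[p.1, p.2]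
  supp_fst : ∀ u v, L < |u| → ψ !₂[u, v] = 0
  supp_snd : ∀ u v, L < |v| → ψ !₂[u, v] = 0
  continuous : Continuous ψ
  integrable : Integrable ψ
  integrable_fourier : Integrable (𝓕 ψ)

/-- The indicator function of `[-L, L]`. -/
def boxCut (L : ℝ) : ℝ → ℝ := chi (Set.Icc (-L) L)

theorem isCutoff_boxCut {L y : ℝ} (hy : |y| + 1 ≤ L) : IsCutoff 1 (2 * L + 1) y (boxCut L) where
  meas := measurable_const.indicator measurableSet_Icc
  abs_le w := by
    unfold boxCut chi
    rw [Set.indicator_apply]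
    split_ifs <;> simp
  eq_of w hw := by
    have h1 := abs_le.1 hw
    have h2 := abs_le.1 (le_refl |y|)
    unfold boxCut chi
    rw [Set.indicator_of_mem, Set.indicator_of_mem]
    · constructor <;> linarith
    · constructor <;> linarith
  supp w hw := by
    unfold boxCut chi
    rw [Set.indicator_of_notMem]
    rintro ⟨h1, h2⟩
    have h3 := abs_le.1 (le_refl |y|)
    have : |w - y| < 2 * L + 1 := by rw [abs_lt]; constructor <;> linarith
    linarith

theorem boxCut_of_le {L w : ℝ} (h : |w| ≤ L) : boxCut L w = 1 := by
  unfold boxCut chi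
  rw [Set.indicator_of_mem]
  exact abs_le.1 h

theorem boxCut_smul_of_supp {E : Type*} [NormedAddCommGroup E] [NormedSpace ℝ E] {L w : ℝ} {f : E}
    (h : L < |w| → f = 0) : boxCut L w • f = f := by
  rcases le_or_gt |w| L with hw | hw
  · rw [boxCut_of_le hw, one_smul]
  · rw [h hw, smul_zero]

namespace Amplitude

variable {β C L : ℝ} {ψ : Plane → ℂ}

theorem mono (h : Amplitude β C L ψ) {L' : ℝ} (hL : L ≤ L') : Amplitude β C L' ψ where
  exponent_pos := h.exponent_pos
  bddHolder := h.bddHolder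
  supp_fst u v hu := h.supp_fst u v (hL.trans_lt hu)
  supp_snd u v hu := h.supp_snd u v (hL.trans_lt hu)
  continuous := h.continuous
  integrable := h.integrable
  integrable_fourier := h.integrable_fourier

theorem bddHolder_swap (h : Amplitude β C L ψ) :
    BddHolder β C fun p : ℝ × ℝ => ψ !₂[p.2, p.1] :=
  h.bddHolder.comp h.exponent_pos (φ := Prod.swap) fun p q => by
    simp [Prod.dist_eq, max_comm]

theorem holderAt_fst (h : Amplitude β C L ψ) {x : ℝ} (hx : |x| + 1 ≤ L) (y : ℝ) :
    HolderAt β (C * (1 + 2 * 1⁻¹ ^ β)) (2 * L + 1) x fun u => ψ !₂[u, y] := by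
  have := HolderAt.cutoff_smul h.exponent_pos one_pos (isCutoff_boxCut hx)
    (h.bddHolder_swap.slice y)
  simpa only [boxCut_smul_of_supp (h.supp_fst _ y)] using this

theorem holderAt_snd (h : Amplitude β C L ψ) {y : ℝ} (hy : |y| + 1 ≤ L) (x : ℝ) :
    HolderAt β (C * (1 + 2 * 1⁻¹ ^ β)) (2 * L + 1) y fun v => ψ !₂[x, v] := by
  have := HolderAt.cutoff_smul h.exponent_pos one_pos (isCutoff_boxCut hy)
    (h.bddHolder.slice x)
  simpa only [boxCut_smul_of_supp (h.supp_snd x _)] using this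

theorem bddHolder_hilb (h : Amplitude β C L ψ) {y : ℝ} (hy : |y| + 1 ≤ L) :
    BddHolder (β / 2) (C * hilbConst β 1 (2 * L + 1)) fun u => hilb (fun v => ψ !₂[u, v]) y := by
  have := BddHolder.hilb h.exponent_pos one_pos (isCutoff_boxCut hy) h.bddHolder
  simpa only [boxCut_smul_of_supp (h.supp_snd _ _)] using this

theorem hilb_eq_zero (h : Amplitude β C L ψ) (u y : ℝ) (hu : L < |u|) :
    hilb (fun v => ψ !₂[u, v]) y = 0 := by
  simp [hilb, h.supp_fst u _ hu]

theorem holderAt_hilb (h : Amplitude β C L ψ) {x y : ℝ} (hx : |x| + 1 ≤ L) (hy : |y| + 1 ≤ L) :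
    HolderAt (β / 2) (C * hilbConst β 1 (2 * L + 1) * (1 + 2 * 1⁻¹ ^ (β / 2))) (2 * L + 1) x
      fun u => hilb (fun v => ψ !₂[u, v]) y := by
  have := HolderAt.cutoff_smul (half_pos h.exponent_pos) one_pos (isCutoff_boxCut hx)
    (h.bddHolder_hilb hy)
  simpa only [boxCut_smul_of_supp (h.hilb_eq_zero _ y)] using this

/-- The amplitude at a point as a superposition of plane waves. -/
theorem eq_integral (h : Amplitude β C L ψ) (u v : ℝ) :
    ψ !₂[u, v] = ∫ ζ : Plane, Complex.exp (Complex.I * (u * (2 * Real.pi * ζ 0 : ℝ))) *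
      (Complex.exp (Complex.I * (v * (2 * Real.pi * ζ 1 : ℝ))) * 𝓕 ψ ζ) := by
  conv_lhs => rw [← h.continuous.fourierInv_fourier_eq h.integrable h.integrable_fourier]
  rw [Real.fourierInv_eq']
  refine integral_congr_ae (Eventually.of_forall fun ζ => ?_)
  simp only [smul_eq_mul]
  rw [← mul_assoc, ← Complex.exp_add]
  congr 2
  simp [PiLp.inner_apply, Fin.sum_univ_two]
  ring

theorem norm_wave (u s : ℝ) : ‖Complex.exp (Complex.I * (u * s))‖ = 1 := by
  rw [mul_comm, ← Complex.ofReal_mul, Complex.norm_exp_ofReal_mul_I]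

theorem integrable_wave {f : Plane → ℂ} (hf : Integrable f) (v : ℝ) (i : Fin 2) :
    Integrable fun ζ : Plane =>
      Complex.exp (Complex.I * (v * (2 * Real.pi * ζ i : ℝ))) * f ζ :=
  hf.bdd_mul (c := 1) (Measurable.aestronglyMeasurable (by fun_prop))
    (Eventually.of_forall fun ζ => (norm_wave _ _).le)

theorem sign_two_pi_mul (s : ℝ) : SignType.sign (2 * Real.pi * s) = SignType.sign s := by
  rw [sign_mul, sign_pos Real.two_pi_pos, one_mul]

theorem hilb_fst_eq (h : Amplitude β C L ψ) {x : ℝ} (hx : |x| + 1 ≤ L) (y : ℝ) :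
    hilb (fun u => ψ !₂[u, y]) x = ∫ ζ : Plane, Complex.I * Real.pi *
      ((SignType.sign (ζ 0) : ℝ) : ℂ) * (Complex.exp (Complex.I * (x * (2 * Real.pi * ζ 0 : ℝ))) *
      (Complex.exp (Complex.I * (y * (2 * Real.pi * ζ 1 : ℝ))) * 𝓕 ψ ζ)) := by
  rw [hilb_integral_exp (μ := volume) (ξ := fun ζ : Plane => 2 * Real.pi * ζ 0) (by fun_prop)
    (integrable_wave h.integrable_fourier y 1) h.exponent_pos (fun u => h.eq_integral u y)
    (h.holderAt_fst hx y)]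
  simp only [sign_two_pi_mul]

theorem hilb_snd_eq (h : Amplitude β C L ψ) {y : ℝ} (hy : |y| + 1 ≤ L) (x : ℝ) :
    hilb (fun v => ψ !₂[x, v]) y = ∫ ζ : Plane, Complex.I * Real.pi *
      ((SignType.sign (ζ 1) : ℝ) : ℂ) * (Complex.exp (Complex.I * (y * (2 * Real.pi * ζ 1 : ℝ))) *
      (Complex.exp (Complex.I * (x * (2 * Real.pi * ζ 0 : ℝ))) * 𝓕 ψ ζ)) := by
  rw [hilb_integral_exp (μ := volume) (ξ := fun ζ : Plane => 2 * Real.pi * ζ 1) (by fun_prop)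
    (integrable_wave h.integrable_fourier x 0) h.exponent_pos (fun v => ?_)
    (h.holderAt_snd hy x)]
  · simp only [sign_two_pi_mul]
  · rw [h.eq_integral x v]
    simp only [mul_left_comm (Complex.exp (Complex.I * (x * _)))]

theorem integrable_sign_mul {f : Plane → ℂ} (hf : Integrable f) (i : Fin 2) :
    Integrable fun ζ : Plane => Complex.I * Real.pi * ((SignType.sign (ζ i) : ℝ) : ℂ) * f ζ := by
  have hm : Measurable fun ζ : Plane => ((SignType.sign (ζ i) : ℝ) : ℂ) := by
    have : Measurable fun s : ℝ => ((SignType.sign s : ℝ)) := by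
      simp only [sign_apply, apply_ite (fun s : SignType => (s : ℝ))]
      exact Measurable.ite measurableSet_Ioi measurable_const
        (Measurable.ite measurableSet_Iio measurable_const measurable_const)
    exact Complex.measurable_ofReal.comp (this.comp (by fun_prop))
  refine hf.bdd_mul (c := Real.pi) (measurable_const.mul hm).aestronglyMeasurable
    (Eventually.of_forall fun ζ => ?_)
  rw [norm_mul, norm_mul, Complex.norm_I, one_mul, Complex.norm_real, Complex.norm_real,
    Real.norm_eq_abs, Real.norm_eq_abs, abs_of_pos Real.pi_pos]
  refine mul_le_of_le_one_right Real.pi_pos.le ?_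
  rcases SignType.sign (ζ i) with _ | _ | _ <;> simp

theorem hilb_hilb_eq (h : Amplitude β C L ψ) {x y : ℝ} (hx : |x| + 1 ≤ L) (hy : |y| + 1 ≤ L) :
    hilb (fun u => hilb (fun v => ψ !₂[u, v]) y) x = ∫ ζ : Plane, Complex.I * Real.pi *
      ((SignType.sign (ζ 0) : ℝ) : ℂ) * (Complex.exp (Complex.I * (x * (2 * Real.pi * ζ 0 : ℝ))) *
      (Complex.I * Real.pi * ((SignType.sign (ζ 1) : ℝ) : ℂ) *
      (Complex.exp (Complex.I * (y * (2 * Real.pi * ζ 1 : ℝ))) * 𝓕 ψ ζ))) := by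
  rw [hilb_integral_exp (μ := volume) (ξ := fun ζ : Plane => 2 * Real.pi * ζ 0) (by fun_prop)
    (integrable_sign_mul (integrable_wave h.integrable_fourier y 1) 1) (half_pos h.exponent_pos)
    (fun u => ?_) (h.holderAt_hilb hx hy)]
  · simp only [sign_two_pi_mul]
  · rw [h.hilb_snd_eq hy u]
    refine integral_congr_ae (Eventually.of_forall fun ζ => ?_)
    simp only
    ring

theorem integrable_focal (h : Integrable (𝓕 ψ)) (m n : Fin 2) : Integrable (focal m n ψ) :=
  h.bdd_mul (c := 1) (measurable_facet m n).aestronglyMeasurable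
    (Eventually.of_forall fun ζ => norm_facet_le m n ζ)

theorem quarter_mul_integrals {f₀ f₁ f₂ f₃ : Plane → ℂ} (h₀ : Integrable f₀) (h₁ : Integrable f₁)
    (h₂ : Integrable f₂) (h₃ : Integrable f₃) (c₁ c₂ c₃ : ℂ) :
    1 / 4 * ((∫ ζ, f₀ ζ) - c₁ * (∫ ζ, f₁ ζ) - c₂ * (∫ ζ, f₂ ζ) - c₃ * (∫ ζ, f₃ ζ)) =
      ∫ ζ, 1 / 4 * (f₀ ζ - c₁ * f₁ ζ - c₂ * f₂ ζ - c₃ * f₃ ζ) := by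
  have k₁ := h₁.const_mul c₁
  have k₂ := h₂.const_mul c₂
  have k₃ := h₃.const_mul c₃
  have e₁ := integral_sub h₀ k₁
  have e₂ := integral_sub (h₀.sub k₁) k₂
  have e₃ := integral_sub ((h₀.sub k₁).sub k₂) k₃
  simp only [Pi.sub_apply] at e₂ e₃
  rw [integral_const_mul, e₃, e₂, e₁]
  simp only [integral_const_mul]

/-- On the detector the amplitude is filtered by `(1 ± i H_x) (1 ± i H_y) / 4`, where `H_x` and
`H_y` are the normalized Hilbert transforms. -/
theorem detAmp_eq (h : Amplitude β C L ψ) {x y : ℝ} (hx : |x| + 1 ≤ L) (hy : |y| + 1 ≤ L)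
    (m n : Fin 2) :
    detAmp m n ψ !₂[x, y] = 1 / 4 * (ψ !₂[x, y]
      - (-1) ^ (m : ℕ) * (Complex.I * (Real.pi⁻¹ : ℝ)) * hilb (fun u => ψ !₂[u, y]) x
      - (-1) ^ (n : ℕ) * (Complex.I * (Real.pi⁻¹ : ℝ)) * hilb (fun v => ψ !₂[x, v]) y
      - (-1) ^ (m : ℕ) * (-1) ^ (n : ℕ) * ((Real.pi⁻¹ : ℝ) : ℂ) ^ 2 *
        hilb (fun u => hilb (fun v => ψ !₂[u, v]) y) x) := by
  rw [h.hilb_fst_eq hx, h.hilb_snd_eq hy, h.hilb_hilb_eq hx hy, h.eq_integral x y]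
  have i0 := integrable_wave (integrable_wave h.integrable_fourier y 1) x 0
  have i0' := integrable_wave (integrable_wave h.integrable_fourier x 0) y 1
  have i1 := integrable_sign_mul i0 0
  have i2 := integrable_sign_mul i0' 1
  have i3 := integrable_sign_mul (integrable_wave
    (integrable_sign_mul (integrable_wave h.integrable_fourier y 1) 1) x 0) 0
  rw [quarter_mul_integrals i0 i1 i2 i3, detAmp, Real.fourierInv_eq']
  refine integral_congr_ae ?_
  filter_upwards [ae_coord_ne 0 0, ae_coord_ne 1 0] with ζ h0 h1
  have e : Complex.exp ((2 * Real.pi * inner ℝ ζ !₂[x, y] : ℝ) * Complex.I) =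
      Complex.exp (Complex.I * (x * (2 * Real.pi * ζ 0 : ℝ))) *
        Complex.exp (Complex.I * (y * (2 * Real.pi * ζ 1 : ℝ))) := by
    rw [← Complex.exp_add]
    congr 1
    simp [PiLp.inner_apply, Fin.sum_univ_two]
    ring
  simp only [smul_eq_mul, focal]
  rw [e, facet_eq_sign h0 h1]
  have hpi : (Real.pi : ℂ) ≠ 0 := by exact_mod_cast Real.pi_ne_zero
  push_cast
  field_simp
  ring_nf
  simp only [Complex.I_sq]
  ring

/-- In the combination of the intensities measured in `x`-direction only two interference terms
survive. -/
theorem mul_combX_intensity (h : Amplitude β C L ψ) {x y I₀ : ℝ} (hI₀ : I₀ ≠ 0)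
    (hx : |x| + 1 ≤ L) (hy : |y| + 1 ≤ L) :
    I₀ * combX I₀ (intensity ψ !₂[x, y]) =
      (1 / 2) * ((1 / Real.pi) *
          (starRingEnd ℂ (ψ !₂[x, y]) * hilb (fun u => ψ !₂[u, y]) x).im +
        (1 / Real.pi ^ 3) * (starRingEnd ℂ (hilb (fun v => ψ !₂[x, v]) y) *
          hilb (fun u => hilb (fun v => ψ !₂[u, v]) y) x).im) := by
  unfold combX intensity
  rw [mul_div_cancel₀ _ hI₀]
  simp only [h.detAmp_eq hx hy]
  generalize hilb (fun u => hilb (fun v => ψ !₂[u, v]) y) x = c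
  generalize hilb (fun u => ψ !₂[u, y]) x = a
  generalize hilb (fun v => ψ !₂[x, v]) y = b
  generalize ψ !₂[x, y] = w
  simp only [one_div, ← inv_pow]
  generalize Real.pi⁻¹ = p
  obtain ⟨a1, a2⟩ := a
  obtain ⟨b1, b2⟩ := b
  obtain ⟨c1, c2⟩ := c
  obtain ⟨w1, w2⟩ := w
  simp [Complex.normSq_apply, pow_two]
  ring

/-- In the combination of the intensities measured in `y`-direction only two interference terms
survive. -/
theorem mul_combY_intensity (h : Amplitude β C L ψ) {x y I₀ : ℝ} (hI₀ : I₀ ≠ 0)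
    (hx : |x| + 1 ≤ L) (hy : |y| + 1 ≤ L) :
    I₀ * combY I₀ (intensity ψ !₂[x, y]) =
      -(1 / 2) * ((1 / Real.pi) *
          (starRingEnd ℂ (ψ !₂[x, y]) * hilb (fun v => ψ !₂[x, v]) y).im +
        (1 / Real.pi ^ 3) * (starRingEnd ℂ (hilb (fun u => ψ !₂[u, y]) x) *
          hilb (fun u => hilb (fun v => ψ !₂[u, v]) y) x).im) := by
  unfold combY intensity
  rw [mul_div_cancel₀ _ hI₀]
  simp only [h.detAmp_eq hx hy]
  generalize hilb (fun u => hilb (fun v => ψ !₂[u, v]) y) x = c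
  generalize hilb (fun u => ψ !₂[u, y]) x = a
  generalize hilb (fun v => ψ !₂[x, v]) y = b
  generalize ψ !₂[x, y] = w
  simp only [one_div, ← inv_pow]
  generalize Real.pi⁻¹ = p
  obtain ⟨a1, a2⟩ := a
  obtain ⟨b1, b2⟩ := b
  obtain ⟨c1, c2⟩ := c
  obtain ⟨w1, w2⟩ := w
  simp [Complex.normSq_apply, pow_two]
  ring

end Amplitude

/-! ### Averages over a modulation period -/

/-- The uniform probability measure on the modulation period, if `T > 0`. -/
def period (T : ℝ) : Measure ℝ :=
  ENNReal.ofReal (1 / T) • volume.restrict (Set.Ioc (-T / 2) (T / 2))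

instance (T : ℝ) : IsFiniteMeasure (period T) := by
  unfold period
  exact Measure.smul_finite _ ENNReal.ofReal_ne_top

theorem integral_period {T : ℝ} (hT : 0 < T) (f : ℝ → ℝ) :
    ∫ t, f t ∂(period T) = (1 / T) * ∫ t in (-T / 2)..(T / 2), f t := by
  unfold period
  rw [integral_smul_measure, intervalIntegral.integral_of_le (by linarith),
    ENNReal.toReal_ofReal (by positivity), smul_eq_mul]

theorem intervalIntegrable_of_period {T : ℝ} (hT : 0 < T) {f : ℝ → ℝ}
    (hf : Integrable f (period T)) : IntervalIntegrable f volume (-T / 2) (T / 2) := by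
  rw [intervalIntegrable_iff_integrableOn_Ioc_of_le (by linarith)]
  unfold period at hf
  rwa [integrable_smul_measure (by simpa using hT) ENNReal.ofReal_ne_top] at hf

theorem integral_period_const {T : ℝ} (hT : 0 < T) (c : ℝ) : ∫ _, c ∂(period T) = c := by
  rw [integral_period hT, intervalIntegral.integral_const, smul_eq_mul]
  field_simp
  ring

theorem integral_period_comp {T : ℝ} (hT : 0 < T) (F : ℝ → ℝ) :
    ∫ t, F (2 * Real.pi * t / T) ∂(period T) =
      (1 / (2 * Real.pi)) * ∫ s in (-Real.pi)..Real.pi, F s := by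
  rw [integral_period hT]
  have hc : 2 * Real.pi / T ≠ 0 := by have := Real.pi_pos; positivity
  have h := intervalIntegral.integral_comp_mul_left (a := -T / 2) (b := T / 2) F hc
  have e1 : 2 * Real.pi / T * (-T / 2) = -Real.pi := by field_simp
  have e2 : 2 * Real.pi / T * (T / 2) = Real.pi := by field_simp
  have e3 : (fun t => F (2 * Real.pi * t / T)) = fun t => F (2 * Real.pi / T * t) := by
    ext t; congr 1; ring
  rw [e3, h, e1, e2, smul_eq_mul]
  have := Real.pi_pos
  field_simp

theorem integral_odd_eq_zero {F : ℝ → ℝ} (hF : ∀ s, F (-s) = -F s) (a : ℝ) :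
    ∫ s in (-a)..a, F s = 0 := by
  have h := intervalIntegral.integral_comp_neg (f := F) (a := -a) (b := a)
  simp only [hF, intervalIntegral.integral_neg, neg_neg] at h
  linarith

theorem integral_even {F : ℝ → ℝ} (hFc : Continuous F) (hF : ∀ s, F (-s) = F s) (a : ℝ) :
    ∫ s in (-a)..a, F s = 2 * ∫ s in (0 : ℝ)..a, F s := by
  have h := intervalIntegral.integral_comp_neg (f := F) (a := 0) (b := a)
  simp only [hF, neg_zero] at h
  rw [← intervalIntegral.integral_add_adjacent_intervals (hFc.intervalIntegrable _ _)
    (hFc.intervalIntegrable 0 _), ← h]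
  ring

theorem integral_shift_eq {F : ℝ → ℝ} (hF : Function.Periodic F (2 * Real.pi)) (c : ℝ) :
    ∫ s in (-Real.pi)..Real.pi, F (s + c) = ∫ s in (-Real.pi)..Real.pi, F s := by
  rw [intervalIntegral.integral_comp_add_right]
  have h := hF.intervalIntegral_add_eq (-Real.pi + c) (-Real.pi)
  have e1 : -Real.pi + c + 2 * Real.pi = Real.pi + c := by ring
  have e2 : -Real.pi + 2 * Real.pi = Real.pi := by ring
  rwa [e1, e2] at h

theorem integral_antiperiodic_eq_zero {F : ℝ → ℝ} (hF : ∀ s, F (s + Real.pi) = -F s) :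
    ∫ s in (-Real.pi)..Real.pi, F s = 0 := by
  have hp : Function.Periodic F (2 * Real.pi) := fun s => by
    rw [two_mul, ← add_assoc, hF, hF, neg_neg]
  have h := integral_shift_eq hp Real.pi
  simp only [hF, intervalIntegral.integral_neg] at h
  linarith

/-! ### The kernels of the pyramid operators as averages -/

theorem lKer_circular_eq {T : ℝ} (hT : 0 < T) (α x y : ℝ) :
    lKer α T .circular x y = (1 / (2 * Real.pi)) * ∫ s in (-Real.pi)..Real.pi,
      Real.cos (α * x * Real.sin s) * Real.cos (α * y * Real.cos s) := by
  rw [← integral_period_comp hT fun s =>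
    Real.cos (α * x * Real.sin s) * Real.cos (α * y * Real.cos s), integral_period hT]
  rfl

theorem lKer_neg_left (α T x y : ℝ) : lKer α T .circular (-x) y = lKer α T .circular x y := by
  simp [lKer]

theorem lKer_neg_right (α T x y : ℝ) : lKer α T .circular x (-y) = lKer α T .circular x y := by
  simp [lKer]

theorem besselJ0_eq (x : ℝ) : besselJ0 x =
    (1 / (2 * Real.pi)) * ∫ s in (-Real.pi)..Real.pi, Real.cos (x * Real.sin s) := by
  unfold besselJ0
  rw [integral_even (by fun_prop) (by simp)]
  have := Real.pi_pos
  field_simp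

theorem lKer_zero_right {T : ℝ} (hT : 0 < T) (α x : ℝ) :
    lKer α T .circular x 0 = kKer α .circular x := by
  rw [lKer_circular_eq hT, kKer, besselJ0_eq]
  simp

theorem lKer_zero_left {T : ℝ} (hT : 0 < T) (α y : ℝ) :
    lKer α T .circular 0 y = kKer α .circular y := by
  rw [lKer_circular_eq hT, kKer, besselJ0_eq]
  have h := integral_shift_eq (F := fun s => Real.cos (α * y * Real.sin s))
    (fun s => by simp) (Real.pi / 2)
  simp only [Real.sin_add_pi_div_two] at h
  simp [h]

/-- The average over the modulation of the sine of a phase difference is the sine of the unmodulated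
phase difference, damped by the kernel `l^c`: the other terms of the addition theorem are odd under
a symmetry of the circle. -/
theorem integral_sin_add {T : ℝ} (hT : 0 < T) (α d x y : ℝ) :
    ∫ t, Real.sin (d + (α * x * Real.sin (2 * Real.pi * t / T) +
      α * y * Real.cos (2 * Real.pi * t / T))) ∂(period T) =
      Real.sin d * lKer α T .circular x y := by
  rw [integral_period_comp hT fun s => Real.sin (d + (α * x * Real.sin s + α * y * Real.cos s)),
    lKer_circular_eq hT]
  have e : ∀ s, Real.sin (d + (α * x * Real.sin s + α * y * Real.cos s)) =
      Real.sin d * (Real.cos (α * x * Real.sin s) * Real.cos (α * y * Real.cos s)) +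
      (-Real.sin d * (Real.sin (α * x * Real.sin s) * Real.sin (α * y * Real.cos s)) +
      (Real.cos d * (Real.sin (α * x * Real.sin s) * Real.cos (α * y * Real.cos s)) +
      Real.cos d * (Real.cos (α * x * Real.sin s) * Real.sin (α * y * Real.cos s)))) := by
    intro s
    rw [Real.sin_add, Real.sin_add, Real.cos_add]
    ring
  simp only [e]
  rw [intervalIntegral.integral_add, intervalIntegral.integral_add, intervalIntegral.integral_add]
  · simp only [intervalIntegral.integral_const_mul]
    rw [integral_odd_eq_zero
      (F := fun s => Real.sin (α * x * Real.sin s) * Real.sin (α * y * Real.cos s)) (by simp),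
      integral_odd_eq_zero
      (F := fun s => Real.sin (α * x * Real.sin s) * Real.cos (α * y * Real.cos s)) (by simp),
      integral_antiperiodic_eq_zero
      (F := fun s => Real.cos (α * x * Real.sin s) * Real.sin (α * y * Real.cos s)) (by simp)]
    ring
  all_goals exact Continuous.intervalIntegrable (by fun_prop) _ _

/-! ### Hölder bounds that are uniform in the modulation -/

/-- A wavefront that is Hölder continuous with exponent `1/2`. -/
structure HolderWave (C : ℝ) (Φ : Plane → ℝ) : Prop where
  nonneg : 0 ≤ C
  continuous : Continuous Φ
  holder : ∀ z z', |Φ z - Φ z'| ≤ C * dist z z' ^ (1 / 2 : ℝ)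

/-- A mask that is bounded and Hölder continuous with exponent `1/2`. -/
structure HolderMask (B : ℝ) (N : Plane → ℝ) : Prop where
  continuous : Continuous N
  bddHolder : BddHolder (1 / 2) B fun p : ℝ × ℝ => N !₂[p.1, p.2]

theorem holderMask_one : HolderMask 1 fun _ => 1 where
  continuous := continuous_const
  bddHolder := ⟨fun p => by simp, fun p q => by simp; positivity⟩

theorem BddHolder.ofReal {X : Type*} [PseudoMetricSpace X] {β C : ℝ} {f : X → ℝ}
    (hf : BddHolder β C f) : BddHolder β C fun p => (f p : ℂ) where
  norm_le p := by simpa using hf.norm_le p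
  holder p q := by
    rw [← Complex.ofReal_sub, Complex.norm_real]
    exact hf.holder p q

theorem BddHolder.mul {X : Type*} [PseudoMetricSpace X] {β A B : ℝ} {f g : X → ℂ}
    (hf : BddHolder β A f) (hg : BddHolder β B g) :
    BddHolder β (2 * A * B) fun p => f p * g p where
  norm_le p := by
    have hA := (norm_nonneg _).trans (hf.norm_le p)
    have hB := (norm_nonneg _).trans (hg.norm_le p)
    rw [norm_mul]
    calc _ ≤ A * B := by
          gcongr
          · exact hf.norm_le p
          · exact hg.norm_le p
      _ ≤ _ := by nlinarith [mul_nonneg hA hB]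
  holder p q := by
    have hA := (norm_nonneg _).trans (hf.norm_le p)
    have hB := (norm_nonneg _).trans (hg.norm_le p)
    have e : f p * g p - f q * g q = f p * (g p - g q) + (f p - f q) * g q := by ring
    rw [e]
    refine (norm_add_le _ _).trans ?_
    rw [norm_mul, norm_mul]
    calc _ ≤ A * (B * dist p q ^ β) + A * dist p q ^ β * B := by
          gcongr
          · exact hf.norm_le p
          · exact hg.holder p q
          · exact hf.holder p q
          · exact hg.norm_le q
      _ = _ := by ring

theorem BddHolder.conj {X : Type*} [PseudoMetricSpace X] {β A : ℝ} {f : X → ℂ}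
    (hf : BddHolder β A f) : BddHolder β A fun p => starRingEnd ℂ (f p) where
  norm_le p := by simpa using hf.norm_le p
  holder p q := by
    rw [← map_sub, RCLike.norm_conj]
    exact hf.holder p q

theorem BddHolder.im {X : Type*} [PseudoMetricSpace X] {β A : ℝ} {f : X → ℂ}
    (hf : BddHolder β A f) : BddHolder β A fun p => (f p).im where
  norm_le p := (Complex.abs_im_le_norm _).trans (hf.norm_le p)
  holder p q := by
    rw [← Complex.sub_im]
    exact (Complex.abs_im_le_norm _).trans (hf.holder p q)

theorem norm_exp_neg_I_mul (s : ℝ) : ‖Complex.exp (-Complex.I * s)‖ = 1 := by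
  have : -Complex.I * s = ((-s : ℝ) : ℂ) * Complex.I := by push_cast; ring
  rw [this, Complex.norm_exp_ofReal_mul_I]

theorem exp_neg_I_sub (s t : ℝ) : ‖Complex.exp (-Complex.I * s) - Complex.exp (-Complex.I * t)‖ =
    ‖Complex.exp (Complex.I * ((t - s : ℝ) : ℂ)) - 1‖ := by
  have : Complex.exp (-Complex.I * s) - Complex.exp (-Complex.I * t) =
      Complex.exp (-Complex.I * t) * (Complex.exp (Complex.I * ((t - s : ℝ) : ℂ)) - 1) := by
    rw [mul_sub, ← Complex.exp_add]
    congr 2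
    · push_cast; ring
    · ring
  rw [this, norm_mul, norm_exp_neg_I_mul, one_mul]

theorem dist_toLp_le (p q : ℝ × ℝ) :
    dist (!₂[p.1, p.2] : Plane) !₂[q.1, q.2] ≤ 2 * dist p q := by
  have h1 : dist p.1 q.1 ≤ dist p q := by rw [Prod.dist_eq]; exact le_max_left _ _
  have h2 : dist p.2 q.2 ≤ dist p q := by rw [Prod.dist_eq]; exact le_max_right _ _
  rw [EuclideanSpace.dist_eq, Fin.sum_univ_two]
  refine Real.sqrt_le_iff.2 ⟨by positivity, ?_⟩
  simp only [Matrix.cons_val_zero, Matrix.cons_val_one]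
  nlinarith [dist_nonneg (x := p.1) (y := q.1), dist_nonneg (x := p.2) (y := q.2)]

/-- Rotating the tilt changes the phase by a Lipschitz function whose constant depends on `α` only:
the Hölder bound does not depend on `t`. -/
theorem bddHolder_wave {C : ℝ} {Φ : Plane → ℝ} (hΦ : HolderWave C Φ) (α T t : ℝ) :
    BddHolder (1 / 2) (1 + 2 * C + 2 * √(2 * |α|)) fun p : ℝ × ℝ =>
      Complex.exp (-Complex.I * (tilted α T Φ t !₂[p.1, p.2] : ℂ)) := by
  have hC := hΦ.nonneg
  have hs := Real.sqrt_nonneg (2 * |α|)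
  constructor
  · intro p
    rw [norm_exp_neg_I_mul]
    linarith
  · intro p q
    have e : ∀ z : Plane, Complex.exp (-Complex.I * (tilted α T Φ t z : ℂ)) =
        Complex.exp (-Complex.I * (Φ z : ℂ)) * Complex.exp (-Complex.I * (tilt α T t z : ℂ)) := by
      intro z
      rw [← Complex.exp_add, tilted]
      push_cast
      ring_nf
    set P : Plane := !₂[p.1, p.2]
    set Q : Plane := !₂[q.1, q.2]
    have h1 : ‖Complex.exp (-Complex.I * (Φ P : ℂ)) - Complex.exp (-Complex.I * (Φ Q : ℂ))‖ ≤
        2 * C * dist p q ^ (1 / 2 : ℝ) := by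
      rw [exp_neg_I_sub]
      have h2 := Real.norm_exp_I_mul_ofReal_sub_one_le (x := Φ Q - Φ P)
      rw [Real.norm_eq_abs, abs_sub_comm] at h2
      refine h2.trans ((hΦ.holder P Q).trans ?_)
      have h3 : dist P Q ^ (1 / 2 : ℝ) ≤ 2 * dist p q ^ (1 / 2 : ℝ) := by
        refine (Real.rpow_le_rpow dist_nonneg (dist_toLp_le p q) (by norm_num)).trans ?_
        rw [Real.mul_rpow (by norm_num) dist_nonneg, ← Real.sqrt_eq_rpow 2]
        gcongr
        rw [Real.sqrt_le_iff]; norm_num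
      calc _ ≤ C * (2 * dist p q ^ (1 / 2 : ℝ)) := by gcongr
        _ = _ := by ring
    have h4 : ‖Complex.exp (-Complex.I * (tilt α T t P : ℂ)) -
        Complex.exp (-Complex.I * (tilt α T t Q : ℂ))‖ ≤
        2 * √(2 * |α|) * dist p q ^ (1 / 2 : ℝ) := by
      rw [exp_neg_I_sub]
      refine (norm_exp_sub_one_le_sqrt _).trans ?_
      rw [← Real.sqrt_eq_rpow, mul_assoc, ← Real.sqrt_mul (by positivity)]
      gcongr
      have d1 : |p.1 - q.1| ≤ dist p q := by
        rw [Prod.dist_eq, ← Real.dist_eq]; exact le_max_left _ _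
      have d2 : |p.2 - q.2| ≤ dist p q := by
        rw [Prod.dist_eq, ← Real.dist_eq]; exact le_max_right _ _
      have e2 : tilt α T t Q - tilt α T t P = -(α * ((p.1 - q.1) * Real.sin (2 * Real.pi * t / T) +
          (p.2 - q.2) * Real.cos (2 * Real.pi * t / T))) := by
        simp only [tilt, P, Q, Matrix.cons_val_zero, Matrix.cons_val_one]
        ring
      have e4 : |(p.1 - q.1) * Real.sin (2 * Real.pi * t / T) +
          (p.2 - q.2) * Real.cos (2 * Real.pi * t / T)| ≤ 2 * dist p q := by
        refine (abs_add_le _ _).trans ?_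
        rw [abs_mul, abs_mul]
        have s1 := Real.abs_sin_le_one (2 * Real.pi * t / T)
        have s2 := Real.abs_cos_le_one (2 * Real.pi * t / T)
        calc _ ≤ |p.1 - q.1| * 1 + |p.2 - q.2| * 1 := by gcongr
          _ ≤ _ := by linarith
      rw [e2, abs_neg, abs_mul]
      calc _ ≤ |α| * (2 * dist p q) := by gcongr
        _ = _ := by ring
    rw [e, e]
    have e3 : ∀ a b c d : ℂ, a * b - c * d = (a - c) * b + c * (b - d) := fun a b c d => by ring
    rw [e3]
    refine (norm_add_le _ _).trans ?_
    rw [norm_mul, norm_mul, norm_exp_neg_I_mul, norm_exp_neg_I_mul, mul_one, one_mul]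
    have : 0 ≤ dist p q ^ (1 / 2 : ℝ) := by positivity
    nlinarith

theorem bddHolder_aperture {C B : ℝ} {Φ N : Plane → ℝ} (hΦ : HolderWave C Φ) (hN : HolderMask B N)
    (α T t : ℝ) :
    BddHolder (1 / 2) (2 * B * (1 + 2 * C + 2 * √(2 * |α|))) fun p : ℝ × ℝ =>
      aperture N (tilted α T Φ t) !₂[p.1, p.2] :=
  hN.bddHolder.ofReal.mul (bddHolder_wave hΦ α T t)

/-! ### The numerators of the pyramid operators -/

/-- The interference term `Im (conj g(b) · f(a))` of two amplitudes at two points. -/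
def pairing (f g : Plane → ℂ) (p : (ℝ × ℝ) × (ℝ × ℝ)) : ℝ :=
  (starRingEnd ℂ (g !₂[p.2.1, p.2.2]) * f !₂[p.1.1, p.1.2]).im

/-- The numerator common to all integrands of the pyramid operators, with the weights `N₁`, `N₂` at
the two points. -/
def meanKernel (α T : ℝ) (Φ N₁ N₂ : Plane → ℝ) (p : (ℝ × ℝ) × (ℝ × ℝ)) : ℝ :=
  N₁ !₂[p.1.1, p.1.2] * N₂ !₂[p.2.1, p.2.2] *
    (Real.sin (Φ !₂[p.1.1, p.1.2] - Φ !₂[p.2.1, p.2.2]) *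
      lKer α T .circular (p.1.1 - p.2.1) (p.1.2 - p.2.2))

theorem bddHolder_pairing {β A B : ℝ} (hβ : 0 < β) {f g : Plane → ℂ}
    (hf : BddHolder β A fun p : ℝ × ℝ => f !₂[p.1, p.2])
    (hg : BddHolder β B fun p : ℝ × ℝ => g !₂[p.1, p.2]) :
    BddHolder β (2 * B * A) (pairing f g) := by
  have h1 := hf.comp hβ (φ := Prod.fst (α := ℝ × ℝ) (β := ℝ × ℝ)) fun p q => by
    rw [Prod.dist_eq (x := p)]; exact le_max_left _ _
  have h2 := hg.comp hβ (φ := Prod.snd (α := ℝ × ℝ) (β := ℝ × ℝ)) fun p q => by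
    rw [Prod.dist_eq (x := p)]; exact le_max_right _ _
  exact (h2.conj.mul h1).im

theorem pairing_aperture (Φ N₁ N₂ : Plane → ℝ) (p : (ℝ × ℝ) × (ℝ × ℝ)) :
    pairing (aperture N₁ Φ) (aperture N₂ Φ) p = -(N₁ !₂[p.1.1, p.1.2] * N₂ !₂[p.2.1, p.2.2] *
      Real.sin (Φ !₂[p.1.1, p.1.2] - Φ !₂[p.2.1, p.2.2])) := by
  unfold pairing aperture
  have e : ∀ s : ℝ, Complex.exp (-Complex.I * s) = ⟨Real.cos s, -Real.sin s⟩ := fun s => by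
    have : -Complex.I * s = ((-s : ℝ) : ℂ) * Complex.I := by push_cast; ring
    rw [this]
    apply Complex.ext
    · rw [Complex.exp_ofReal_mul_I_re, Real.cos_neg]
    · rw [Complex.exp_ofReal_mul_I_im, Real.sin_neg]
  rw [e, e, Real.sin_sub]
  simp
  ring

theorem continuous_toLp_pair : Continuous fun p : ℝ × ℝ => (!₂[p.1, p.2] : Plane) := by
  refine (PiLp.continuous_toLp 2 _).comp (continuous_pi fun i => ?_)
  fin_cases i
  · exact continuous_fst
  · exact continuous_snd

theorem continuous_tilted {Φ : Plane → ℝ} (hΦ : Continuous Φ) (α T : ℝ) :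
    Continuous fun q : ℝ × Plane => tilted α T Φ q.1 q.2 := by
  unfold tilted tilt
  fun_prop

theorem continuous_aperture {Φ N : Plane → ℝ} (hΦ : Continuous Φ) (hN : Continuous N) (α T : ℝ) :
    Continuous fun q : ℝ × Plane => aperture N (tilted α T Φ q.1) q.2 := by
  have := continuous_tilted hΦ α T
  unfold aperture
  fun_prop

theorem continuous_pairing {Φ N₁ N₂ : Plane → ℝ} (hΦ : Continuous Φ) (h₁ : Continuous N₁)
    (h₂ : Continuous N₂) (α T : ℝ) :
    Continuous fun q : ℝ × ((ℝ × ℝ) × (ℝ × ℝ)) =>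
      pairing (aperture N₁ (tilted α T Φ q.1)) (aperture N₂ (tilted α T Φ q.1)) q.2 := by
  have c1 := (continuous_aperture hΦ h₁ α T).comp (f := fun q : ℝ × ((ℝ × ℝ) × (ℝ × ℝ)) =>
    (q.1, (!₂[q.2.1.1, q.2.1.2] : Plane)))
    (continuous_fst.prodMk (continuous_toLp_pair.comp (by fun_prop : Continuous
      fun q : ℝ × ((ℝ × ℝ) × (ℝ × ℝ)) => q.2.1)))
  have c2 := (continuous_aperture hΦ h₂ α T).comp (f := fun q : ℝ × ((ℝ × ℝ) × (ℝ × ℝ)) =>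
    (q.1, (!₂[q.2.2.1, q.2.2.2] : Plane)))
    (continuous_fst.prodMk (continuous_toLp_pair.comp (by fun_prop : Continuous
      fun q : ℝ × ((ℝ × ℝ) × (ℝ × ℝ)) => q.2.2)))
  exact Complex.continuous_im.comp ((Complex.continuous_conj.comp c2).mul c1)

/-- The numerator of the pyramid operators is, up to sign, the time average of interference terms. -/
theorem integral_pairing {T : ℝ} (hT : 0 < T) (α : ℝ) (Φ N₁ N₂ : Plane → ℝ)
    (p : (ℝ × ℝ) × (ℝ × ℝ)) :
    ∫ t, pairing (aperture N₁ (tilted α T Φ t)) (aperture N₂ (tilted α T Φ t)) p ∂(period T) =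
      -meanKernel α T Φ N₁ N₂ p := by
  simp only [pairing_aperture]
  rw [integral_neg, integral_const_mul, meanKernel, ← integral_sin_add hT]
  congr 3
  ext t
  congr 1
  simp only [tilted, tilt, Matrix.cons_val_zero, Matrix.cons_val_one]
  ring

/-- The Hölder constant of interference terms. -/
def pairConst (C B₁ B₂ α : ℝ) : ℝ :=
  2 * (2 * B₂ * (1 + 2 * C + 2 * √(2 * |α|))) * (2 * B₁ * (1 + 2 * C + 2 * √(2 * |α|)))

section Kernel

variable {C B₁ B₂ T : ℝ} {Φ N₁ N₂ : Plane → ℝ}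

theorem bddHolder_pairing_aperture (hΦ : HolderWave C Φ) (h₁ : HolderMask B₁ N₁)
    (h₂ : HolderMask B₂ N₂) (α T t : ℝ) :
    BddHolder (1 / 2) (pairConst C B₁ B₂ α)
      (pairing (aperture N₁ (tilted α T Φ t)) (aperture N₂ (tilted α T Φ t))) :=
  bddHolder_pairing (by norm_num) (bddHolder_aperture hΦ h₁ α T t) (bddHolder_aperture hΦ h₂ α T t)

theorem bddHolder_meanKernel (hT : 0 < T) (hΦ : HolderWave C Φ) (h₁ : HolderMask B₁ N₁)
    (h₂ : HolderMask B₂ N₂) (α : ℝ) :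
    BddHolder (1 / 2) (pairConst C B₁ B₂ α) (meanKernel α T Φ N₁ N₂) := by
  have hk := fun t => bddHolder_pairing_aperture hΦ h₁ h₂ α T t
  have hc := continuous_pairing hΦ.continuous h₁.continuous h₂.continuous α T
  have hi : ∀ p, Integrable (fun t => pairing (aperture N₁ (tilted α T Φ t))
      (aperture N₂ (tilted α T Φ t)) p) (period T) := fun p =>
    Integrable.of_bound (hc.comp (by fun_prop : Continuous fun t : ℝ => (t, p))).aestronglyMeasurable
      _ (Eventually.of_forall fun t => (hk t).norm_le p)
  have e : ∀ p, meanKernel α T Φ N₁ N₂ p = -∫ t, pairing (aperture N₁ (tilted α T Φ t))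
      (aperture N₂ (tilted α T Φ t)) p ∂(period T) := fun p => by rw [integral_pairing hT, neg_neg]
  constructor
  · intro p
    rw [e, norm_neg]
    refine (norm_integral_le_of_norm_le (integrable_const (pairConst C B₁ B₂ α))
      (Eventually.of_forall fun t => (hk t).norm_le p)).trans_eq (integral_period_const hT _)
  · intro p q
    rw [e, e, neg_sub_neg, norm_sub_rev, ← integral_sub (hi p) (hi q)]
    exact (norm_integral_le_of_norm_le (integrable_const (pairConst C B₁ B₂ α * dist p q ^ (1 / 2 : ℝ)))
      (Eventually.of_forall fun t => (hk t).holder p q)).trans_eq (integral_period_const hT _)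

theorem dist_tripleX_le (x : ℝ) (p q : (ℝ × ℝ) × ℝ) :
    dist (p.1, (x, p.2)) (q.1, (x, q.2)) ≤ dist p q := by
  simp [Prod.dist_eq]

theorem dist_tripleY_le (y : ℝ) (p q : (ℝ × ℝ) × ℝ) :
    dist (p.1, (p.2, y)) (q.1, (q.2, y)) ≤ dist p q := by
  simp [Prod.dist_eq]

theorem dist_singleX_le (x y u u' : ℝ) : dist ((u, y), (x, y)) ((u', y), (x, y)) ≤ dist u u' := by
  simp [Prod.dist_eq]

theorem dist_singleY_le (x y v v' : ℝ) : dist ((x, v), (x, y)) ((x, v'), (x, y)) ≤ dist v v' := by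
  simp [Prod.dist_eq]

/-- The one-dimensional term of the `x`-operator, for a mask and a cutoff in the variable of
integration. The kernel `k^c` is the restriction of `l^c` to an axis. -/
theorem pv_singleX (hT : 0 < T) (hΦ : HolderWave C Φ) (h₁ : HolderMask B₁ N₁) (α : ℝ)
    {r R x : ℝ} (hr : 0 < r) (y : ℝ) {c : ℝ → ℝ} (hc : IsCutoff r R x c) :
    PVExists Set.univ x
        (fun u => c u * (N₁ !₂[u, y] * singleX (kKer α .circular) Φ x y u)) ∧
      pv Set.univ x (fun u => c u * (N₁ !₂[u, y] * singleX (kKer α .circular) Φ x y u)) =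
        hilb (fun u => c u • meanKernel α T Φ N₁ (fun _ => 1) ((u, y), (x, y))) x := by
  have hA := HolderAt.cutoff_smul (by norm_num) hr hc
    ((bddHolder_meanKernel hT hΦ h₁ holderMask_one α).comp (by norm_num)
      (φ := fun u : ℝ => ((u, y), (x, y))) (dist_singleX_le x y))
  have e : (fun u => c u * (N₁ !₂[u, y] * singleX (kKer α .circular) Φ x y u)) = fun u =>
      (c u • meanKernel α T Φ N₁ (fun _ => 1) ((u, y), (x, y))) / (u - x) := by
    ext u
    simp only [singleX, meanKernel, smul_eq_mul, sub_self, lKer_zero_right hT]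
    ring
  rw [e]
  exact ⟨pvExists_of_holderAt (by norm_num) hA, pv_eq_hilb (by norm_num) hA⟩

theorem pv_singleY (hT : 0 < T) (hΦ : HolderWave C Φ) (h₁ : HolderMask B₁ N₁) (α : ℝ)
    {r R y : ℝ} (hr : 0 < r) (x : ℝ) {c : ℝ → ℝ} (hc : IsCutoff r R y c) :
    PVExists Set.univ y
        (fun v => c v * (N₁ !₂[x, v] * singleY (kKer α .circular) Φ x y v)) ∧
      pv Set.univ y (fun v => c v * (N₁ !₂[x, v] * singleY (kKer α .circular) Φ x y v)) =
        hilb (fun v => c v • meanKernel α T Φ N₁ (fun _ => 1) ((x, v), (x, y))) y := by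
  have hA := HolderAt.cutoff_smul (by norm_num) hr hc
    ((bddHolder_meanKernel hT hΦ h₁ holderMask_one α).comp (by norm_num)
      (φ := fun v : ℝ => ((x, v), (x, y))) (dist_singleY_le x y))
  have e : (fun v => c v * (N₁ !₂[x, v] * singleY (kKer α .circular) Φ x y v)) = fun v =>
      (c v • meanKernel α T Φ N₁ (fun _ => 1) ((x, v), (x, y))) / (v - y) := by
    ext v
    simp only [singleY, meanKernel, smul_eq_mul, sub_self, lKer_zero_left hT]
    ring
  rw [e]
  exact ⟨pvExists_of_holderAt (by norm_num) hA, pv_eq_hilb (by norm_num) hA⟩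

theorem pv3_tripleX (hT : 0 < T) (hΦ : HolderWave C Φ) (h₁ : HolderMask B₁ N₁)
    (h₂ : HolderMask B₂ N₂) (α : ℝ) {r R x y : ℝ} (hr : 0 < r) {a b c : ℝ → ℝ}
    (hc : IsCutoff3 r R x y y a b c) :
    PV3Exists Set.univ Set.univ Set.univ x y y (fun u v w => a u * b v * c w *
        (N₁ !₂[u, v] * N₂ !₂[x, w] * tripleX (lKer α T .circular) Φ x y u v w)) ∧
      pv3 Set.univ Set.univ Set.univ x y y (fun u v w => a u * b v * c w *
        (N₁ !₂[u, v] * N₂ !₂[x, w] * tripleX (lKer α T .circular) Φ x y u v w)) =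
        hilb3 a b c x y y fun p => meanKernel α T Φ N₁ N₂ (p.1, (x, p.2)) := by
  have h := pv3_eq_hilb3 (by norm_num) hr hc
    ((bddHolder_meanKernel hT hΦ h₁ h₂ α).comp (by norm_num)
      (φ := fun p : (ℝ × ℝ) × ℝ => (p.1, (x, p.2))) (dist_tripleX_le x))
  have e : (fun u v w => a u * b v * c w *
        (N₁ !₂[u, v] * N₂ !₂[x, w] * tripleX (lKer α T .circular) Φ x y u v w)) =
      fun u v w => a u * b v * c w * (meanKernel α T Φ N₁ N₂ ∘
        fun p : (ℝ × ℝ) × ℝ => (p.1, (x, p.2))) ((u, v), w) / ((u - x) * (v - y) * (w - y)) := by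
    ext u v w
    simp only [tripleX, meanKernel, Function.comp]
    rw [← neg_sub v w, lKer_neg_right]
    ring
  rw [e]
  exact h

theorem pv3_tripleY (hT : 0 < T) (hΦ : HolderWave C Φ) (h₁ : HolderMask B₁ N₁)
    (h₂ : HolderMask B₂ N₂) (α : ℝ) {r R x y : ℝ} (hr : 0 < r) {a b c : ℝ → ℝ}
    (hc : IsCutoff3 r R x y x a b c) :
    PV3Exists Set.univ Set.univ Set.univ x y x (fun u v w => a u * b v * c w *
        (N₁ !₂[u, v] * N₂ !₂[w, y] * tripleY (lKer α T .circular) Φ x y u v w)) ∧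
      pv3 Set.univ Set.univ Set.univ x y x (fun u v w => a u * b v * c w *
        (N₁ !₂[u, v] * N₂ !₂[w, y] * tripleY (lKer α T .circular) Φ x y u v w)) =
        hilb3 a b c x y x fun p => meanKernel α T Φ N₁ N₂ (p.1, (p.2, y)) := by
  have h := pv3_eq_hilb3 (by norm_num) hr hc
    ((bddHolder_meanKernel hT hΦ h₁ h₂ α).comp (by norm_num)
      (φ := fun p : (ℝ × ℝ) × ℝ => (p.1, (p.2, y))) (dist_tripleY_le y))
  have e : (fun u v w => a u * b v * c w *
        (N₁ !₂[u, v] * N₂ !₂[w, y] * tripleY (lKer α T .circular) Φ x y u v w)) =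
      fun u v w => a u * b v * c w * (meanKernel α T Φ N₁ N₂ ∘
        fun p : (ℝ × ℝ) × ℝ => (p.1, (p.2, y))) ((u, v), w) / ((u - x) * (v - y) * (w - x)) := by
    ext u v w
    simp only [tripleY, meanKernel, Function.comp]
    rw [← neg_sub u w, lKer_neg_left]
    ring
  rw [e]
  exact h

end Kernel

/-! ### Smooth masks -/

/-- Smooth masks are Lipschitz continuous and bounded; the interpolation of both bounds yields the
Hölder exponent `1/2`. -/
theorem exists_holderMask {M : Plane → ℝ} (hM : ContDiff ℝ ∞ M) (hMc : HasCompactSupport M) :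
    ∃ B, HolderMask B M := by
  obtain ⟨B, hB⟩ := hMc.exists_bound_of_continuous hM.continuous
  obtain ⟨K, hK⟩ := (hM.of_le (by exact_mod_cast le_top) :
    ContDiff ℝ 1 M).lipschitzWith_of_hasCompactSupport hMc (by norm_num)
  have hB0 : 0 ≤ B := (norm_nonneg _).trans (hB 0)
  refine ⟨B + 2 * √(B * K), hM.continuous, ⟨fun p => (hB _).trans (by
    linarith [Real.sqrt_nonneg (B * K)]), fun p q => ?_⟩⟩
  set P : Plane := !₂[p.1, p.2]
  set Q : Plane := !₂[q.1, q.2]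
  have h1 : ‖M P - M Q‖ ≤ 2 * B := (norm_sub_le _ _).trans (by linarith [hB P, hB Q])
  have h2 : ‖M P - M Q‖ ≤ 2 * K * dist p q := by
    rw [← dist_eq_norm]
    refine (hK.dist_le_mul P Q).trans ?_
    have := mul_le_mul_of_nonneg_left (dist_toLp_le p q) K.coe_nonneg
    linarith
  have h3 : ‖M P - M Q‖ ≤ 2 * √(B * K) * √(dist p q) := by
    rw [mul_assoc, ← Real.sqrt_mul (by positivity)]
    have h4 : ‖M P - M Q‖ ^ 2 ≤ 2 ^ 2 * (B * K * dist p q) := by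
      rw [sq]
      calc _ ≤ 2 * B * (2 * K * dist p q) := by gcongr
        _ = _ := by ring
    have h5 := Real.sqrt_le_sqrt h4
    rwa [Real.sqrt_sq (norm_nonneg _), Real.sqrt_mul (by norm_num), Real.sqrt_sq (by norm_num)]
      at h5
  rw [← Real.sqrt_eq_rpow]
  refine h3.trans ?_
  gcongr
  linarith

theorem exists_supp_bound {M : Plane → ℝ} (hMc : HasCompactSupport M) :
    ∃ L, (∀ u v, L < |u| → M !₂[u, v] = 0) ∧ (∀ u v, L < |v| → M !₂[u, v] = 0) := by
  obtain ⟨L, hL⟩ := hMc.isCompact.isBounded.subset_closedBall 0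
  have key : ∀ z : Plane, L < ‖z‖ → M z = 0 := fun z hz => by
    refine image_eq_zero_of_notMem_tsupport fun h => ?_
    have := hL h
    rw [mem_closedBall_zero_iff] at this
    linarith
  refine ⟨L, fun u v h => key _ (h.trans_le ?_), fun u v h => key _ (h.trans_le ?_)⟩
  · simpa using PiLp.norm_apply_le (p := 2) (!₂[u, v] : Plane) 0
  · simpa using PiLp.norm_apply_le (p := 2) (!₂[u, v] : Plane) 1

theorem contDiff_tilt_exp (α T t : ℝ) :
    ContDiff ℝ ∞ fun z : Plane => Complex.exp (-Complex.I * (tilt α T t z : ℂ)) := by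
  have h : ContDiff ℝ ∞ fun z : Plane => tilt α T t z := by
    unfold tilt
    have h0 : ContDiff ℝ ∞ fun z : Plane => z 0 := contDiff_piLp_apply 2
    have h1 : ContDiff ℝ ∞ fun z : Plane => z 1 := contDiff_piLp_apply 2
    exact contDiff_const.mul ((h0.mul contDiff_const).add (h1.mul contDiff_const))
  exact ((contDiff_const.mul (Complex.ofRealCLM.contDiff.comp h))).cexp

/-- The amplitudes of all tilted wavefronts in a smooth pupil satisfy the hypotheses for the
pointwise theory, uniformly in the tilt. -/
theorem amplitude_aperture {C B L : ℝ} {Φ M : Plane → ℝ} {G : Plane → ℂ} (hΦ : HolderWave C Φ)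
    (hG : Integrable G) (hGΦ : ∀ z, 𝓕⁻ G z = (Φ z : ℂ)) (hM : ContDiff ℝ ∞ M)
    (hMc : HasCompactSupport M) (hMB : HolderMask B M)
    (hL : (∀ u v, L < |u| → M !₂[u, v] = 0) ∧ (∀ u v, L < |v| → M !₂[u, v] = 0)) (α T t : ℝ) :
    Amplitude (1 / 2) (2 * B * (1 + 2 * C + 2 * √(2 * |α|))) L (aperture M (tilted α T Φ t)) := by
  have hcont : Continuous (aperture M (tilted α T Φ t)) :=
    (continuous_aperture hΦ.continuous hM.continuous α T).comp
      (by fun_prop : Continuous fun z : Plane => (t, z))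
  have hcs : HasCompactSupport (aperture M (tilted α T Φ t)) := by
    refine hMc.mono fun z hz => ?_
    intro h0
    exact hz (by simp [aperture, h0])
  have hint := hcont.integrable_of_hasCompactSupport hcs (μ := volume)
  refine ⟨by norm_num, bddHolder_aperture hΦ hMB α T t, fun u v h => ?_, fun u v h => ?_, hcont,
    hint, ?_⟩
  · simp [aperture, hL.1 u v h]
  · simp [aperture, hL.2 u v h]
  · have hMs : ContDiff ℝ ∞ fun z => (M z : ℂ) * Complex.exp (-Complex.I * (tilt α T t z : ℂ)) :=
      (Complex.ofRealCLM.contDiff.comp hM).mul (contDiff_tilt_exp α T t)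
    have hMsc : HasCompactSupport
        fun z => (M z : ℂ) * Complex.exp (-Complex.I * (tilt α T t z : ℂ)) := by
      refine hMc.mono fun z hz h0 => hz ?_
      simp [h0]
    set S : 𝓢(Plane, ℂ) := hMsc.toSchwartzMap hMs
    have hS : ∀ z, S z = (M z : ℂ) * Complex.exp (-Complex.I * (tilt α T t z : ℂ)) := fun z => rfl
    have e : aperture M (tilted α T Φ t) = fun z => S z * Complex.exp (-Complex.I * (Φ z : ℂ)) := by
      ext z
      rw [hS, aperture, tilted, mul_assoc, ← Complex.exp_add]
      push_cast
      ring_nf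
    rw [e] at hint ⊢
    refine integrable_fourier_mul_exp (𝓕 S).integrable hG (fun z => ?_) hGΦ hint
    rw [← SchwartzMap.fourierInv_coe, FourierTransform.fourierInv_fourier_eq]

section Pointwise

variable {β C L : ℝ} {ψ : Plane → ℂ}

/-- Multiplication by a complex number followed by the imaginary part, as a real-linear map. -/
def imMul (w : ℂ) : ℂ →L[ℝ] ℝ := Complex.imCLM.comp (ContinuousLinearMap.mul ℝ ℂ w)

theorem imMul_apply (w z : ℂ) : imMul w z = (w * z).im := rfl

theorem hilb_im_mul {R a : ℝ} {g : ℝ → ℂ} (hβ : 0 < β) (hg : HolderAt β C R a g) (w : ℂ) :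
    hilb (fun s => (w * g s).im) a = (w * hilb g a).im := by
  simpa only [imMul_apply] using hilb_clm_comp hβ hg (imMul w)

theorem hilb_im_conj_mul {R a : ℝ} {g : ℝ → ℂ} (hβ : 0 < β) (hg : HolderAt β C R a g) (w : ℂ) :
    hilb (fun s => (starRingEnd ℂ (g s) * w).im) a = (starRingEnd ℂ (hilb g a) * w).im := by
  have h := hilb_clm_comp hβ hg ((imMul w).comp (Complex.conjCLE : ℂ →L[ℝ] ℂ))
  simpa [imMul_apply, mul_comm w] using h

theorem hilb_neg (g : ℝ → ℝ) (a : ℝ) : hilb (fun s => -g s) a = -hilb g a := by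
  simpa using hilb_const_mul (-1) g a

/-- The iterated Hilbert transform of an interference term factors. -/
theorem hilb3_pairing (h : Amplitude β C L ψ) {x y z : ℝ} (hx : |x| + 1 ≤ L) (hy : |y| + 1 ≤ L)
    {K R : ℝ} {q : ℝ → ℂ} (hq : HolderAt β K R z q) (hqs : ∀ w, L < |w| → q w = 0) :
    hilb3 (boxCut L) (boxCut L) (boxCut L) x y z
        (fun p => (starRingEnd ℂ (q p.2) * ψ !₂[p.1.1, p.1.2]).im) =
      (starRingEnd ℂ (hilb q z) * hilb (fun u => hilb (fun v => ψ !₂[u, v]) y) x).im := by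
  unfold hilb3
  have e1 : ∀ u v w, boxCut L w • (starRingEnd ℂ (q w) * ψ !₂[u, v]).im =
      (starRingEnd ℂ (q w) * ψ !₂[u, v]).im := fun u v w =>
    boxCut_smul_of_supp fun hw => by simp [hqs w hw]
  have e2 : ∀ (w : ℂ) u v, boxCut L v • (w * ψ !₂[u, v]).im = (w * ψ !₂[u, v]).im := fun w u v =>
    boxCut_smul_of_supp fun hv => by simp [h.supp_snd u v hv]
  have e3 : ∀ (w : ℂ) u, boxCut L u • (w * hilb (fun v => ψ !₂[u, v]) y).im =
      (w * hilb (fun v => ψ !₂[u, v]) y).im := fun w u =>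
    boxCut_smul_of_supp fun hu => by rw [h.hilb_eq_zero u y hu]; simp
  simp only [e1, hilb_im_conj_mul h.exponent_pos hq, e2,
    fun u w => hilb_im_mul h.exponent_pos (h.holderAt_snd hy u) w, e3,
    hilb_im_mul (half_pos h.exponent_pos) (h.holderAt_hilb hx hy)]

theorem hilb_pairing_fst (h : Amplitude β C L ψ) {x : ℝ} (hx : |x| + 1 ≤ L) (y : ℝ) :
    hilb (fun u => boxCut L u • pairing ψ ψ ((u, y), (x, y))) x =
      (starRingEnd ℂ (ψ !₂[x, y]) * hilb (fun u => ψ !₂[u, y]) x).im := by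
  rw [← hilb_im_mul h.exponent_pos (h.holderAt_fst hx y)]
  congr 1
  ext u
  exact boxCut_smul_of_supp fun hu => by simp [pairing, h.supp_fst u y hu]

theorem hilb_pairing_snd (h : Amplitude β C L ψ) {y : ℝ} (hy : |y| + 1 ≤ L) (x : ℝ) :
    hilb (fun v => boxCut L v • pairing ψ ψ ((x, v), (x, y))) y =
      (starRingEnd ℂ (ψ !₂[x, y]) * hilb (fun v => ψ !₂[x, v]) y).im := by
  rw [← hilb_im_mul h.exponent_pos (h.holderAt_snd hy x)]
  congr 1
  ext v
  exact boxCut_smul_of_supp fun hv => by simp [pairing, h.supp_snd x v hv]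

end Pointwise

theorem isCutoff3_boxCut {L x y z : ℝ} (hx : |x| + 1 ≤ L) (hy : |y| + 1 ≤ L) (hz : |z| + 1 ≤ L) :
    IsCutoff3 1 (2 * L + 1) x y z (boxCut L) (boxCut L) (boxCut L) :=
  ⟨isCutoff_boxCut hx, isCutoff_boxCut hy, isCutoff_boxCut hz⟩

theorem boxCut_mul_of_supp {L w f : ℝ} (h : L < |w| → f = 0) : boxCut L w * f = f :=
  boxCut_smul_of_supp h

/-! ### Data and pyramid operators of smooth masks -/

section Average

variable {C B L T I₀ : ℝ} {Φ M : Plane → ℝ}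

/-- Time averages of the two terms of the data in `x`-direction. -/
theorem average_X (hT : 0 < T) (hΦ : HolderWave C Φ) (hMB : HolderMask B M) (α : ℝ) {x y : ℝ}
    (hx : |x| + 1 ≤ L) (hy : |y| + 1 ≤ L)
    (hA : ∀ t, Amplitude (1 / 2) (2 * B * (1 + 2 * C + 2 * √(2 * |α|))) L
      (aperture M (tilted α T Φ t))) (hI₀ : I₀ ≠ 0) :
    Integrable (fun t => I₀ * combX I₀ (intensity (aperture M (tilted α T Φ t)) !₂[x, y]))
        (period T) ∧
      ∫ t, I₀ * combX I₀ (intensity (aperture M (tilted α T Φ t)) !₂[x, y]) ∂(period T) =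
        -(1 / 2) * ((1 / Real.pi) *
          hilb (fun u => boxCut L u • meanKernel α T Φ M M ((u, y), (x, y))) x +
          (1 / Real.pi ^ 3) * hilb3 (boxCut L) (boxCut L) (boxCut L) x y y
            fun p => meanKernel α T Φ M M (p.1, (x, p.2))) := by
  have hk := fun t => bddHolder_pairing_aperture hΦ hMB hMB α T t
  have hc := continuous_pairing hΦ.continuous hMB.continuous hMB.continuous α T
  obtain ⟨i1, a1⟩ := hilb_cutoff_integral (ν := period T) (β := 1 / 2) (by norm_num) one_pos
    (isCutoff_boxCut hx)
    (G := fun t u => pairing (aperture M (tilted α T Φ t)) (aperture M (tilted α T Φ t))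
      ((u, y), (x, y)))
    (hc.comp (by fun_prop : Continuous fun q : ℝ × ℝ => (q.1, ((q.2, y), (x, y))))).stronglyMeasurable
    (fun t => (hk t).comp (by norm_num) (dist_singleX_le x y))
  obtain ⟨i3, a3⟩ := hilb3_integral (ν := period T) (β := 1 / 2) (by norm_num) one_pos
    (isCutoff3_boxCut hx hy hy)
    (G := fun t p => pairing (aperture M (tilted α T Φ t)) (aperture M (tilted α T Φ t))
      (p.1, (x, p.2)))
    (hc.comp (by fun_prop : Continuous fun q : ℝ × ((ℝ × ℝ) × ℝ) =>
      (q.1, (q.2.1, (x, q.2.2))))).stronglyMeasurable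
    (fun t => (hk t).comp (by norm_num) (dist_tripleX_le x))
  simp only [integral_pairing hT, smul_neg, hilb3, hilb_neg] at a1 a3
  have e : ∀ t, I₀ * combX I₀ (intensity (aperture M (tilted α T Φ t)) !₂[x, y]) =
      1 / 2 * (1 / Real.pi * hilb (fun u => boxCut L u • pairing (aperture M (tilted α T Φ t))
        (aperture M (tilted α T Φ t)) ((u, y), (x, y))) x + 1 / Real.pi ^ 3 *
      hilb3 (boxCut L) (boxCut L) (boxCut L) x y y fun p => pairing (aperture M (tilted α T Φ t))
        (aperture M (tilted α T Φ t)) (p.1, (x, p.2))) := fun t => by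
    rw [(hA t).mul_combX_intensity hI₀ hx hy, hilb_pairing_fst (hA t) hx y,
      ← hilb3_pairing (hA t) hx hy ((hA t).holderAt_snd hy x) ((hA t).supp_snd x)]
    rfl
  simp only [e]
  refine ⟨((i1.const_mul _).add (i3.const_mul _)).const_mul _, ?_⟩
  rw [integral_const_mul, integral_add (i1.const_mul _) (i3.const_mul _), integral_const_mul,
    integral_const_mul, ← a1]
  unfold hilb3
  rw [← a3]
  ring

/-- Time averages of the two terms of the data in `y`-direction. -/
theorem average_Y (hT : 0 < T) (hΦ : HolderWave C Φ) (hMB : HolderMask B M) (α : ℝ) {x y : ℝ}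
    (hx : |x| + 1 ≤ L) (hy : |y| + 1 ≤ L)
    (hA : ∀ t, Amplitude (1 / 2) (2 * B * (1 + 2 * C + 2 * √(2 * |α|))) L
      (aperture M (tilted α T Φ t))) (hI₀ : I₀ ≠ 0) :
    Integrable (fun t => I₀ * combY I₀ (intensity (aperture M (tilted α T Φ t)) !₂[x, y]))
        (period T) ∧
      ∫ t, I₀ * combY I₀ (intensity (aperture M (tilted α T Φ t)) !₂[x, y]) ∂(period T) =
        (1 / 2) * ((1 / Real.pi) *
          hilb (fun v => boxCut L v • meanKernel α T Φ M M ((x, v), (x, y))) y +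
          (1 / Real.pi ^ 3) * hilb3 (boxCut L) (boxCut L) (boxCut L) x y x
            fun p => meanKernel α T Φ M M (p.1, (p.2, y))) := by
  have hk := fun t => bddHolder_pairing_aperture hΦ hMB hMB α T t
  have hc := continuous_pairing hΦ.continuous hMB.continuous hMB.continuous α T
  obtain ⟨i1, a1⟩ := hilb_cutoff_integral (ν := period T) (β := 1 / 2) (by norm_num) one_pos
    (isCutoff_boxCut hy)
    (G := fun t v => pairing (aperture M (tilted α T Φ t)) (aperture M (tilted α T Φ t))
      ((x, v), (x, y)))
    (hc.comp (by fun_prop : Continuous fun q : ℝ × ℝ => (q.1, ((x, q.2), (x, y))))).stronglyMeasurable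
    (fun t => (hk t).comp (by norm_num) (dist_singleY_le x y))
  obtain ⟨i3, a3⟩ := hilb3_integral (ν := period T) (β := 1 / 2) (by norm_num) one_pos
    (isCutoff3_boxCut hx hy hx)
    (G := fun t p => pairing (aperture M (tilted α T Φ t)) (aperture M (tilted α T Φ t))
      (p.1, (p.2, y)))
    (hc.comp (by fun_prop : Continuous fun q : ℝ × ((ℝ × ℝ) × ℝ) =>
      (q.1, (q.2.1, (q.2.2, y))))).stronglyMeasurable
    (fun t => (hk t).comp (by norm_num) (dist_tripleY_le y))
  simp only [integral_pairing hT, smul_neg, hilb3, hilb_neg] at a1 a3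
  have e : ∀ t, I₀ * combY I₀ (intensity (aperture M (tilted α T Φ t)) !₂[x, y]) =
      -(1 / 2) * (1 / Real.pi * hilb (fun v => boxCut L v • pairing (aperture M (tilted α T Φ t))
        (aperture M (tilted α T Φ t)) ((x, v), (x, y))) y + 1 / Real.pi ^ 3 *
      hilb3 (boxCut L) (boxCut L) (boxCut L) x y x fun p => pairing (aperture M (tilted α T Φ t))
        (aperture M (tilted α T Φ t)) (p.1, (p.2, y))) := fun t => by
    rw [(hA t).mul_combY_intensity hI₀ hx hy, hilb_pairing_snd (hA t) hy x,
      ← hilb3_pairing (hA t) hx hy ((hA t).holderAt_fst hx y) (fun w => (hA t).supp_fst w y)]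
    rfl
  simp only [e]
  refine ⟨((i1.const_mul _).add (i3.const_mul _)).const_mul _, ?_⟩
  rw [integral_const_mul, integral_add (i1.const_mul _) (i3.const_mul _), integral_const_mul,
    integral_const_mul, ← a1]
  unfold hilb3
  rw [← a3]
  ring

end Average

/-- The theorem for smooth masks and circular modulation with an arbitrary modulation parameter; the
parameter zero yields the sensor without modulation. -/
theorem smooth_circular {C T I₀ : ℝ} {Φ M : Plane → ℝ} {G : Plane → ℂ} (hT : 0 < T) (hI₀ : I₀ ≠ 0)
    (hΦ : HolderWave C Φ) (hG : Integrable G) (hGΦ : ∀ z, 𝓕⁻ G z = (Φ z : ℂ))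
    (hM : ContDiff ℝ ∞ M) (hMc : HasCompactSupport M) (α : ℝ) :
    DataDefined I₀ α T M .circular Φ ∧ ∀ x y : ℝ,
      MaskPyrDefined M (kKer α .circular) (lKer α T .circular) Φ x y ∧
      I₀ * dataX I₀ α T M .circular Φ x y =
        -(1 / 2) * maskPyrX M (kKer α .circular) (lKer α T .circular) Φ x y ∧
      I₀ * dataY I₀ α T M .circular Φ x y =
        (1 / 2) * maskPyrY M (kKer α .circular) (lKer α T .circular) Φ x y := by
  obtain ⟨B, hMB⟩ := exists_holderMask hM hMc
  obtain ⟨L₀, hL₀⟩ := exists_supp_bound hMc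
  have hA := fun t => amplitude_aperture hΦ hG hGΦ hM hMc hMB hL₀ α T t
  have hA' : ∀ x y t, Amplitude (1 / 2) (2 * B * (1 + 2 * C + 2 * √(2 * |α|)))
      (|L₀| + |x| + |y| + 1) (aperture M (tilted α T Φ t)) := fun x y t => (hA t).mono (by
    linarith [le_abs_self L₀, abs_nonneg x, abs_nonneg y])
  have hx : ∀ x y : ℝ, |x| + 1 ≤ |L₀| + |x| + |y| + 1 := fun x y => by
    linarith [abs_nonneg L₀, abs_nonneg y]
  have hy : ∀ x y : ℝ, |y| + 1 ≤ |L₀| + |x| + |y| + 1 := fun x y => by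
    linarith [abs_nonneg L₀, abs_nonneg x]
  have cancel : ∀ a : ℝ, I₀⁻¹ * (I₀ * a) = a := fun a => inv_mul_cancel_left₀ hI₀ a
  refine ⟨⟨fun t m n => Amplitude.integrable_focal (hA t).integrable_fourier m n, fun x y =>
    ⟨?_, ?_⟩⟩, fun x y => ?_⟩
  · have := (average_X hT hΦ hMB α (hx x y) (hy x y) (hA' x y) hI₀).1.const_mul I₀⁻¹
    simp only [cancel] at this
    exact intervalIntegrable_of_period hT this
  · have := (average_Y hT hΦ hMB α (hx x y) (hy x y) (hA' x y) hI₀).1.const_mul I₀⁻¹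
    simp only [cancel] at this
    exact intervalIntegrable_of_period hT this
  · have aX := (average_X hT hΦ hMB α (hx x y) (hy x y) (hA' x y) hI₀).2
    have aY := (average_Y hT hΦ hMB α (hx x y) (hy x y) (hA' x y) hI₀).2
    have hx := hx x y
    have hy := hy x y
    have hLL : L₀ ≤ |L₀| + |x| + |y| + 1 := by
      linarith [le_abs_self L₀, abs_nonneg x, abs_nonneg y]
    set L := |L₀| + |x| + |y| + 1
    have s1 : ∀ u v, L < |u| → M !₂[u, v] = 0 := fun u v h => hL₀.1 u v (hLL.trans_lt h)
    have s2 : ∀ u v, L < |v| → M !₂[u, v] = 0 := fun u v h => hL₀.2 u v (hLL.trans_lt h)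
    have pX := pv_singleX hT hΦ hMB α one_pos y (isCutoff_boxCut hx)
    have pY := pv_singleY hT hΦ hMB α one_pos x (isCutoff_boxCut hy)
    have pX3 := pv3_tripleX hT hΦ hMB hMB α one_pos (isCutoff3_boxCut hx hy hy)
    have pY3 := pv3_tripleY hT hΦ hMB hMB α one_pos (isCutoff3_boxCut hx hy hx)
    -- the mask vanishes outside of the large box, so that its indicator function may be inserted
    have f1 : ∀ u, boxCut L u * (M !₂[u, y] * singleX (kKer α .circular) Φ x y u) =
        M !₂[u, y] * singleX (kKer α .circular) Φ x y u := fun u =>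
      boxCut_mul_of_supp fun h => by rw [s1 u y h, zero_mul]
    have f2 : ∀ v, boxCut L v * (M !₂[x, v] * singleY (kKer α .circular) Φ x y v) =
        M !₂[x, v] * singleY (kKer α .circular) Φ x y v := fun v =>
      boxCut_mul_of_supp fun h => by rw [s2 x v h, zero_mul]
    have f3 : ∀ u v w, boxCut L u * boxCut L v * boxCut L w *
        (M !₂[u, v] * M !₂[x, w] * tripleX (lKer α T .circular) Φ x y u v w) =
        M !₂[u, v] * M !₂[x, w] * tripleX (lKer α T .circular) Φ x y u v w := fun u v w => by
      rw [mul_assoc, mul_assoc, boxCut_mul_of_supp, boxCut_mul_of_supp, boxCut_mul_of_supp]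
      · intro h; rw [s2 x w h]; ring
      · intro h; rw [s2 u v h]; ring
      · intro h; rw [s1 u v h]; ring
    have f4 : ∀ u v w, boxCut L u * boxCut L v * boxCut L w *
        (M !₂[u, v] * M !₂[w, y] * tripleY (lKer α T .circular) Φ x y u v w) =
        M !₂[u, v] * M !₂[w, y] * tripleY (lKer α T .circular) Φ x y u v w := fun u v w => by
      rw [mul_assoc, mul_assoc, boxCut_mul_of_supp, boxCut_mul_of_supp, boxCut_mul_of_supp]
      · intro h; rw [s1 w y h]; ring
      · intro h; rw [s2 u v h]; ring
      · intro h; rw [s1 u v h]; ring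
    simp only [f1] at pX
    simp only [f2] at pY
    simp only [f3] at pX3
    simp only [f4] at pY3
    have g1 : hilb (fun u => boxCut L u • meanKernel α T Φ M M ((u, y), (x, y))) x =
        M !₂[x, y] *
          hilb (fun u => boxCut L u • meanKernel α T Φ M (fun _ => 1) ((u, y), (x, y))) x := by
      rw [← hilb_const_mul]
      congr 1; ext u; simp only [meanKernel, smul_eq_mul]; ring
    have g2 : hilb (fun v => boxCut L v • meanKernel α T Φ M M ((x, v), (x, y))) y =
        M !₂[x, y] *
          hilb (fun v => boxCut L v • meanKernel α T Φ M (fun _ => 1) ((x, v), (x, y))) y := by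
      rw [← hilb_const_mul]
      congr 1; ext v; simp only [meanKernel, smul_eq_mul]; ring
    refine ⟨⟨pX.1, pX3.1, pY.1, pY3.1⟩, ?_, ?_⟩
    · rw [maskPyrX, pX.2, pX3.2, mul_assoc (1 / Real.pi), ← g1, ← aX, integral_const_mul,
        integral_period hT]
      rfl
    · rw [maskPyrY, pY.2, pY3.2, mul_assoc (1 / Real.pi), ← g2, ← aY, integral_const_mul,
        integral_period hT]
      rfl

/-! ### The pyramid operators for sharp pupils -/

theorem chi_mul {S : Set ℝ} (f : ℝ → ℝ) : S.indicator f = fun t => chi S t * f t := by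
  ext t
  unfold chi
  by_cases h : t ∈ S <;> simp [h]

theorem chi_of_mem {X : Type*} {S : Set X} {x : X} (h : x ∈ S) : chi S x = 1 :=
  Set.indicator_of_mem h _

theorem chi_of_notMem {X : Type*} {S : Set X} {x : X} (h : x ∉ S) : chi S x = 0 :=
  Set.indicator_of_notMem h _

theorem abs_chi_le {X : Type*} (S : Set X) (x : X) : |chi S x| ≤ 1 := by
  by_cases h : x ∈ S <;> simp [chi_of_mem, chi_of_notMem, h]

theorem chi_pupil (Ωy Ωx : Set ℝ) (z : Plane) :
    chi (pupil Ωy Ωx) z = chi Ωy (z 0) * chi Ωx (z 1) := by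
  by_cases h0 : z 0 ∈ Ωy <;> by_cases h1 : z 1 ∈ Ωx <;> simp [chi, pupil, h0, h1]

/-- Functions that agree with the indicator function of `[a, b]` away from the endpoints are cutoffs
at points off the endpoints, with radii that depend on the point only. -/
theorem isCutoff_of_eq {a b x r R ε : ℝ} {c : ℝ → ℝ} (hm : Measurable c) (hc : ∀ w, |c w| ≤ 1)
    (h0 : ∀ w, w ∉ Set.Icc a b → c w = 0) (h1 : ∀ w, a + ε ≤ w → w ≤ b - ε → c w = 1)
    (hr : 0 < r) (hε : ε ≤ r) (ha : 2 * r ≤ |x - a|) (hb : 2 * r ≤ |x - b|)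
    (hR : |x| + |a| + |b| < R) : IsCutoff r R x c where
  meas := hm
  abs_le := hc
  eq_of w hw := by
    rw [abs_le] at hw
    rcases lt_or_ge x a with h | h
    · rw [abs_of_neg (by linarith)] at ha
      rw [h0 w fun h => by linarith [h.1], h0 x fun h => by linarith [h.1]]
    rcases lt_or_ge b x with h' | h'
    · rw [abs_of_pos (by linarith)] at hb
      rw [h0 w fun h => by linarith [h.2], h0 x fun h => by linarith [h.2]]
    rw [abs_of_nonneg (by linarith)] at ha
    rw [abs_of_nonpos (by linarith)] at hb
    rw [h1 w (by linarith) (by linarith), h1 x (by linarith) (by linarith)]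
  supp w hw := by
    refine h0 w fun h => ?_
    have h2 : |w - x| ≤ |x| + |a| + |b| := by
      rw [abs_le]
      constructor <;>
      linarith [h.1, h.2, neg_abs_le a, le_abs_self b, neg_abs_le x, le_abs_self x, abs_nonneg a,
        abs_nonneg b]
    linarith

theorem isCutoff_chi {a b x r R : ℝ} (hr : 0 < r) (ha : 2 * r ≤ |x - a|) (hb : 2 * r ≤ |x - b|)
    (hR : |x| + |a| + |b| < R) : IsCutoff r R x (chi (Set.Icc a b)) :=
  isCutoff_of_eq (ε := 0) (measurable_const.indicator measurableSet_Icc) (abs_chi_le _)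
    (fun _ h => chi_of_notMem h)
    (fun _ h h' => chi_of_mem ⟨by linarith, by linarith⟩) hr hr.le ha hb hR

theorem IsCutoff.mono {r R R' y : ℝ} {c : ℝ → ℝ} (h : IsCutoff r R y c) (hR : R ≤ R') :
    IsCutoff r R' y c :=
  ⟨h.meas, h.abs_le, h.eq_of, fun w hw => h.supp w (hR.trans hw)⟩

theorem IsCutoff.mono_left {r r' R y : ℝ} {c : ℝ → ℝ} (h : IsCutoff r R y c) (hr : r' ≤ r) :
    IsCutoff r' R y c :=
  ⟨h.meas, h.abs_le, fun w hw => h.eq_of w (hw.trans hr), h.supp⟩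

theorem pv_eq_chi {S : Set ℝ} (hS : MeasurableSet S) (a : ℝ) (f : ℝ → ℝ) :
    pv S a f = pv Set.univ a fun t => chi S t * f t := by
  rw [pv_eq_univ hS, chi_mul]

theorem pvExists_iff_chi {S : Set ℝ} (hS : MeasurableSet S) (a : ℝ) (f : ℝ → ℝ) :
    PVExists S a f ↔ PVExists Set.univ a fun t => chi S t * f t := by
  rw [pvExists_iff_univ hS, chi_mul]

theorem pv3_const_mul {S₁ S₂ S₃ : Set ℝ} {x y z : ℝ} {F : ℝ → ℝ → ℝ → ℝ}
    (h : PV3Exists S₁ S₂ S₃ x y z F) (k : ℝ) :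
    PV3Exists S₁ S₂ S₃ x y z (fun u v w => k * F u v w) ∧
      pv3 S₁ S₂ S₃ x y z (fun u v w => k * F u v w) = k * pv3 S₁ S₂ S₃ x y z F := by
  unfold PV3Exists pv3
  have e3 : ∀ u v, _ := fun u v => pv_const_mul S₃ z k _ (h.1 u v)
  have e2 : ∀ u, _ := fun u => pv_const_mul S₂ y k _ (h.2.1 u)
  have e1 := pv_const_mul S₁ x k _ h.2.2
  simp only [(e3 _ _).2, (e2 _).2]
  exact ⟨⟨fun u v => (e3 u v).1, fun u => (e2 u).1, e1.1⟩, e1.2⟩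

/-- Reduction of iterated principal values over measurable sets to weighted ones over the line. The
inner principal values have to exist for all values of the outer variables, also outside the
domains of the outer integrals: hence the auxiliary large intervals. -/
theorem pv3_of_chi {S₁ S₂ S₃ : Set ℝ} (h₁ : MeasurableSet S₁) (h₂ : MeasurableSet S₂)
    (h₃ : MeasurableSet S₃) {x y z : ℝ} {F : ℝ → ℝ → ℝ → ℝ} {L₀ : ℝ}
    (H3 : ∀ L, L₀ ≤ L → PV3Exists Set.univ Set.univ Set.univ x y z fun u v w =>
      boxCut L u * boxCut L v * chi S₃ w * F u v w)
    (H2 : ∀ L, L₀ ≤ L → PV3Exists Set.univ Set.univ Set.univ x y z fun u v w =>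
      boxCut L u * chi S₂ v * chi S₃ w * F u v w)
    (H1 : PV3Exists Set.univ Set.univ Set.univ x y z fun u v w =>
      chi S₁ u * chi S₂ v * chi S₃ w * F u v w) :
    PV3Exists S₁ S₂ S₃ x y z F ∧ pv3 S₁ S₂ S₃ x y z F =
      pv3 Set.univ Set.univ Set.univ x y z fun u v w =>
        chi S₁ u * chi S₂ v * chi S₃ w * F u v w := by
  have E3 : ∀ u v, PVExists S₃ z fun w => F u v w := fun u v => by
    rw [pvExists_iff_chi h₃]
    have h := (H3 (max L₀ (max |u| |v|)) (le_max_left _ _)).1 u v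
    dsimp only at h
    rw [boxCut_of_le ((le_max_left _ _).trans (le_max_right _ _)),
      boxCut_of_le ((le_max_right _ _).trans (le_max_right _ _))] at h
    simpa using h
  have P3 : ∀ k u v, (pv Set.univ z fun w => k * chi S₃ w * F u v w) =
      k * pv S₃ z fun w => F u v w := fun k u v => by
    rw [pv_eq_chi h₃, ← (pv_const_mul _ _ k _ ((pvExists_iff_chi h₃ _ _).1 (E3 u v))).2]
    simp only [mul_assoc]
  have E2 : ∀ u, PVExists S₂ y fun v => pv S₃ z fun w => F u v w := fun u => by
    rw [pvExists_iff_chi h₂]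
    have h := (H2 (max L₀ |u|) (le_max_left _ _)).2.1 u
    dsimp only at h
    rw [boxCut_of_le (le_max_right _ _)] at h
    simpa [P3] using h
  have P2 : ∀ k u, (pv Set.univ y fun v => pv Set.univ z fun w =>
      k * chi S₂ v * chi S₃ w * F u v w) = k * pv S₂ y fun v => pv S₃ z fun w => F u v w :=
    fun k u => by
    simp only [P3]
    rw [pv_eq_chi h₂, ← (pv_const_mul _ _ k _ ((pvExists_iff_chi h₂ _ _).1 (E2 u))).2]
    simp only [mul_assoc]
  refine ⟨⟨E3, E2, ?_⟩, ?_⟩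
  · rw [pvExists_iff_chi h₁]
    simpa only [P2] using H1.2.2
  · unfold pv3
    rw [pv_eq_chi h₁]
    simp only [P2]

section Sharp

variable {C T r R a b c d x y : ℝ} {Φ : Plane → ℝ}

/-- The position of a point relative to the edges of the pupil `[a, b] × [c, d]`: its distances to
the lines through the edges are at least `2r`, and `R` bounds the point and the pupil. -/
structure OffEdges (r R a b c d x y : ℝ) : Prop where
  pos : 0 < r
  le_one : r ≤ 1
  fst_left : 2 * r ≤ |x - a|
  fst_right : 2 * r ≤ |x - b|
  snd_left : 2 * r ≤ |y - c|
  snd_right : 2 * r ≤ |y - d|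
  fst_lt : |x| + |a| + |b| < R
  snd_lt : |y| + |c| + |d| < R

theorem exists_offEdges (h1 : x ≠ a) (h2 : x ≠ b) (h3 : y ≠ c) (h4 : y ≠ d) :
    ∃ r R, OffEdges r R a b c d x y := by
  have := abs_pos.2 (sub_ne_zero.2 h1)
  have := abs_pos.2 (sub_ne_zero.2 h2)
  have := abs_pos.2 (sub_ne_zero.2 h3)
  have := abs_pos.2 (sub_ne_zero.2 h4)
  set m := min (min |x - a| |x - b|) (min (min |y - c| |y - d|) 1) with hm
  have m0 : 0 < m := by simp only [hm, lt_min_iff]; exact ⟨⟨‹_›, ‹_›⟩, ⟨‹_›, ‹_›⟩, one_pos⟩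
  have m1 : m ≤ |x - a| := (min_le_left _ _).trans (min_le_left _ _)
  have m2 : m ≤ |x - b| := (min_le_left _ _).trans (min_le_right _ _)
  have m3 : m ≤ |y - c| := (min_le_right _ _).trans ((min_le_left _ _).trans (min_le_left _ _))
  have m4 : m ≤ |y - d| := (min_le_right _ _).trans ((min_le_left _ _).trans (min_le_right _ _))
  have m5 : m ≤ 1 := (min_le_right _ _).trans (min_le_right _ _)
  refine ⟨m / 2, |x| + |a| + |b| + (|y| + |c| + |d|) + 1, ⟨by linarith, by linarith, by linarith,
    by linarith, by linarith, by linarith, ?_, ?_⟩⟩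
  · linarith [abs_nonneg y, abs_nonneg c, abs_nonneg d]
  · linarith [abs_nonneg x, abs_nonneg a, abs_nonneg b]

namespace OffEdges

theorem chi_fst (h : OffEdges r R a b c d x y) : IsCutoff r R x (chi (Set.Icc a b)) :=
  isCutoff_chi h.pos h.fst_left h.fst_right h.fst_lt

theorem chi_snd (h : OffEdges r R a b c d x y) : IsCutoff r R y (chi (Set.Icc c d)) :=
  isCutoff_chi h.pos h.snd_left h.snd_right h.snd_lt

theorem box (h : OffEdges r R a b c d x y) {L : ℝ} (hL : |x| + |y| + 1 ≤ L) :
    IsCutoff r (max R (2 * L + 1)) x (boxCut L) ∧ IsCutoff r (max R (2 * L + 1)) y (boxCut L) :=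
  ⟨((isCutoff_boxCut (by linarith [abs_nonneg y])).mono_left h.le_one).mono (le_max_right _ _),
    ((isCutoff_boxCut (by linarith [abs_nonneg x])).mono_left h.le_one).mono (le_max_right _ _)⟩

end OffEdges

theorem sharp_singleX (hT : 0 < T) (hΦ : HolderWave C Φ) (α : ℝ) (h : OffEdges r R a b c d x y) :
    PVExists (Set.Icc a b) x (singleX (kKer α .circular) Φ x y) ∧
      pv (Set.Icc a b) x (singleX (kKer α .circular) Φ x y) =
        hilb (fun u => chi (Set.Icc a b) u •
          meanKernel α T Φ (fun _ => 1) (fun _ => 1) ((u, y), (x, y))) x := by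
  have k := pv_singleX hT hΦ holderMask_one α h.pos y h.chi_fst
  simp only [one_mul] at k
  rw [pvExists_iff_chi measurableSet_Icc, pv_eq_chi measurableSet_Icc]
  exact k

theorem sharp_singleY (hT : 0 < T) (hΦ : HolderWave C Φ) (α : ℝ) (h : OffEdges r R a b c d x y) :
    PVExists (Set.Icc c d) y (singleY (kKer α .circular) Φ x y) ∧
      pv (Set.Icc c d) y (singleY (kKer α .circular) Φ x y) =
        hilb (fun v => chi (Set.Icc c d) v •
          meanKernel α T Φ (fun _ => 1) (fun _ => 1) ((x, v), (x, y))) y := by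
  have k := pv_singleY hT hΦ holderMask_one α h.pos x h.chi_snd
  simp only [one_mul] at k
  rw [pvExists_iff_chi measurableSet_Icc, pv_eq_chi measurableSet_Icc]
  exact k

theorem sharp_tripleX (hT : 0 < T) (hΦ : HolderWave C Φ) (α : ℝ) (h : OffEdges r R a b c d x y) :
    PV3Exists (Set.Icc a b) (Set.Icc c d) (Set.Icc c d) x y y
        (tripleX (lKer α T .circular) Φ x y) ∧
      pv3 (Set.Icc a b) (Set.Icc c d) (Set.Icc c d) x y y (tripleX (lKer α T .circular) Φ x y) =
        hilb3 (chi (Set.Icc a b)) (chi (Set.Icc c d)) (chi (Set.Icc c d)) x y y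
          fun p => meanKernel α T Φ (fun _ => 1) (fun _ => 1) (p.1, (x, p.2)) := by
  have k := fun {R : ℝ} {a b c : ℝ → ℝ} (hc : IsCutoff3 r R x y y a b c) =>
    pv3_tripleX hT hΦ holderMask_one holderMask_one α h.pos hc
  simp only [one_mul] at k
  have s := pv3_of_chi (measurableSet_Icc (a := a) (b := b)) (measurableSet_Icc (a := c) (b := d))
    (measurableSet_Icc (a := c) (b := d)) (x := x) (y := y) (z := y)
    (F := tripleX (lKer α T .circular) Φ x y) (L₀ := |x| + |y| + 1)
    (fun L hL => (k ⟨(h.box hL).1, (h.box hL).2, h.chi_snd.mono (le_max_left _ _)⟩).1)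
    (fun L hL => (k ⟨(h.box hL).1, h.chi_snd.mono (le_max_left _ _),
      h.chi_snd.mono (le_max_left _ _)⟩).1)
    (k ⟨h.chi_fst, h.chi_snd, h.chi_snd⟩).1
  exact ⟨s.1, s.2.trans (k ⟨h.chi_fst, h.chi_snd, h.chi_snd⟩).2⟩

theorem sharp_tripleY (hT : 0 < T) (hΦ : HolderWave C Φ) (α : ℝ) (h : OffEdges r R a b c d x y) :
    PV3Exists (Set.Icc a b) (Set.Icc c d) (Set.Icc a b) x y x
        (tripleY (lKer α T .circular) Φ x y) ∧
      pv3 (Set.Icc a b) (Set.Icc c d) (Set.Icc a b) x y x (tripleY (lKer α T .circular) Φ x y) =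
        hilb3 (chi (Set.Icc a b)) (chi (Set.Icc c d)) (chi (Set.Icc a b)) x y x
          fun p => meanKernel α T Φ (fun _ => 1) (fun _ => 1) (p.1, (p.2, y)) := by
  have k := fun {R : ℝ} {a b c : ℝ → ℝ} (hc : IsCutoff3 r R x y x a b c) =>
    pv3_tripleY hT hΦ holderMask_one holderMask_one α h.pos hc
  simp only [one_mul] at k
  have s := pv3_of_chi (measurableSet_Icc (a := a) (b := b)) (measurableSet_Icc (a := c) (b := d))
    (measurableSet_Icc (a := a) (b := b)) (x := x) (y := y) (z := x)
    (F := tripleY (lKer α T .circular) Φ x y) (L₀ := |x| + |y| + 1)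
    (fun L hL => (k ⟨(h.box hL).1, (h.box hL).2, h.chi_fst.mono (le_max_left _ _)⟩).1)
    (fun L hL => (k ⟨(h.box hL).1, h.chi_snd.mono (le_max_left _ _),
      h.chi_fst.mono (le_max_left _ _)⟩).1)
    (k ⟨h.chi_fst, h.chi_snd, h.chi_fst⟩).1
  exact ⟨s.1, s.2.trans (k ⟨h.chi_fst, h.chi_snd, h.chi_fst⟩).2⟩

theorem pyrDefined_circular (hT : 0 < T) (hΦ : HolderWave C Φ) (α : ℝ) (h1 : x ≠ a) (h2 : x ≠ b)
    (h3 : y ≠ c) (h4 : y ≠ d) :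
    PyrDefined (Set.Icc a b) (Set.Icc c d) (kKer α .circular) (lKer α T .circular) Φ x y := by
  obtain ⟨r, R, h⟩ := exists_offEdges h1 h2 h3 h4
  exact ⟨(sharp_singleX hT hΦ α h).1, (sharp_tripleX hT hΦ α h).1, (sharp_singleY hT hΦ α h).1,
    (sharp_tripleY hT hΦ α h).1⟩

end Sharp

/-! ### Approximation of sharp pupils by smooth masks -/

/-- A smooth approximation of the indicator function of `[a, b]` with transition zones of
width `1/k` inside of the interval. -/
def edge (a b : ℝ) (k : ℕ) (u : ℝ) : ℝ :=
  Real.smoothTransition (k * (u - a)) * Real.smoothTransition (k * (b - u))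

/-- A smooth approximation of the indicator function of the pupil `[a, b] × [c, d]`. -/
def edgeMask (a b c d : ℝ) (k : ℕ) (z : Plane) : ℝ := edge a b k (z 0) * edge c d k (z 1)

section Edge

variable {a b c d : ℝ}

theorem contDiff_edge (a b : ℝ) (k : ℕ) : ContDiff ℝ ∞ (edge a b k) :=
  (Real.smoothTransition.contDiff.comp (contDiff_const.mul (contDiff_id.sub contDiff_const))).mul
    (Real.smoothTransition.contDiff.comp (contDiff_const.mul (contDiff_const.sub contDiff_id)))

theorem edge_nonneg (a b : ℝ) (k : ℕ) (u : ℝ) : 0 ≤ edge a b k u :=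
  mul_nonneg (Real.smoothTransition.nonneg _) (Real.smoothTransition.nonneg _)

theorem edge_le_one (a b : ℝ) (k : ℕ) (u : ℝ) : edge a b k u ≤ 1 :=
  mul_le_one₀ (Real.smoothTransition.le_one _) (Real.smoothTransition.nonneg _)
    (Real.smoothTransition.le_one _)

theorem abs_edge_le (a b : ℝ) (k : ℕ) (u : ℝ) : |edge a b k u| ≤ 1 := by
  rw [abs_of_nonneg (edge_nonneg a b k u)]
  exact edge_le_one a b k u

theorem edge_of_notMem (k : ℕ) {u : ℝ} (h : u ∉ Set.Icc a b) : edge a b k u = 0 := by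
  have hk : (0 : ℝ) ≤ k := k.cast_nonneg
  unfold edge
  rw [Set.mem_Icc, not_and_or, not_le, not_le] at h
  rcases h with h | h
  · rw [Real.smoothTransition.zero_of_nonpos (by nlinarith), zero_mul]
  · rw [Real.smoothTransition.zero_of_nonpos (x := k * (b - u)) (by nlinarith), mul_zero]

theorem edge_eq_one {k : ℕ} (hk : k ≠ 0) {u : ℝ} (h : a + 1 / k ≤ u) (h' : u ≤ b - 1 / k) :
    edge a b k u = 1 := by
  have hk' : (0 : ℝ) < k := by positivity
  have e : (k : ℝ) * (1 / k) = 1 := by field_simp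
  unfold edge
  rw [Real.smoothTransition.one_of_one_le, Real.smoothTransition.one_of_one_le, one_mul]
  · rw [← e]; gcongr; linarith
  · rw [← e]; gcongr; linarith

theorem eventually_one_div_le {ε : ℝ} (hε : 0 < ε) :
    ∀ᶠ k : ℕ in atTop, k ≠ 0 ∧ 1 / (k : ℝ) ≤ ε :=
  (eventually_ne_atTop 0).and
    ((tendsto_one_div_atTop_nhds_zero_nat (𝕜 := ℝ)).eventually_le_const hε)

theorem eventually_edge_eq {u : ℝ} (ha : u ≠ a) (hb : u ≠ b) :
    ∀ᶠ k in atTop, edge a b k u = chi (Set.Icc a b) u := by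
  by_cases h : u ∈ Set.Icc a b
  · have h1 : 0 < u - a := sub_pos.2 (lt_of_le_of_ne h.1 ha.symm)
    have h2 : 0 < b - u := sub_pos.2 (lt_of_le_of_ne h.2 hb)
    filter_upwards [eventually_one_div_le h1, eventually_one_div_le h2] with k hk hk'
    rw [chi_of_mem h, edge_eq_one hk.1 (by linarith) (by linarith)]
  · exact Eventually.of_forall fun k => by rw [chi_of_notMem h, edge_of_notMem k h]

theorem tendsto_edge (a b : ℝ) :
    ∀ᵐ u, Tendsto (fun k => edge a b k u) atTop (𝓝 (chi (Set.Icc a b) u)) := by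
  filter_upwards [Measure.ae_ne volume a, Measure.ae_ne volume b] with u ha hb
  exact tendsto_const_nhds.congr' ((eventually_edge_eq ha hb).mono fun k hk => hk.symm)

theorem eventually_isCutoff_edge {r R x : ℝ} (hr : 0 < r) (ha : 2 * r ≤ |x - a|)
    (hb : 2 * r ≤ |x - b|) (hR : |x| + |a| + |b| < R) :
    ∀ᶠ k in atTop, IsCutoff r R x (edge a b k) :=
  (eventually_one_div_le hr).mono fun k hk =>
    isCutoff_of_eq (contDiff_edge a b k).continuous.measurable (abs_edge_le a b k)
      (fun _ => edge_of_notMem k) (fun _ => edge_eq_one hk.1) hr hk.2 ha hb hR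

theorem contDiff_edgeMask (a b c d : ℝ) (k : ℕ) : ContDiff ℝ ∞ (edgeMask a b c d k) :=
  ((contDiff_edge a b k).comp (contDiff_piLp_apply 2)).mul
    ((contDiff_edge c d k).comp (contDiff_piLp_apply 2))

theorem abs_edgeMask_le (k : ℕ) (z : Plane) :
    |edgeMask a b c d k z| ≤ chi (pupil (Set.Icc a b) (Set.Icc c d)) z := by
  unfold edgeMask
  rw [chi_pupil, abs_mul]
  have key : ∀ a b u, |edge a b k u| ≤ chi (Set.Icc a b) u := fun a b u => by
    by_cases h : u ∈ Set.Icc a b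
    · rw [chi_of_mem h]; exact abs_edge_le a b k u
    · rw [edge_of_notMem k h, chi_of_notMem h, abs_zero]
  exact mul_le_mul (key _ _ _) (key _ _ _) (abs_nonneg _) ((abs_nonneg _).trans (key _ _ _))

theorem hasCompactSupport_edgeMask (a b c d : ℝ) (k : ℕ) :
    HasCompactSupport (edgeMask a b c d k) := by
  refine HasCompactSupport.intro (isCompact_closedBall (0 : Plane) (|a| + |b| + (|c| + |d|)))
    fun z hz => ?_
  by_contra h
  have h' : z ∈ pupil (Set.Icc a b) (Set.Icc c d) := by
    by_contra h'
    exact h (abs_eq_zero.1 (le_antisymm ((abs_edgeMask_le k z).trans_eq (chi_of_notMem h'))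
      (abs_nonneg _)))
  refine hz ?_
  have e0 : |z 0| ≤ |a| + |b| := by
    rw [abs_le]; constructor <;>
    linarith [h'.1.1, h'.1.2, neg_abs_le a, le_abs_self b, abs_nonneg a, abs_nonneg b]
  have e1 : |z 1| ≤ |c| + |d| := by
    rw [abs_le]; constructor <;>
    linarith [h'.2.1, h'.2.2, neg_abs_le c, le_abs_self d, abs_nonneg c, abs_nonneg d]
  rw [mem_closedBall_zero_iff, EuclideanSpace.norm_eq, Fin.sum_univ_two]
  refine Real.sqrt_le_iff.2 ⟨by positivity, ?_⟩
  simp only [Real.norm_eq_abs]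
  nlinarith [abs_nonneg (z 0), abs_nonneg (z 1)]

theorem ae_eventually_edgeMask_eq (a b c d : ℝ) : ∀ᵐ z : Plane,
    ∀ᶠ k in atTop, edgeMask a b c d k z = chi (pupil (Set.Icc a b) (Set.Icc c d)) z := by
  filter_upwards [ae_coord_ne 0 a, ae_coord_ne 0 b, ae_coord_ne 1 c, ae_coord_ne 1 d]
    with z h1 h2 h3 h4
  filter_upwards [eventually_edge_eq h1 h2, eventually_edge_eq h3 h4] with k e1 e2
  rw [chi_pupil, edgeMask, e1, e2]

variable {C T x y : ℝ} {Φ : Plane → ℝ}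

/-- The pyramid operators for the smooth masks converge to those for the sharp pupil off the lines
through the edges. -/
theorem tendsto_maskPyrX (hT : 0 < T) (hΦ : HolderWave C Φ) (α : ℝ) (h1 : x ≠ a) (h2 : x ≠ b)
    (h3 : y ≠ c) (h4 : y ≠ d) :
    Tendsto (fun k => maskPyrX (edgeMask a b c d k) (kKer α .circular) (lKer α T .circular) Φ x y)
      atTop (𝓝 (pyrX (Set.Icc a b) (Set.Icc c d) (kKer α .circular) (lKer α T .circular) Φ x y)) := by
  obtain ⟨r, R, h⟩ := exists_offEdges h1 h2 h3 h4
  have c1 := eventually_isCutoff_edge h.pos h.fst_left h.fst_right h.fst_lt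
  have c2 := eventually_isCutoff_edge h.pos h.snd_left h.snd_right h.snd_lt
  have hG := (bddHolder_meanKernel hT hΦ holderMask_one holderMask_one α)
  have t1 : Tendsto (fun k => hilb (fun u => edge a b k u •
      meanKernel α T Φ (fun _ => 1) (fun _ => 1) ((u, y), (x, y))) x) atTop
      (𝓝 (pv (Set.Icc a b) x (singleX (kKer α .circular) Φ x y))) := by
    rw [(sharp_singleX hT hΦ α h).2]
    refine tendsto_hilb (by norm_num : (0 : ℝ) < 1 / 2) (c1.mono fun k hk =>
      HolderAt.cutoff_smul (by norm_num) h.pos hk (hG.comp (by norm_num)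
      (φ := fun u : ℝ => ((u, y), (x, y))) (dist_singleX_le x y))) ?_
    filter_upwards [tendsto_edge a b] with u hu using hu.smul_const _
  have t3 : Tendsto (fun k => hilb3 (edge a b k) (edge c d k) (edge c d k) x y y
      fun p => meanKernel α T Φ (fun _ => 1) (fun _ => 1) (p.1, (x, p.2))) atTop
      (𝓝 (pv3 (Set.Icc a b) (Set.Icc c d) (Set.Icc c d) x y y
        (tripleX (lKer α T .circular) Φ x y))) := by
    rw [(sharp_tripleX hT hΦ α h).2]
    exact tendsto_hilb3 (by norm_num) h.pos ((c1.and c2).mono fun k hk => ⟨hk.1, hk.2, hk.2⟩)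
      (tendsto_edge a b) (tendsto_edge c d) (tendsto_edge c d) (hG.comp (by norm_num)
      (φ := fun p : (ℝ × ℝ) × ℝ => (p.1, (x, p.2))) (dist_tripleX_le x))
  have a0 : Tendsto (fun k => edge a b k x) atTop (𝓝 (chi (Set.Icc a b) x)) :=
    tendsto_const_nhds.congr' ((eventually_edge_eq h1 h2).mono fun k hk => hk.symm)
  have b0 : Tendsto (fun k => edge c d k y) atTop (𝓝 (chi (Set.Icc c d) y)) :=
    tendsto_const_nhds.congr' ((eventually_edge_eq h3 h4).mono fun k hk => hk.symm)
  have t := ((((a0.mul b0).const_mul (1 / Real.pi)).mul (b0.mul t1))).add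
    ((a0.const_mul (1 / Real.pi ^ 3)).mul t3)
  -- the mask contributes its value at `(x, y)` and at the points `(u, y)`, hence a square of the
  -- indicator function of `[c, d]` at `y`
  have e : (1 / Real.pi * (chi (Set.Icc a b) x * chi (Set.Icc c d) y) *
      (chi (Set.Icc c d) y * pv (Set.Icc a b) x (singleX (kKer α .circular) Φ x y)) +
      1 / Real.pi ^ 3 * chi (Set.Icc a b) x * pv3 (Set.Icc a b) (Set.Icc c d) (Set.Icc c d) x y y
        (tripleX (lKer α T .circular) Φ x y)) =
      pyrX (Set.Icc a b) (Set.Icc c d) (kKer α .circular) (lKer α T .circular) Φ x y := by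
    rw [pyrX, chi_pupil]
    have : chi (Set.Icc c d) y * chi (Set.Icc c d) y = chi (Set.Icc c d) y := by
      by_cases h : y ∈ Set.Icc c d <;> simp [chi_of_mem, chi_of_notMem, h]
    simp only [Matrix.cons_val_zero, Matrix.cons_val_one]
    linear_combination (1 / Real.pi * chi (Set.Icc a b) x *
      pv (Set.Icc a b) x (singleX (kKer α .circular) Φ x y)) * this
  rw [e] at t
  refine t.congr' ?_
  filter_upwards [c1, c2] with k k1 k2
  have s1 := pv_singleX hT hΦ holderMask_one α h.pos y k1
  have s3 := pv3_tripleX hT hΦ holderMask_one holderMask_one α h.pos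
    (⟨k1, k2, k2⟩ : IsCutoff3 r R x y y (edge a b k) (edge c d k) (edge c d k))
  have p1 : pv Set.univ x (fun x' => edgeMask a b c d k !₂[x', y] *
      singleX (kKer α .circular) Φ x y x') = edge c d k y *
      hilb (fun u => edge a b k u •
        meanKernel α T Φ (fun _ => 1) (fun _ => 1) ((u, y), (x, y))) x := by
    rw [← s1.2, ← (pv_const_mul _ _ (edge c d k y) _ s1.1).2]
    congr 1; ext s
    simp only [edgeMask, Matrix.cons_val_zero, Matrix.cons_val_one]; ring
  have p3 : pv3 Set.univ Set.univ Set.univ x y y (fun x' y' y'' => edgeMask a b c d k !₂[x', y'] *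
      edgeMask a b c d k !₂[x, y''] * tripleX (lKer α T .circular) Φ x y x' y' y'') = edge a b k x *
      hilb3 (edge a b k) (edge c d k) (edge c d k) x y y
        fun p => meanKernel α T Φ (fun _ => 1) (fun _ => 1) (p.1, (x, p.2)) := by
    rw [← s3.2, ← (pv3_const_mul s3.1 (edge a b k x)).2]
    congr 1; ext u v w
    simp only [edgeMask, Matrix.cons_val_zero, Matrix.cons_val_one]; ring
  rw [maskPyrX, p1, p3]
  simp only [edgeMask, Matrix.cons_val_zero, Matrix.cons_val_one]
  ring

theorem tendsto_maskPyrY (hT : 0 < T) (hΦ : HolderWave C Φ) (α : ℝ) (h1 : x ≠ a) (h2 : x ≠ b)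
    (h3 : y ≠ c) (h4 : y ≠ d) :
    Tendsto (fun k => maskPyrY (edgeMask a b c d k) (kKer α .circular) (lKer α T .circular) Φ x y)
      atTop (𝓝 (pyrY (Set.Icc a b) (Set.Icc c d) (kKer α .circular) (lKer α T .circular) Φ x y)) := by
  obtain ⟨r, R, h⟩ := exists_offEdges h1 h2 h3 h4
  have c1 := eventually_isCutoff_edge h.pos h.fst_left h.fst_right h.fst_lt
  have c2 := eventually_isCutoff_edge h.pos h.snd_left h.snd_right h.snd_lt
  have hG := (bddHolder_meanKernel hT hΦ holderMask_one holderMask_one α)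
  have t1 : Tendsto (fun k => hilb (fun v => edge c d k v •
      meanKernel α T Φ (fun _ => 1) (fun _ => 1) ((x, v), (x, y))) y) atTop
      (𝓝 (pv (Set.Icc c d) y (singleY (kKer α .circular) Φ x y))) := by
    rw [(sharp_singleY hT hΦ α h).2]
    refine tendsto_hilb (by norm_num : (0 : ℝ) < 1 / 2) (c2.mono fun k hk =>
      HolderAt.cutoff_smul (by norm_num) h.pos hk (hG.comp (by norm_num)
      (φ := fun v : ℝ => ((x, v), (x, y))) (dist_singleY_le x y))) ?_
    filter_upwards [tendsto_edge c d] with u hu using hu.smul_const _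
  have t3 : Tendsto (fun k => hilb3 (edge a b k) (edge c d k) (edge a b k) x y x
      fun p => meanKernel α T Φ (fun _ => 1) (fun _ => 1) (p.1, (p.2, y))) atTop
      (𝓝 (pv3 (Set.Icc a b) (Set.Icc c d) (Set.Icc a b) x y x
        (tripleY (lKer α T .circular) Φ x y))) := by
    rw [(sharp_tripleY hT hΦ α h).2]
    exact tendsto_hilb3 (by norm_num) h.pos ((c1.and c2).mono fun k hk => ⟨hk.1, hk.2, hk.1⟩)
      (tendsto_edge a b) (tendsto_edge c d) (tendsto_edge a b) (hG.comp (by norm_num)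
      (φ := fun p : (ℝ × ℝ) × ℝ => (p.1, (p.2, y))) (dist_tripleY_le y))
  have a0 : Tendsto (fun k => edge a b k x) atTop (𝓝 (chi (Set.Icc a b) x)) :=
    tendsto_const_nhds.congr' ((eventually_edge_eq h1 h2).mono fun k hk => hk.symm)
  have b0 : Tendsto (fun k => edge c d k y) atTop (𝓝 (chi (Set.Icc c d) y)) :=
    tendsto_const_nhds.congr' ((eventually_edge_eq h3 h4).mono fun k hk => hk.symm)
  have t := ((((a0.mul b0).const_mul (1 / Real.pi)).mul (a0.mul t1))).add
    ((b0.const_mul (1 / Real.pi ^ 3)).mul t3)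
  have e : (1 / Real.pi * (chi (Set.Icc a b) x * chi (Set.Icc c d) y) *
      (chi (Set.Icc a b) x * pv (Set.Icc c d) y (singleY (kKer α .circular) Φ x y)) +
      1 / Real.pi ^ 3 * chi (Set.Icc c d) y * pv3 (Set.Icc a b) (Set.Icc c d) (Set.Icc a b) x y x
        (tripleY (lKer α T .circular) Φ x y)) =
      pyrY (Set.Icc a b) (Set.Icc c d) (kKer α .circular) (lKer α T .circular) Φ x y := by
    rw [pyrY, chi_pupil]
    have : chi (Set.Icc a b) x * chi (Set.Icc a b) x = chi (Set.Icc a b) x := by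
      by_cases h : x ∈ Set.Icc a b <;> simp [chi_of_mem, chi_of_notMem, h]
    simp only [Matrix.cons_val_zero, Matrix.cons_val_one]
    linear_combination (1 / Real.pi * chi (Set.Icc c d) y *
      pv (Set.Icc c d) y (singleY (kKer α .circular) Φ x y)) * this
  rw [e] at t
  refine t.congr' ?_
  filter_upwards [c1, c2] with k k1 k2
  have s1 := pv_singleY hT hΦ holderMask_one α h.pos x k2
  have s3 := pv3_tripleY hT hΦ holderMask_one holderMask_one α h.pos
    (⟨k1, k2, k1⟩ : IsCutoff3 r R x y x (edge a b k) (edge c d k) (edge a b k))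
  have p1 : pv Set.univ y (fun y' => edgeMask a b c d k !₂[x, y'] *
      singleY (kKer α .circular) Φ x y y') = edge a b k x *
      hilb (fun v => edge c d k v •
        meanKernel α T Φ (fun _ => 1) (fun _ => 1) ((x, v), (x, y))) y := by
    rw [← s1.2, ← (pv_const_mul _ _ (edge a b k x) _ s1.1).2]
    congr 1; ext s
    simp only [edgeMask, Matrix.cons_val_zero, Matrix.cons_val_one]; ring
  have p3 : pv3 Set.univ Set.univ Set.univ x y x (fun x' y' x'' => edgeMask a b c d k !₂[x', y'] *
      edgeMask a b c d k !₂[x'', y] * tripleY (lKer α T .circular) Φ x y x' y' x'') = edge c d k y *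
      hilb3 (edge a b k) (edge c d k) (edge a b k) x y x
        fun p => meanKernel α T Φ (fun _ => 1) (fun _ => 1) (p.1, (p.2, y)) := by
    rw [← s3.2, ← (pv3_const_mul s3.1 (edge c d k y)).2]
    congr 1; ext u v w
    simp only [edgeMask, Matrix.cons_val_zero, Matrix.cons_val_one]; ring
  rw [maskPyrY, p1, p3]
  simp only [edgeMask, Matrix.cons_val_zero, Matrix.cons_val_one]
  ring

end Edge

/-! ### Fourier-Plancherel amplitudes -/

theorem toL2_of_memLp {f : Plane → ℂ} (h : MemLp f 2 (volume : Measure Plane)) :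
    toL2 f = h.toLp f := dif_pos h

theorem toL1_of_memLp {f : Plane → ℝ} (h : MemLp f 1 (volume : Measure Plane)) :
    toL1 f = h.toLp f := dif_pos h

theorem coeFn_toL2 {f : Plane → ℂ} (h : MemLp f 2 (volume : Measure Plane)) :
    (toL2 f : Plane → ℂ) =ᵐ[volume] f := by
  rw [toL2_of_memLp h]; exact h.coeFn_toLp

theorem coeFn_toL1 {f : Plane → ℝ} (h : MemLp f 1 (volume : Measure Plane)) :
    (toL1 f : Plane → ℝ) =ᵐ[volume] f := by
  rw [toL1_of_memLp h]; exact h.coeFn_toLp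

/-- The Fourier-Plancherel transform is given by the Fourier integral on `L¹ ∩ L²`. -/
theorem fourier_toL2_ae {f : Plane → ℂ} (hf : Integrable f)
    (hf2 : MemLp f 2 (volume : Measure Plane)) :
    ((𝓕 (toL2 f) : Lp ℂ 2 (volume : Measure Plane)) : Plane → ℂ) =ᵐ[volume] 𝓕 f := by
  refine ae_eq_of_forall_schwartz ((Lp.memLp _).locallyIntegrable (by norm_num))
    (continuous_fourier hf).locallyIntegrable fun φ => ?_
  have h := congrArg (fun u : 𝓢'(Plane, ℂ) => u φ) (Lp.fourier_toTemperedDistribution_eq (toL2 f))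
  simp only [TemperedDistribution.fourier_apply, Lp.toTemperedDistribution_apply, smul_eq_mul] at h
  rw [← h, ← integral_fourier_mul φ.integrable hf, ← SchwartzMap.fourier_coe]
  refine integral_congr_ae ?_
  filter_upwards [coeFn_toL2 hf2] with x hx
  rw [hx]

theorem fourierInv_toL2_ae {f : Plane → ℂ} (hf : Integrable f)
    (hf2 : MemLp f 2 (volume : Measure Plane)) :
    ((𝓕⁻ (toL2 f) : Lp ℂ 2 (volume : Measure Plane)) : Plane → ℂ) =ᵐ[volume] 𝓕⁻ f := by
  refine ae_eq_of_forall_schwartz ((Lp.memLp _).locallyIntegrable (by norm_num))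
    (continuous_fourierInv hf).locallyIntegrable fun φ => ?_
  have h := congrArg (fun u : 𝓢'(Plane, ℂ) => u φ)
    (Lp.fourierInv_toTemperedDistribution_eq (toL2 f))
  simp only [TemperedDistribution.fourierInv_apply, Lp.toTemperedDistribution_apply,
    smul_eq_mul] at h
  rw [← h, ← integral_fourierInv_mul φ.integrable hf, ← SchwartzMap.fourierInv_coe]
  refine integral_congr_ae ?_
  filter_upwards [coeFn_toL2 hf2] with x hx
  rw [hx]

theorem norm_fourier_sub (u v : Lp ℂ 2 (volume : Measure Plane)) : ‖𝓕 u - 𝓕 v‖ = ‖u - v‖ := by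
  have h : 𝓕 (u - v) = 𝓕 u - 𝓕 v := map_sub (Lp.fourierTransformₗᵢ Plane ℂ) u v
  rw [← h, Lp.norm_fourier_eq]

theorem norm_fourierInv_sub (u v : Lp ℂ 2 (volume : Measure Plane)) :
    ‖𝓕⁻ u - 𝓕⁻ v‖ = ‖u - v‖ := by
  rw [← norm_fourier_sub, FourierTransform.fourier_fourierInv_eq,
    FourierTransform.fourier_fourierInv_eq]

/-- The passage from the pupil to the detector through the facet `(m, n)`, on `L²`. -/
def beam (m n : Fin 2) (u : Lp ℂ 2 (volume : Measure Plane)) : Lp ℂ 2 (volume : Measure Plane) :=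
  𝓕⁻ (toL2 fun ζ => facet m n ζ * (𝓕 u : Lp ℂ 2 (volume : Measure Plane)) ζ)

theorem norm_beam_sub_le (m n : Fin 2) (u v : Lp ℂ 2 (volume : Measure Plane)) :
    ‖beam m n u - beam m n v‖ ≤ ‖u - v‖ := by
  unfold beam
  rw [norm_fourierInv_sub, ← norm_fourier_sub u v]
  refine Lp.norm_le_norm_of_ae_le ?_
  filter_upwards [coeFn_toL2 (memLp_facet_mul m n (𝓕 u)), coeFn_toL2 (memLp_facet_mul m n (𝓕 v)),
    Lp.coeFn_sub (𝓕 u) (𝓕 v), Lp.coeFn_sub (toL2 fun ζ => facet m n ζ * (𝓕 u : Lp ℂ 2 _) ζ)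
      (toL2 fun ζ => facet m n ζ * (𝓕 v : Lp ℂ 2 _) ζ)] with ζ e1 e2 e3 e4
  rw [e3, e4, Pi.sub_apply, Pi.sub_apply, e1, e2, ← mul_sub, norm_mul]
  exact mul_le_of_le_one_left (norm_nonneg _) (norm_facet_le m n ζ)

theorem continuous_beam (m n : Fin 2) : Continuous (beam m n) :=
  (LipschitzWith.of_dist_le_mul (K := 1) fun u v => by
    simpa [dist_eq_norm] using norm_beam_sub_le m n u v).continuous

theorem beam_zero (m n : Fin 2) : beam m n 0 = 0 := by
  unfold beam
  have h0 : 𝓕 (0 : Lp ℂ 2 (volume : Measure Plane)) = 0 :=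
    map_zero (Lp.fourierTransformₗᵢ Plane ℂ)
  have h1 : (toL2 fun ζ => facet m n ζ *
      (𝓕 (0 : Lp ℂ 2 (volume : Measure Plane)) : Lp ℂ 2 (volume : Measure Plane)) ζ) = 0 := by
    rw [h0, Lp.eq_zero_iff_ae_eq_zero]
    filter_upwards [coeFn_toL2 (memLp_facet_mul m n 0),
      Lp.coeFn_zero ℂ 2 (volume : Measure Plane)] with ζ e1 e2
    rw [e1, e2]
    simp
  rw [h1]
  exact map_zero (Lp.fourierTransformₗᵢ Plane ℂ).symm

theorem norm_beam_le (m n : Fin 2) (u : Lp ℂ 2 (volume : Measure Plane)) :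
    ‖beam m n u‖ ≤ ‖u‖ := by
  simpa [beam_zero] using norm_beam_sub_le m n u 0

/-- The two versions of the detector amplitudes agree if both are defined. -/
theorem detAmpL2_ae {ψ : Plane → ℂ} (h1 : Integrable ψ) (h2 : MemLp ψ 2 (volume : Measure Plane))
    (h3 : Integrable (𝓕 ψ)) (m n : Fin 2) :
    (detAmpL2 m n ψ : Plane → ℂ) =ᵐ[volume] detAmp m n ψ := by
  have e : (fun ζ => facet m n ζ * (𝓕 (toL2 ψ) : Lp ℂ 2 (volume : Measure Plane)) ζ) =ᵐ[volume]
      focal m n ψ := by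
    filter_upwards [fourier_toL2_ae h1 h2] with ζ hζ
    rw [hζ, focal]
  have hm := memLp_facet_mul m n (𝓕 (toL2 ψ))
  have hm' := hm.ae_eq e
  have e2 : (toL2 fun ζ => facet m n ζ * (𝓕 (toL2 ψ) : Lp ℂ 2 (volume : Measure Plane)) ζ) =
      toL2 (focal m n ψ) := by
    rw [toL2_of_memLp hm, toL2_of_memLp hm', MemLp.toLp_eq_toLp_iff]
    exact e
  unfold detAmpL2
  rw [e2]
  exact fourierInv_toL2_ae (Amplitude.integrable_focal h3 m n) hm'

/-! ### Intensities in `L¹` -/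

/-- The intensity `|u|²` of an amplitude. -/
def sqL1 (u : Lp ℂ 2 (volume : Measure Plane)) : Lp ℝ 1 (volume : Measure Plane) :=
  (innerSL ℝ (E := ℂ)).holderL volume 2 2 1 u u

theorem coeFn_sqL1 (u : Lp ℂ 2 (volume : Measure Plane)) :
    (sqL1 u : Plane → ℝ) =ᵐ[volume] fun z => Complex.normSq (u z) := by
  filter_upwards [ContinuousLinearMap.coeFn_holder (r := 1) (innerSL ℝ (E := ℂ)) u u] with z hz
  rw [sqL1, ContinuousLinearMap.holderL_apply_apply, hz, Complex.normSq_eq_norm_sq]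
  exact real_inner_self_eq_norm_sq (u z)

theorem continuous_sqL1 : Continuous sqL1 :=
  ((innerSL ℝ (E := ℂ)).holderL volume 2 2 1).continuous.clm_apply continuous_id

theorem norm_sqL1_le (u : Lp ℂ 2 (volume : Measure Plane)) :
    ‖sqL1 u‖ ≤ ‖(innerSL ℝ (E := ℂ)).holderL (volume : Measure Plane) 2 2 1‖ * ‖u‖ * ‖u‖ :=
  ContinuousLinearMap.le_opNorm₂ _ _ _

/-- A linear combination of four intensities. -/
def comb (w : Fin 2 → Fin 2 → ℝ) (I : Fin 2 → Fin 2 → ℝ) : ℝ := ∑ m, ∑ n, w m n * I m n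

/-- The linear combination of the four intensities that belong to an amplitude in the pupil. -/
def combL1 (w : Fin 2 → Fin 2 → ℝ) (u : Lp ℂ 2 (volume : Measure Plane)) :
    Lp ℝ 1 (volume : Measure Plane) := ∑ m, ∑ n, w m n • sqL1 (beam m n u)

theorem continuous_combL1 (w : Fin 2 → Fin 2 → ℝ) : Continuous (combL1 w) :=
  continuous_finsetSum _ fun m _ => continuous_finsetSum _ fun n _ =>
    (continuous_sqL1.comp (continuous_beam m n)).const_smul (w m n)

theorem norm_combL1_le (w : Fin 2 → Fin 2 → ℝ) : ∃ K, ∀ u B, ‖u‖ ≤ B → ‖combL1 w u‖ ≤ K * (B * B) := by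
  refine ⟨∑ m, ∑ n, ‖w m n‖ * ‖(innerSL ℝ (E := ℂ)).holderL (volume : Measure Plane) 2 2 1‖,
    fun u B hu => ?_⟩
  unfold combL1
  rw [Finset.sum_mul]
  refine norm_sum_le_of_le _ fun m _ => ?_
  rw [Finset.sum_mul]
  refine norm_sum_le_of_le _ fun n _ => ?_
  rw [norm_smul, mul_assoc]
  have h := (norm_beam_le m n u).trans hu
  have h0 := norm_nonneg (beam m n u)
  refine mul_le_mul_of_nonneg_left ((norm_sqL1_le _).trans ?_) (norm_nonneg _)
  rw [mul_assoc]
  have hB := h0.trans h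
  gcongr

theorem coeFn_combL1 (w : Fin 2 → Fin 2 → ℝ) (ψ : Plane → ℂ) :
    (combL1 w (toL2 ψ) : Plane → ℝ) =ᵐ[volume] fun z => comb w (intensityL2 ψ z) := by
  have h : ∀ m n, (w m n • sqL1 (beam m n (toL2 ψ)) : Plane → ℝ) =ᵐ[volume]
      fun z => w m n * intensityL2 ψ z m n := fun m n => by
    filter_upwards [coeFn_sqL1 (beam m n (toL2 ψ))] with z h2
    rw [Pi.smul_apply, h2]
    rfl
  have h' := fun m n => (Lp.coeFn_smul (w m n) (sqL1 (beam m n (toL2 ψ)))).trans (h m n)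
  unfold combL1 comb
  simp only [Fin.sum_univ_two]
  filter_upwards [h' 0 0, h' 0 1, h' 1 0, h' 1 1,
    Lp.coeFn_add (w 0 0 • sqL1 (beam 0 0 (toL2 ψ)) + w 0 1 • sqL1 (beam 0 1 (toL2 ψ)))
      (w 1 0 • sqL1 (beam 1 0 (toL2 ψ)) + w 1 1 • sqL1 (beam 1 1 (toL2 ψ))),
    Lp.coeFn_add (w 0 0 • sqL1 (beam 0 0 (toL2 ψ))) (w 0 1 • sqL1 (beam 0 1 (toL2 ψ))),
    Lp.coeFn_add (w 1 0 • sqL1 (beam 1 0 (toL2 ψ))) (w 1 1 • sqL1 (beam 1 1 (toL2 ψ)))]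
    with z e1 e2 e3 e4 a1 a2 a3
  rw [a1, Pi.add_apply, a2, a3, Pi.add_apply, Pi.add_apply, e1, e2, e3, e4]

theorem toL1_comb (w : Fin 2 → Fin 2 → ℝ) (ψ : Plane → ℂ) :
    (toL1 fun z => comb w (intensityL2 ψ z)) = combL1 w (toL2 ψ) := by
  have h := coeFn_combL1 w ψ
  have hm : MemLp (fun z => comb w (intensityL2 ψ z)) 1 (volume : Measure Plane) :=
    (Lp.memLp (combL1 w (toL2 ψ))).ae_eq h
  refine Lp.ext ?_
  filter_upwards [coeFn_toL1 hm, h] with z e1 e2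
  rw [e1, e2]

/-- The weights of the intensities in the data in `x`-direction. -/
def weightX (I₀ : ℝ) (m _ : Fin 2) : ℝ := I₀⁻¹ * (-1) ^ (m : ℕ)

/-- The weights of the intensities in the data in `y`-direction. -/
def weightY (I₀ : ℝ) (_ n : Fin 2) : ℝ := -(I₀⁻¹ * (-1) ^ (n : ℕ))

theorem combX_eq_comb (I₀ : ℝ) : combX I₀ = comb (weightX I₀) := by
  ext I
  simp [combX, comb, weightX, Fin.sum_univ_two]
  ring

theorem combY_eq_comb (I₀ : ℝ) : combY I₀ = comb (weightY I₀) := by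
  ext I
  simp [combY, comb, weightY, Fin.sum_univ_two]
  ring

/-! ### Limits and integrals in `Lᵖ` -/

/-- Dominated convergence in `L²`. -/
theorem tendsto_toL2 {ι : Type*} {l : Filter ι} [l.IsCountablyGenerated] {F : ι → Plane → ℂ}
    {f : Plane → ℂ} {g : Plane → ℝ} (hg : MemLp g 2 (volume : Measure Plane))
    (hF : ∀ i, AEStronglyMeasurable (F i) (volume : Measure Plane))
    (hf : AEStronglyMeasurable f (volume : Measure Plane))
    (hFg : ∀ i z, ‖F i z‖ ≤ g z) (hfg : ∀ z, ‖f z‖ ≤ g z)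
    (hlim : ∀ᵐ z, Tendsto (fun i => F i z) l (𝓝 (f z))) :
    Tendsto (fun i => toL2 (F i)) l (𝓝 (toL2 f)) := by
  have hg' : ∀ z, ‖g z‖ = g z := fun z => by
    rw [Real.norm_eq_abs, abs_of_nonneg ((norm_nonneg _).trans (hfg z))]
  have mF : ∀ i, MemLp (F i) 2 (volume : Measure Plane) := fun i =>
    hg.mono (hF i) (Eventually.of_forall fun z => by rw [hg']; exact hFg i z)
  have mf : MemLp f 2 (volume : Measure Plane) :=
    hg.mono hf (Eventually.of_forall fun z => by rw [hg']; exact hfg z)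
  rw [tendsto_iff_edist_tendsto_0]
  simp only [toL2_of_memLp mf, fun i => toL2_of_memLp (mF i), Lp.edist_toLp_toLp]
  have e : ∀ i, eLpNorm (F i - f) 2 (volume : Measure Plane) =
      (∫⁻ z, ‖F i z - f z‖ₑ ^ (2 : ℝ)) ^ (1 / (2 : ℝ)) := fun i => by
    rw [eLpNorm_eq_lintegral_rpow_enorm_toReal (by norm_num) (by norm_num)]
    simp
  simp only [e]
  have h2 : MemLp (fun z => 2 * g z) 2 (volume : Measure Plane) := hg.const_mul 2
  have hfin := lintegral_rpow_enorm_lt_top_of_eLpNorm_lt_top (by norm_num) (by norm_num)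
    h2.eLpNorm_lt_top
  have t : Tendsto (fun i => ∫⁻ z, ‖F i z - f z‖ₑ ^ (2 : ℝ)) l (𝓝 (∫⁻ _ : Plane, 0)) := by
    refine tendsto_lintegral_filter_of_dominated_convergence'
      (fun z => ‖2 * g z‖ₑ ^ (2 : ℝ)) (Eventually.of_forall fun i =>
        ((hF i).sub hf).enorm.pow_const _) (Eventually.of_forall fun i =>
        Eventually.of_forall fun z => ?_) (by simpa using hfin.ne) ?_
    · gcongr
      rw [enorm_le_iff_norm_le, norm_mul, hg']
      refine (norm_sub_le _ _).trans ?_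
      have := hFg i z
      have := hfg z
      norm_num
      linarith
    · filter_upwards [hlim] with z hz
      have h := ((hz.sub_const (f z)).enorm).ennrpow_const 2
      simpa using h
  have t' := t.ennrpow_const (1 / 2)
  simpa using t'

/-- A Bochner integral in `L¹` can be computed pointwise. -/
theorem coeFn_intervalIntegral {F : ℝ → Lp ℝ 1 (volume : Measure Plane)} {a b : ℝ} (hab : a ≤ b)
    (hF : IntervalIntegrable F volume a b) {g : ℝ → Plane → ℝ}
    (hg : StronglyMeasurable (Function.uncurry g)) (hFg : ∀ t, (F t : Plane → ℝ) =ᵐ[volume] g t) :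
    ((∫ t in a..b, F t : Lp ℝ 1 (volume : Measure Plane)) : Plane → ℝ) =ᵐ[volume]
      fun z => ∫ t in a..b, g t z := by
  simp only [intervalIntegral.integral_of_le hab]
  rw [intervalIntegrable_iff_integrableOn_Ioc_of_le hab] at hF
  have hI : Integrable (Function.uncurry g)
      ((volume.restrict (Set.Ioc a b)).prod (volume : Measure Plane)) := by
    rw [integrable_prod_iff hg.aestronglyMeasurable]
    refine ⟨Eventually.of_forall fun t => (L1.integrable_coeFn (F t)).congr (hFg t), ?_⟩
    refine hF.norm.congr (Eventually.of_forall fun t => ?_)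
    dsimp only
    rw [L1.norm_eq_integral_norm]
    exact integral_congr_ae ((hFg t).mono fun z hz => by simp [hz])
  refine Integrable.ae_eq_of_forall_setIntegral_eq _ _ (L1.integrable_coeFn _)
    hI.integral_prod_right fun s hs _ => ?_
  let A : Lp ℝ 1 (volume : Measure Plane) →L[ℝ] ℝ :=
    { toFun := fun u => ∫ z in s, u z
      map_add' := fun u v => by
        rw [← integral_add (L1.integrable_coeFn u).integrableOn (L1.integrable_coeFn v).integrableOn]
        exact integral_congr_ae (ae_restrict_of_ae (Lp.coeFn_add u v))
      map_smul' := fun c u => by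
        rw [RingHom.id_apply, smul_eq_mul, ← integral_const_mul]
        exact integral_congr_ae (ae_restrict_of_ae (Lp.coeFn_smul c u))
      cont := continuous_setIntegral s }
  have hA : ∀ u, A u = ∫ z in s, u z := fun _ => rfl
  rw [← hA, ← A.integral_comp_comm hF]
  have hI' : Integrable (Function.uncurry g)
      ((volume.restrict (Set.Ioc a b)).prod ((volume : Measure Plane).restrict s)) := by
    refine hI.mono_measure ?_
    exact Measure.prod_mono le_rfl Measure.restrict_le_self
  rw [← integral_integral_swap hI']
  refine integral_congr_ae (Eventually.of_forall fun t => ?_)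
  simp only [hA]
  exact integral_congr_ae (ae_restrict_of_ae (hFg t))

/-! ### Joint measurability of the data in time and space -/

theorem stronglyMeasurable_fourier {F : ℝ → Plane → ℂ}
    (hF : StronglyMeasurable (Function.uncurry F)) :
    StronglyMeasurable (Function.uncurry fun t => 𝓕 (F t)) := by
  have h : StronglyMeasurable fun q : (ℝ × Plane) × Plane =>
      Real.fourierChar (-(inner ℝ q.2 q.1.2)) • F q.1.1 q.2 := by
    refine StronglyMeasurable.smul (f := fun q : (ℝ × Plane) × Plane =>
      Real.fourierChar (-(inner ℝ q.2 q.1.2))) ?_ (hF.comp_measurable (by fun_prop : Measurable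
        fun q : (ℝ × Plane) × Plane => (q.1.1, q.2)))
    exact (Real.continuous_fourierChar.comp (by fun_prop)).stronglyMeasurable
  exact h.integral_prod_right' (ν := (volume : Measure Plane))

theorem stronglyMeasurable_fourierInv {F : ℝ → Plane → ℂ}
    (hF : StronglyMeasurable (Function.uncurry F)) :
    StronglyMeasurable (Function.uncurry fun t => 𝓕⁻ (F t)) := by
  have h := (stronglyMeasurable_fourier hF).comp_measurable
    (by fun_prop : Measurable fun q : ℝ × Plane => (q.1, -q.2))
  have e : (Function.uncurry fun t => 𝓕⁻ (F t)) =
      (Function.uncurry fun t => 𝓕 (F t)) ∘ fun q : ℝ × Plane => (q.1, -q.2) := by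
    ext q
    exact Real.fourierInv_eq_fourier_neg _ _
  rw [e]
  exact h

theorem stronglyMeasurable_comb_intensity {F : ℝ → Plane → ℂ}
    (hF : StronglyMeasurable (Function.uncurry F)) (w : Fin 2 → Fin 2 → ℝ) :
    StronglyMeasurable (Function.uncurry fun t z => comb w (intensity (F t) z)) := by
  have h : ∀ m n, StronglyMeasurable fun q : ℝ × Plane => w m n * intensity (F q.1) q.2 m n :=
    fun m n => by
    have h1 : StronglyMeasurable (Function.uncurry fun t => focal m n (F t)) :=
      ((measurable_facet m n).comp measurable_snd).stronglyMeasurable.mul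
        (stronglyMeasurable_fourier hF)
    exact (Complex.continuous_normSq.comp_stronglyMeasurable
      (stronglyMeasurable_fourierInv h1)).const_mul _
  have e : (Function.uncurry fun t z => comb w (intensity (F t) z)) = fun q : ℝ × Plane =>
      (w 0 0 * intensity (F q.1) q.2 0 0 + w 0 1 * intensity (F q.1) q.2 0 1) +
      (w 1 0 * intensity (F q.1) q.2 1 0 + w 1 1 * intensity (F q.1) q.2 1 1) := by
    ext q
    simp [Function.uncurry, comb, Fin.sum_univ_two]
  rw [e]
  exact ((h 0 0).add (h 0 1)).add ((h 1 0).add (h 1 1))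

/-! ### Data of the sharp pupil -/

theorem measurable_chi_pupil (a b c d : ℝ) :
    Measurable (chi (pupil (Set.Icc a b) (Set.Icc c d))) := by
  have h0 : Measurable fun z : Plane => z 0 := by fun_prop
  have h1 : Measurable fun z : Plane => z 1 := by fun_prop
  exact measurable_const.indicator ((h0 measurableSet_Icc).inter (h1 measurableSet_Icc))

theorem norm_aperture (M Φ : Plane → ℝ) (z : Plane) : ‖aperture M Φ z‖ = |M z| := by
  rw [aperture, norm_mul, norm_exp_neg_I_mul, mul_one, Complex.norm_real, Real.norm_eq_abs]

theorem memLp_chi_pupil (a b c d : ℝ) :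
    MemLp (chi (pupil (Set.Icc a b) (Set.Icc c d))) 2 (volume : Measure Plane) := by
  have h := memLp_aperture a b c d (fun _ => 0) continuous_const
  refine h.mono (measurable_chi_pupil a b c d).aestronglyMeasurable (Eventually.of_forall fun z => ?_)
  rw [norm_aperture, Real.norm_eq_abs]

section Data

variable {a b c d α T C : ℝ} {Φ M : Plane → ℝ}

theorem measurable_aperture (hΦ : Continuous Φ) (hM : Measurable M) (α T : ℝ) :
    Measurable fun q : ℝ × Plane => aperture M (tilted α T Φ q.1) q.2 := by
  have := (continuous_tilted hΦ α T).measurable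
  unfold aperture
  fun_prop

theorem aestronglyMeasurable_aperture (hΦ : Continuous Φ) (hM : Measurable M) (α T t : ℝ) :
    AEStronglyMeasurable (aperture M (tilted α T Φ t)) (volume : Measure Plane) :=
  ((measurable_aperture hΦ hM α T).comp (by fun_prop : Measurable fun z : Plane => (t, z))
    ).aestronglyMeasurable

/-- In `L²`, the amplitudes in the pupil depend continuously on time. -/
theorem continuous_toL2_aperture (hΦ : Continuous Φ) (hM : Measurable M)
    (hMχ : ∀ z, |M z| ≤ chi (pupil (Set.Icc a b) (Set.Icc c d)) z) (α T : ℝ) :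
    Continuous fun t => toL2 (aperture M (tilted α T Φ t)) := by
  refine continuous_iff_continuousAt.2 fun t₀ => ?_
  refine tendsto_toL2 (memLp_chi_pupil a b c d)
    (fun t => aestronglyMeasurable_aperture hΦ hM α T t)
    (aestronglyMeasurable_aperture hΦ hM α T t₀) (fun t z => by rw [norm_aperture]; exact hMχ z)
    (fun z => by rw [norm_aperture]; exact hMχ z) (Eventually.of_forall fun z => ?_)
  have h : Continuous fun t => aperture M (tilted α T Φ t) z := by
    have := (continuous_tilted hΦ α T).comp (by fun_prop : Continuous fun t : ℝ => (t, z))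
    unfold aperture
    simp only [Function.comp_def] at this
    fun_prop
  exact h.tendsto t₀

theorem norm_toL2_aperture_le (hΦ : Continuous Φ) (hM : Measurable M)
    (hMχ : ∀ z, |M z| ≤ chi (pupil (Set.Icc a b) (Set.Icc c d)) z) (α T t : ℝ) :
    ‖toL2 (aperture M (tilted α T Φ t))‖ ≤ ‖(memLp_chi_pupil a b c d).toLp‖ := by
  have hle : ∀ z, ‖aperture M (tilted α T Φ t) z‖ ≤
      ‖chi (pupil (Set.Icc a b) (Set.Icc c d)) z‖ := fun z => by
    rw [norm_aperture]; exact (hMχ z).trans (le_abs_self _)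
  have hm := (memLp_chi_pupil a b c d).mono (aestronglyMeasurable_aperture hΦ hM α T t)
    (Eventually.of_forall hle)
  refine Lp.norm_le_norm_of_ae_le ?_
  filter_upwards [coeFn_toL2 hm, (memLp_chi_pupil a b c d).coeFn_toLp] with z e1 e2
  rw [e1, e2]
  exact hle z

theorem intervalIntegrable_toL1_comb (hΦ : Continuous Φ) (α T : ℝ) (w : Fin 2 → Fin 2 → ℝ)
    (p q : ℝ) : IntervalIntegrable (fun t => toL1 fun z => comb w (intensityL2
      (aperture (chi (pupil (Set.Icc a b) (Set.Icc c d))) (tilted α T Φ t)) z)) volume p q := by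
  simp only [toL1_comb]
  exact ((continuous_combL1 w).comp (continuous_toL2_aperture hΦ (measurable_chi_pupil a b c d)
    (fun z => (abs_of_nonneg (Set.indicator_nonneg (fun _ _ => zero_le_one) z)).le)
    α T)).intervalIntegrable _ _

/-- The data of the sharp pupil are the limits of the pointwise data of the smooth masks, whenever
these limits exist almost everywhere. -/
theorem ae_eq_of_tendsto_data {G : Plane → ℂ} (hT : 0 < T) (hΦ : HolderWave C Φ) (hG : Integrable G)
    (hGΦ : ∀ z, 𝓕⁻ G z = (Φ z : ℂ)) (α : ℝ) (w : Fin 2 → Fin 2 → ℝ) {P : Plane → ℝ}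
    (hP : ∀ᵐ z, Tendsto (fun k => (1 / T) * ∫ t in (-T / 2)..(T / 2),
      comb w (intensity (aperture (edgeMask a b c d k) (tilted α T Φ t)) z)) atTop (𝓝 (P z))) :
    (((1 / T) • ∫ t in (-T / 2)..(T / 2), toL1 fun z => comb w (intensityL2
      (aperture (chi (pupil (Set.Icc a b) (Set.Icc c d))) (tilted α T Φ t)) z) :
      Lp ℝ 1 (volume : Measure Plane)) : Plane → ℝ) =ᵐ[volume] P := by
  have hχ : ∀ z, |chi (pupil (Set.Icc a b) (Set.Icc c d)) z| ≤
      chi (pupil (Set.Icc a b) (Set.Icc c d)) z := fun z =>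
    (abs_of_nonneg (Set.indicator_nonneg (fun _ _ => zero_le_one) z)).le
  have hmχ := measurable_chi_pupil a b c d
  have hmk := fun k => (contDiff_edgeMask a b c d k).continuous.measurable
  have hk := fun k (z : Plane) => abs_edgeMask_le (a := a) (b := b) (c := c) (d := d) k z
  simp only [toL1_comb]
  set F : ℕ → ℝ → Lp ℝ 1 (volume : Measure Plane) := fun k t =>
    combL1 w (toL2 (aperture (edgeMask a b c d k) (tilted α T Φ t))) with hF
  have hFc : ∀ k, Continuous (F k) := fun k => (continuous_combL1 w).comp
    (continuous_toL2_aperture hΦ.continuous (hmk k) (hk k) α T)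
  -- convergence in `L¹`, by dominated convergence in time
  have t1 : Tendsto (fun k => (1 / T) • ∫ t in (-T / 2)..(T / 2), F k t) atTop
      (𝓝 ((1 / T) • ∫ t in (-T / 2)..(T / 2), combL1 w (toL2
        (aperture (chi (pupil (Set.Icc a b) (Set.Icc c d))) (tilted α T Φ t))))) := by
    refine Tendsto.const_smul ?_ _
    obtain ⟨K, hK⟩ := norm_combL1_le w
    refine intervalIntegral.tendsto_integral_filter_of_dominated_convergence (fun _ => K *
      (‖(memLp_chi_pupil a b c d).toLp‖ * ‖(memLp_chi_pupil a b c d).toLp‖))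
      (Eventually.of_forall fun k => (hFc k).aestronglyMeasurable)
      (Eventually.of_forall fun k => Eventually.of_forall fun t _ =>
        hK _ _ (norm_toL2_aperture_le hΦ.continuous (hmk k) (hk k) α T t))
      intervalIntegrable_const (Eventually.of_forall fun t _ => ?_)
    refine ((continuous_combL1 w).tendsto _).comp ?_
    refine tendsto_toL2 (memLp_chi_pupil a b c d)
      (fun k => aestronglyMeasurable_aperture hΦ.continuous (hmk k) α T t)
      (aestronglyMeasurable_aperture hΦ.continuous hmχ α T t)
      (fun k z => by rw [norm_aperture]; exact hk k z)
      (fun z => by rw [norm_aperture]; exact hχ z) ?_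
    filter_upwards [ae_eventually_edgeMask_eq a b c d] with z hz
    exact tendsto_const_nhds.congr' (hz.mono fun k hk => by simp only [aperture, hk])
  -- pointwise formulas for the smooth masks
  have t2 : ∀ k, (((1 / T) • ∫ t in (-T / 2)..(T / 2), F k t :
      Lp ℝ 1 (volume : Measure Plane)) : Plane → ℝ) =ᵐ[volume] fun z =>
      (1 / T) * ∫ t in (-T / 2)..(T / 2),
        comb w (intensity (aperture (edgeMask a b c d k) (tilted α T Φ t)) z) := fun k => by
    have hM := contDiff_edgeMask a b c d k
    have hMc := hasCompactSupport_edgeMask a b c d k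
    obtain ⟨B, hMB⟩ := exists_holderMask hM hMc
    obtain ⟨L₀, hL₀⟩ := exists_supp_bound hMc
    have hA := fun t => amplitude_aperture hΦ hG hGΦ hM hMc hMB hL₀ α T t
    have hm2 : ∀ t, MemLp (aperture (edgeMask a b c d k) (tilted α T Φ t)) 2
        (volume : Measure Plane) := fun t =>
      (memLp_chi_pupil a b c d).mono (aestronglyMeasurable_aperture hΦ.continuous (hmk k) α T t)
        (Eventually.of_forall fun z => by
          rw [norm_aperture]; exact (hk k z).trans (le_abs_self _))
    have e := coeFn_intervalIntegral (by linarith) ((hFc k).intervalIntegrable (-T / 2) (T / 2))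
      (stronglyMeasurable_comb_intensity (F := fun t =>
        aperture (edgeMask a b c d k) (tilted α T Φ t))
        (measurable_aperture hΦ.continuous (hmk k) α T).stronglyMeasurable w) (fun t => ?_)
    · filter_upwards [Lp.coeFn_smul (1 / T) (∫ t in (-T / 2)..(T / 2), F k t), e] with z e1 e2
      rw [e1, Pi.smul_apply, e2, smul_eq_mul]
    · have h := fun m n =>
        detAmpL2_ae (hA t).integrable (hm2 t) (hA t).integrable_fourier m n
      filter_upwards [coeFn_combL1 w (aperture (edgeMask a b c d k) (tilted α T Φ t)), h 0 0, h 0 1,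
        h 1 0, h 1 1] with z e0 e1 e2 e3 e4
      simp only [hF]
      rw [e0]
      simp only [comb, intensityL2, intensity, Fin.sum_univ_two, e1, e2, e3, e4]
  obtain ⟨ns, hns, hsub⟩ := (tendstoInMeasure_of_tendsto_Lp t1).exists_seq_tendsto_ae
  filter_upwards [hsub, ae_all_iff.2 t2, hP] with z h1 h2 h3
  simp only [h2] at h1
  exact tendsto_nhds_unique h1 (h3.comp hns.tendsto_atTop)

theorem cons_coord (z : Plane) : !₂[z 0, z 1] = z := by
  ext i
  fin_cases i <;> rfl

/-- The theorem for sharp pupils and circular modulation with an arbitrary modulation parameter. -/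
theorem sharp_circular {G : Plane → ℂ} {I₀ : ℝ} (hT : 0 < T) (hI₀ : I₀ ≠ 0) (hΦ : HolderWave C Φ)
    (hG : Integrable G) (hGΦ : ∀ z, 𝓕⁻ G z = (Φ z : ℂ)) (α a b c d : ℝ) :
    DataL1Defined I₀ α T (chi (pupil (Set.Icc a b) (Set.Icc c d))) .circular Φ ∧
      (∀ᵐ z : Plane,
        I₀ * dataXL1 I₀ α T (chi (pupil (Set.Icc a b) (Set.Icc c d))) .circular Φ z =
          -(1 / 2) * pyrX (Set.Icc a b) (Set.Icc c d) (kKer α .circular) (lKer α T .circular) Φ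
            (z 0) (z 1)) ∧
      ∀ᵐ z : Plane,
        I₀ * dataYL1 I₀ α T (chi (pupil (Set.Icc a b) (Set.Icc c d))) .circular Φ z =
          (1 / 2) * pyrY (Set.Icc a b) (Set.Icc c d) (kKer α .circular) (lKer α T .circular) Φ
            (z 0) (z 1) := by
  have hsm := fun k => (smooth_circular hT hI₀ hΦ hG hGΦ (contDiff_edgeMask a b c d k)
    (hasCompactSupport_edgeMask a b c d k) α).2
  have hoff : ∀ᵐ z : Plane, (z 0 ≠ a ∧ z 0 ≠ b) ∧ (z 1 ≠ c ∧ z 1 ≠ d) :=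
    ((ae_coord_ne 0 a).and (ae_coord_ne 0 b)).and ((ae_coord_ne 1 c).and (ae_coord_ne 1 d))
  refine ⟨⟨?_, ?_⟩, ?_, ?_⟩
  · rw [combX_eq_comb]
    exact intervalIntegrable_toL1_comb hΦ.continuous α T _ _ _
  · rw [combY_eq_comb]
    exact intervalIntegrable_toL1_comb hΦ.continuous α T _ _ _
  · have h := ae_eq_of_tendsto_data (a := a) (b := b) (c := c) (d := d) hT hΦ hG hGΦ α
      (weightX I₀) (P := fun z => I₀⁻¹ * (-(1 / 2) * pyrX (Set.Icc a b) (Set.Icc c d)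
        (kKer α .circular) (lKer α T .circular) Φ (z 0) (z 1))) ?_
    · filter_upwards [h] with z hz
      rw [← combX_eq_comb] at hz
      rw [dataXL1, hz, mul_inv_cancel_left₀ hI₀]
    · filter_upwards [hoff] with z hz
      have t := ((tendsto_maskPyrX hT hΦ α hz.1.1 hz.1.2 hz.2.1 hz.2.2).const_mul
        (-(1 / 2))).const_mul I₀⁻¹
      refine t.congr fun k => ?_
      rw [← (hsm k (z 0) (z 1)).2.1, inv_mul_cancel_left₀ hI₀, ← combX_eq_comb, dataX, cons_coord]
  · have h := ae_eq_of_tendsto_data (a := a) (b := b) (c := c) (d := d) hT hΦ hG hGΦ α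
      (weightY I₀) (P := fun z => I₀⁻¹ * ((1 / 2) * pyrY (Set.Icc a b) (Set.Icc c d)
        (kKer α .circular) (lKer α T .circular) Φ (z 0) (z 1))) ?_
    · filter_upwards [h] with z hz
      rw [← combY_eq_comb] at hz
      rw [dataYL1, hz, mul_inv_cancel_left₀ hI₀]
    · filter_upwards [hoff] with z hz
      have t := ((tendsto_maskPyrY hT hΦ α hz.1.1 hz.1.2 hz.2.1 hz.2.2).const_mul
        (1 / 2)).const_mul I₀⁻¹
      refine t.congr fun k => ?_
      rw [← (hsm k (z 0) (z 1)).2.2, inv_mul_cancel_left₀ hI₀, ← combY_eq_comb, dataY, cons_coord]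

end Data

/-! ### The sensor without modulation as a special case -/

theorem kKer_nonmodulated (α : ℝ) : kKer α .nonmodulated = kKer 0 .circular := by
  ext x
  have := Real.pi_pos.ne'
  simp [kKer, besselJ0, this]

theorem lKer_nonmodulated {T : ℝ} (hT : 0 < T) (α : ℝ) :
    lKer α T .nonmodulated = lKer 0 T .circular := by
  ext x y
  simp [lKer]
  field_simp
  ring

theorem tilted_zero (T : ℝ) (Φ : Plane → ℝ) (t : ℝ) : tilted 0 T Φ t = Φ := by
  ext z
  simp [tilted, tilt]

theorem average_const {E : Type*} [NormedAddCommGroup E] [NormedSpace ℝ E] [CompleteSpace E] {T : ℝ}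
    (hT : 0 < T) (v : E) : (1 / T) • ∫ _ in (-T / 2)..(T / 2), v = v := by
  rw [intervalIntegral.integral_const, smul_smul]
  have : 1 / T * (T / 2 - -T / 2) = 1 := by field_simp; ring
  rw [this, one_smul]

section Nonmodulated

variable {T : ℝ} (I₀ α : ℝ) (M Φ : Plane → ℝ)

theorem dataX_nonmodulated (hT : 0 < T) (x y : ℝ) :
    dataX I₀ α T M .nonmodulated Φ x y = dataX I₀ 0 T M .circular Φ x y := by
  simp only [dataX, tilted_zero]
  exact (average_const hT _).symm

theorem dataY_nonmodulated (hT : 0 < T) (x y : ℝ) :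
    dataY I₀ α T M .nonmodulated Φ x y = dataY I₀ 0 T M .circular Φ x y := by
  simp only [dataY, tilted_zero]
  exact (average_const hT _).symm

theorem dataXL1_nonmodulated (hT : 0 < T) :
    dataXL1 I₀ α T M .nonmodulated Φ = dataXL1 I₀ 0 T M .circular Φ := by
  simp only [dataXL1, tilted_zero]
  exact (average_const hT _).symm

theorem dataYL1_nonmodulated (hT : 0 < T) :
    dataYL1 I₀ α T M .nonmodulated Φ = dataYL1 I₀ 0 T M .circular Φ := by
  simp only [dataYL1, tilted_zero]
  exact (average_const hT _).symm

theorem dataDefined_nonmodulated (h : DataDefined I₀ 0 T M .circular Φ) :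
    DataDefined I₀ α T M .nonmodulated Φ := by
  have h := h.1 0
  rwa [tilted_zero] at h

end Nonmodulated

end

end PyramidSensor

theorem theorem1 (r : ℕ) (hr : 0 < r) (lam D T I₀ : ℝ) (hlam : 0 < lam) (hD : 0 < D) (hT : 0 < T)
    (hI₀ : 0 < I₀) (Φ : Plane → ℝ) (hΦc : Continuous Φ) (hΦ : MemH (11 / 6) Φ) (μ : Regime) :
    -- smooth pupil masks: pointwise everywhere
    (∀ M : Plane → ℝ, ContDiff ℝ ∞ M → HasCompactSupport M →
      DataDefined I₀ (modParam r lam D) T M μ Φ ∧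
      ∀ x y : ℝ,
        MaskPyrDefined M (kKer (modParam r lam D) μ) (lKer (modParam r lam D) T μ) Φ x y ∧
        I₀ * dataX I₀ (modParam r lam D) T M μ Φ x y =
          -(1 / 2) * maskPyrX M (kKer (modParam r lam D) μ) (lKer (modParam r lam D) T μ) Φ x y ∧
        I₀ * dataY I₀ (modParam r lam D) T M μ Φ x y =
          (1 / 2) * maskPyrY M (kKer (modParam r lam D) μ) (lKer (modParam r lam D) T μ) Φ x y) ∧
    -- sharp pupils: almost everywhere
    (∀ aY bY aX bX : ℝ, aY < bY → aX < bX →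
      DataL1Defined I₀ (modParam r lam D) T
        (chi (pupil (Set.Icc aY bY) (Set.Icc aX bX))) μ Φ ∧
      (∀ x y : ℝ, x ≠ aY → x ≠ bY → y ≠ aX → y ≠ bX →
        PyrDefined (Set.Icc aY bY) (Set.Icc aX bX)
          (kKer (modParam r lam D) μ) (lKer (modParam r lam D) T μ) Φ x y) ∧
      (∀ᵐ z : Plane,
        I₀ * dataXL1 I₀ (modParam r lam D) T
            (chi (pupil (Set.Icc aY bY) (Set.Icc aX bX))) μ Φ z =
          -(1 / 2) * pyrX (Set.Icc aY bY) (Set.Icc aX bX)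
            (kKer (modParam r lam D) μ) (lKer (modParam r lam D) T μ) Φ (z 0) (z 1)) ∧
      (∀ᵐ z : Plane,
        I₀ * dataYL1 I₀ (modParam r lam D) T
            (chi (pupil (Set.Icc aY bY) (Set.Icc aX bX))) μ Φ z =
          (1 / 2) * pyrY (Set.Icc aY bY) (Set.Icc aX bX)
            (kKer (modParam r lam D) μ) (lKer (modParam r lam D) T μ) Φ (z 0) (z 1))) := by

  obtain ⟨G, hG, hG', hGΦ⟩ := exists_fourierInv_eq hΦc hΦ
  obtain ⟨C, hC, hΦC⟩ := exists_holder hG hG' hGΦ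
  have hW : HolderWave C Φ := ⟨hC, hΦc, hΦC⟩
  cases μ with
  | circular =>
    refine ⟨fun M hM hMc => smooth_circular hT hI₀.ne' hW hG hGΦ hM hMc _,
      fun aY bY aX bX _ _ => ?_⟩
    have h := sharp_circular hT hI₀.ne' hW hG hGΦ (modParam r lam D) aY bY aX bX
    exact ⟨h.1, fun x y h1 h2 h3 h4 => pyrDefined_circular hT hW _ h1 h2 h3 h4, h.2⟩
  | nonmodulated =>
    simp only [kKer_nonmodulated, lKer_nonmodulated hT, dataX_nonmodulated _ _ _ _ hT,
      dataY_nonmodulated _ _ _ _ hT, dataXL1_nonmodulated _ _ _ _ hT,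
      dataYL1_nonmodulated _ _ _ _ hT]
    refine ⟨fun M hM hMc => ?_, fun aY bY aX bX _ _ => ?_⟩
    · have h := smooth_circular hT hI₀.ne' hW hG hGΦ hM hMc 0
      exact ⟨dataDefined_nonmodulated _ _ _ _ h.1, h.2⟩
    · have h := sharp_circular hT hI₀.ne' hW hG hGΦ 0 aY bY aX bX
      exact ⟨trivial, fun x y h1 h2 h3 h4 => pyrDefined_circular hT hW _ h1 h2 h3 h4, h.2⟩
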